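/- Let $\mathbb S^n=\{x\in\mathbb R^{n+1}: \langle x,x\rangle=1\}$ with $\langle x,y\rangle=\sum_{i\le n+1}x_iy_i$, and let $\mathbb H^n=\{x\in\mathbb R^{n+1}:\langle x,x\rangle=-1,\ x_{n+1}>0\}$ with $\langle x,y\rangle=\sum_{i\le n}x_iy_i-x_{n+1}y_{n+1}$ (hyperboloid model), each with the geodesic distance $d$ ($\cos d(x,y)=\langle x,y\rangle$, $0\le d\le\pi$, respectively $\cosh d(x,y)=-\langle x,y\rangle$, $d\ge 0$) and the $n$-dimensional Riemannian volume $\mathrm{Vol}$. *Solids.* For a circle of radius $R$ in a totally geodesic plane of $\mathbb S^3$ or $\mathbb H^3$, the solid torus with radii $R,r$ is the union, over the points $q$ of the circle, of the closed discs of centre $q$ and radius $r$ in the totally geodesic hyperplane through $q$ perpendicular to the circle. For points $o,p$ with $d(o,p)=h$, and a subset $B$ of the totally geodesic hyperplane through $p$ perpendicular to the geodesic $op$, the cone with apex $o$ and base $B$ is the union of the geodesic segments from $o$ to the points of $B$. It is called the right cone of radius $r$ and height $h$ if $B=B^{n-1}(r)$ is the closed ball of centre $p$ and radius $r$ in that hyperplane.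 A regular $n$-gonal disc of side $a$ and centre $p$ is the geodesic convex hull of $n$ points that are equally spaced on a circle of centre $p$ in a totally geodesic plane (in the spherical case, of radius less than $\pi/2$), with consecutive points at distance $a$. 1. *Solid tori.* In $\mathbb S^3$, if $0<r\le R$ and $r+R\le\pi$, the solid torus has volume $2\pi^2\sin R\,\sin^2 r$. In $\mathbb H^3$, if $0<r\le R$, it has volume $2\pi^2\sinh R\,\sinh^2 r$. 2. *Right circular cones.* In $\mathbb S^3$, for $0<r<\pi/2$ and $0<h<\pi/2$, the right cone of radius $r$ and height $h$ has volume $$\pi\left(h-\frac{\sin h}{\sqrt{\tan^2 r+\sin^2 h}}\arctan\frac{\sqrt{\tan^2 r+\sin^2 h}}{\cos h}\right).$$ In $\mathbb H^3$, for $r,h>0$, it has volume $$\pi\left(-h+\frac{\sinh h}{\sqrt{\tanh^2 r+\sinh^2 h}}\operatorname{artanh}\frac{\sqrt{\tanh^2 r+\sinh^2 h}}{\cosh h}\right).$$ 3. *Cones over balls.* Let $n\ge 1$. In $\mathbb S^n$, for $0<r\le\pi/2$ and $0<h<\pi$, the right cone of radius $r$ and height $h$ has volume $$\frac{\pi^{\frac{n-1}2}}{\Gamma(\frac{n+1}2)}\int_0^h\frac{dt}{(a^2\csc^2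 t+1)^{\frac{n-1}2}},\qquad a=\cot r\,\sin h.$$ In $\mathbb H^n$, for $r,h>0$, it has volume $$\frac{\pi^{\frac{n-1}2}}{\Gamma(\frac{n+1}2)}\int_0^h\frac{dt}{(a^2\operatorname{csch}^2 t-1)^{\frac{n-1}2}},\qquad a=\coth r\,\sinh h.$$ 4. *Cones over regular polygons.* Let $n\ge 3$. In $\mathbb S^3$, for $0<h<\pi$, the cone of height $h$ whose base is a regular $n$-gonal disc of side $a$, centred at $p$ and contained in the hyperplane through $p$ perpendicular to $op$, has volume $$\int_0^h\frac{n}{\sqrt{1+\cot^2 b\,\sin^2 h\,\csc^2 t}}\arctan\left(\frac{\tan\frac{\pi}{n}}{\sqrt{1+\cot^2 b\,\sin^2 h\,\csc^2 t}}\right)dt,$$ where $b\in(0,\pi/2)$ is given by $\cot^2 b=\tan^2\frac{\pi}{n}\cot^2\frac a2-1$. In $\mathbb H^3$, for $h>0$, the analogous cone has volume $$\int_0^h\frac{n}{\sqrt{-1+\coth^2 b\,\sinh^2 h\,\operatorname{csch}^2 t}}\operatorname{artanh}\left(\frac{\tan\frac{\pi}{n}}{\sqrt{-1+\coth^2 b\,\sinh^2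 h\,\operatorname{csch}^2 t}}\right)dt,$$ where $b>0$ is given by $\coth^2 b=\tan^2\frac{\pi}{n}\coth^2\frac a2+1$. -/

import Mathlib

open MeasureTheory
open scoped Matrix Real ENNReal

noncomputable section

namespace NonEuclid

/-- The two non-Euclidean geometries. -/
inductive Geometry
  | spherical
  | hyperbolic

/-- The sign of the last coordinate in the bilinear form: `1` for the sphere, `-1` for the
hyperboloid model of hyperbolic space. -/
def Geometry.sign : Geometry → ℝ
  | .spherical => 1
  | .hyperbolic => -1

/-- The trigonometric or hyperbolic sine, according to the geometry. -/
def Geometry.sinX : Geometry → ℝ → ℝ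
  | .spherical => Real.sin
  | .hyperbolic => Real.sinh

/-- The trigonometric or hyperbolic cosine, according to the geometry. -/
def Geometry.cosX : Geometry → ℝ → ℝ
  | .spherical => Real.cos
  | .hyperbolic => Real.cosh

/-- The matrix `diag(1, …, 1, ±1)` of size `n + 1`. -/
def formMatrix (X : Geometry) (n : ℕ) : Matrix (Fin (n + 1)) (Fin (n + 1)) ℝ :=
  Matrix.diagonal (fun i => if i = Fin.last n then X.sign else 1)

/-- The symmetric bilinear form `⟨a, b⟩ = a₁b₁ + ⋯ + aₙbₙ ± aₙ₊₁bₙ₊₁` on `ℝⁿ⁺¹`. -/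
def form (X : Geometry) {n : ℕ} (a b : Fin (n + 1) → ℝ) : ℝ :=
  b ⬝ᵥ (formMatrix X n *ᵥ a)

/-- The points of the `n`-dimensional space: the unit sphere of `ℝⁿ⁺¹`, or the upper sheet
`⟨x, x⟩ = -1`, `xₙ₊₁ > 0` of the hyperboloid. -/
def space : Geometry → (n : ℕ) → Set (Fin (n + 1) → ℝ)
  | .spherical, _ => {x | form .spherical x x = 1}
  | .hyperbolic, n => {x | form .hyperbolic x x = -1 ∧ 0 < x (Fin.last n)}

/-- The geodesic distance between two points of the space: `cos d = ⟨a, b⟩` with `0 ≤ d ≤ π` on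
the sphere, `cosh d = -⟨a, b⟩` with `0 ≤ d` in hyperbolic space. -/
def gdist : (X : Geometry) → {n : ℕ} → (a b : Fin (n + 1) → ℝ) → ℝ
  | .spherical, _, a, b => Real.arccos (form .spherical a b)
  | .hyperbolic, _, a, b => Real.arcosh (-form .hyperbolic a b)

/-! ### Volume -/

/-- The Jacobian matrix of a parametrization `f` at `s`. -/
def jacobian {k n : ℕ} (f : (Fin k → ℝ) → (Fin (n + 1) → ℝ)) (s : Fin k → ℝ) :
    Matrix (Fin (n + 1)) (Fin k) ℝ :=
  LinearMap.toMatrix' (fderiv ℝ f s : (Fin k → ℝ) →ₗ[ℝ] (Fin (n + 1) → ℝ))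

/-- The density of the volume element of a parametrization `f` at `s`: the square root of the
Gram determinant `det (Dfᵀ J Df)`. -/
def volumeElement (X : Geometry) {k n : ℕ} (f : (Fin k → ℝ) → (Fin (n + 1) → ℝ))
    (s : Fin k → ℝ) : ℝ :=
  √((jacobian f s)ᵀ * formMatrix X n * jacobian f s).det

/-- The parametrization of the part `ε xₙ₊₁ > 0` of the space (`ε = ±1`) by its first `n`
coordinates, `x ↦ (x, ε √(1 ∓ |x|²))`. -/
def graphChart (X : Geometry) {n : ℕ} (ε : ℝ) (x : Fin n → ℝ) : Fin (n + 1) → ℝ :=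
  Fin.snoc (α := fun _ => ℝ) x (ε * √(1 - X.sign * (x ⬝ᵥ x)))

/-- The `n`-dimensional Riemannian volume of a subset `A` of the space, as the integral of the
volume element. Hyperbolic space is covered by one chart with domain `ℝⁿ`; the sphere is covered,
up to its equator, which is a null set, by the two charts of the open hemispheres. -/
def vol : (X : Geometry) → {n : ℕ} → Set (Fin (n + 1) → ℝ) → ℝ≥0∞
  | .spherical, n, A =>
      (∫⁻ x in {x : Fin n → ℝ | x ⬝ᵥ x < 1 ∧ graphChart .spherical 1 x ∈ A},
        ENNReal.ofReal (volumeElement .spherical (graphChart .spherical 1) x)) +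
      ∫⁻ x in {x : Fin n → ℝ | x ⬝ᵥ x < 1 ∧ graphChart .spherical (-1) x ∈ A},
        ENNReal.ofReal (volumeElement .spherical (graphChart .spherical (-1)) x)
  | .hyperbolic, n, A =>
      ∫⁻ x in {x : Fin n → ℝ | graphChart .hyperbolic 1 x ∈ A},
        ENNReal.ofReal (volumeElement .hyperbolic (graphChart .hyperbolic 1) x)

/-! ### Solids -/

/-- The hyperplane through the point `p` of the space that is perpendicular to the geodesic from
`p` to `o`; the vector `o - (⟨o, p⟩ / ⟨p, p⟩) p` is the component of `o` tangent to the space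
at `p`. -/
def perpHyperplane (X : Geometry) {n : ℕ} (p o : Fin (n + 1) → ℝ) : Set (Fin (n + 1) → ℝ) :=
  {x ∈ space X n | form X x (o - (form X o p / form X p p) • p) = 0}

/-- The geodesic segment between two (not antipodal) points `x`, `y`. -/
def geodesicSegment (X : Geometry) {n : ℕ} (x y : Fin (n + 1) → ℝ) : Set (Fin (n + 1) → ℝ) :=
  {z ∈ space X n | ∃ s t : ℝ, 0 ≤ s ∧ 0 ≤ t ∧ z = s • x + t • y}

/-- The solid cone with apex `o` over the base `B`: the union of the geodesic segments from `o`
to the points of `B`. -/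
def coneOver (X : Geometry) {n : ℕ} (o : Fin (n + 1) → ℝ) (B : Set (Fin (n + 1) → ℝ)) :
    Set (Fin (n + 1) → ℝ) :=
  ⋃ x ∈ B, geodesicSegment X o x

/-- The right cone with apex `o` whose base is the `(n - 1)`-dimensional closed ball of centre `p`
and radius `r` in the hyperplane through `p` perpendicular to the geodesic from `p` to `o`. -/
def rightBallCone (X : Geometry) {n : ℕ} (o p : Fin (n + 1) → ℝ) (r : ℝ) :
    Set (Fin (n + 1) → ℝ) :=
  coneOver X o {x ∈ perpHyperplane X p o | gdist X p x ≤ r}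

/-- `e₁`, `e₂` are orthonormal tangent vectors at the point `p` of the space. -/
def IsTangentFrame (X : Geometry) {n : ℕ} (p e₁ e₂ : Fin (n + 1) → ℝ) : Prop :=
  p ∈ space X n ∧ form X e₁ e₁ = 1 ∧ form X e₂ e₂ = 1 ∧ form X e₁ e₂ = 0 ∧
    form X e₁ p = 0 ∧ form X e₂ p = 0

/-- The point at angle `θ` on the circle of centre `p` and (geodesic) radius `R` in the plane
through `p` spanned by the tangent vectors `e₁`, `e₂`. -/
def circlePoint (X : Geometry) {n : ℕ} (p e₁ e₂ : Fin (n + 1) → ℝ) (R θ : ℝ) :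
    Fin (n + 1) → ℝ :=
  X.cosX R • p + X.sinX R • (Real.cos θ • e₁ + Real.sin θ • e₂)

/-- The direction of the tangent of that circle at the point at angle `θ`. -/
def circleTangent {n : ℕ} (e₁ e₂ : Fin (n + 1) → ℝ) (θ : ℝ) : Fin (n + 1) → ℝ :=
  (-Real.sin θ) • e₁ + Real.cos θ • e₂

/-- The solid torus: the union, over the points `q` of the circle of centre `p` and radius `R`, of
the closed discs of centre `q` and radius `r` in the hyperplanes through `q` perpendicular to the
circle. -/
def solidTorus (X : Geometry) {n : ℕ} (p e₁ e₂ : Fin (n + 1) → ℝ) (R r : ℝ) :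
    Set (Fin (n + 1) → ℝ) :=
  ⋃ θ : ℝ, {x ∈ space X n | form X x (circleTangent e₁ e₂ θ) = 0 ∧
    gdist X (circlePoint X p e₁ e₂ R θ) x ≤ r}

/-- The geodesic convex hull of finitely many points of the space (lying, on the sphere, in an
open hemisphere). -/
def geodesicHull (X : Geometry) {n m : ℕ} (v : Fin m → Fin (n + 1) → ℝ) :
    Set (Fin (n + 1) → ℝ) :=
  {x ∈ space X n | ∃ w : Fin m → ℝ, (∀ k, 0 ≤ w k) ∧ x = ∑ k, w k • v k}

/-- `P` is a regular `m`-gonal disc with centre `p` and side length `a`: the convex hull of `m`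
points equally spaced on a circle of centre `p` in some plane through `p`, two consecutive ones of
which are at distance `a`. On the sphere the radius of that circle is less than `π / 2`. -/
def IsRegularPolygon (X : Geometry) {n : ℕ} (m : ℕ) (a : ℝ) (p : Fin (n + 1) → ℝ)
    (P : Set (Fin (n + 1) → ℝ)) : Prop :=
  ∃ (e₁ e₂ : Fin (n + 1) → ℝ) (c : ℝ), IsTangentFrame X p e₁ e₂ ∧ 0 < c ∧
    (X = .spherical → c < π / 2) ∧
    gdist X (circlePoint X p e₁ e₂ c 0) (circlePoint X p e₁ e₂ c (2 * π / m)) = a ∧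
    P = geodesicHull X (fun k : Fin m => circlePoint X p e₁ e₂ c (2 * π * k / m))

end NonEuclid

end

open NonEuclid

namespace NonEuclid

/-! ### The bilinear form -/

section Form

variable {X : Geometry} {n : ℕ}

/-! Write `σ` for `X.sign`, and `sin`, `cos` for `X.sinX`, `X.cosX`. The proof turns Riemannian
volume into Lebesgue measure, in two stages.

First, the position vector of a point of the space has square `σ` and is orthogonal, for the form,
to all tangent vectors. Hence the Gram determinant of a parametrization `ψ` is, up to a power of
`s`, the squared Jacobian of `(s, u) ↦ s ψ(u)`; here the form enters only through its determinant
`±1`. Integrating over `0 < s ≤ 1`, the volume of `A` is `n + 1` times the Lebesgue measure of the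
Euclidean cone over `A` (`vol_eq_volume_euclCone`). No chart occurs in the latter, so `vol` may be
computed in any chart that misses only a part of a linear hyperplane (`vol_eq_lintegral_chart`).

Second, some charts have density one, in the manner of Archimedes' theorem on the sphere and the
cylinder. Let `E(t)` run with unit speed along a circle or hyperbola in a plane, let `d` be an
orthonormal frame of the complement, and send `(t, v)` to `ρ(v) E(t) + ∑ vᵢ dᵢ`, with `ρ(v)` chosen
so that the point lies in the space. The factor `ρ` lost in the direction of `t` is regained in the
directions of `v` (`volumeElement_cyl`), so the volume is the Lebesgue measure of the set of
parameters (`IsCylinder.vol_eq`).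

For a torus, `E` rotates in the plane of `e₁`, `e₂`. Maximizing over the angle makes membership one
inequality, independent of `t`. It describes an ellipse with semi-axes `sin R sin r` and `sin r`,
whence the volume `2π · π sin R sin² r` (`vol_solidTorus`).

For a cone, `E` follows the geodesic from `o` to `p`. The base is cut out of its hyperplane by
conditions homogeneous in the coordinates orthogonal to `o`. Adding a multiple of `o` does not
change these, so the cone obeys the same conditions together with `0 ≤ t ≤ h` (`coneOver_eq`,
`vol_coneOver`), and its volume is the integral over `t` of the Euclidean volumes of the slices.
Over a ball the slices are Euclidean balls (`vol_rightBallCone`); in dimension 3 the remaining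
integral is elementary. Over a regular polygon the slices are star-shaped with `n`-fold symmetry,
and polar coordinates reduce their area to an integral over one sector (`volume_polygonSlice`),
which is an `arctan` or an `artanh`. -/

lemma form_eq (a b : Fin (n + 1) → ℝ) :
    form X a b = ∑ i : Fin n, a i.castSucc * b i.castSucc +
      X.sign * a (Fin.last n) * b (Fin.last n) := by
  simp only [form, formMatrix, dotProduct, Matrix.mulVec_diagonal, Fin.sum_univ_castSucc,
    Fin.castSucc_ne_last, if_false, if_true, one_mul]
  congr 1
  · exact Finset.sum_congr rfl fun i _ => mul_comm _ _
  · ring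

lemma form_comm (a b : Fin (n + 1) → ℝ) : form X a b = form X b a := by
  simp only [form_eq]
  congr 1
  · exact Finset.sum_congr rfl fun i _ => mul_comm _ _
  · ring

@[simp] lemma form_add_right (a b c : Fin (n + 1) → ℝ) :
    form X a (b + c) = form X a b + form X a c := by
  simp [form, add_dotProduct]

@[simp] lemma form_smul_right (s : ℝ) (a b : Fin (n + 1) → ℝ) :
    form X a (s • b) = s * form X a b := by
  simp [form]

@[simp] lemma form_add_left (a b c : Fin (n + 1) → ℝ) :
    form X (a + b) c = form X a c + form X b c := by
  simp only [form_comm _ c, form_add_right]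

@[simp] lemma form_smul_left (s : ℝ) (a b : Fin (n + 1) → ℝ) :
    form X (s • a) b = s * form X a b := by
  simp only [form_comm _ b, form_smul_right]

/-- The form as a bilinear form. -/
def formBilin (X : Geometry) (n : ℕ) : LinearMap.BilinForm ℝ (Fin (n + 1) → ℝ) :=
  LinearMap.mk₂ ℝ (form X) form_add_left form_smul_left form_add_right
    fun s a b => form_smul_right s a b

@[simp] lemma formBilin_apply (a b : Fin (n + 1) → ℝ) : formBilin X n a b = form X a b := rfl

@[simp] lemma form_sum_right {ι : Type*} (s : Finset ι) (a : Fin (n + 1) → ℝ)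
    (f : ι → Fin (n + 1) → ℝ) : form X a (∑ i ∈ s, f i) = ∑ i ∈ s, form X a (f i) :=
  map_sum (formBilin X n a) f s

@[simp] lemma form_sum_left {ι : Type*} (s : Finset ι) (a : Fin (n + 1) → ℝ)
    (f : ι → Fin (n + 1) → ℝ) : form X (∑ i ∈ s, f i) a = ∑ i ∈ s, form X (f i) a := by
  simp only [form_comm _ a, form_sum_right]

@[simp] lemma form_neg_right (a b : Fin (n + 1) → ℝ) : form X a (-b) = -form X a b :=
  map_neg (formBilin X n a) b

@[simp] lemma form_neg_left (a b : Fin (n + 1) → ℝ) : form X (-a) b = -form X a b := by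
  simp only [form_comm _ b, form_neg_right]

@[simp] lemma form_sub_right (a b c : Fin (n + 1) → ℝ) :
    form X a (b - c) = form X a b - form X a c :=
  map_sub (formBilin X n a) b c

@[simp] lemma form_sub_left (a b c : Fin (n + 1) → ℝ) :
    form X (a - b) c = form X a c - form X b c := by
  simp only [form_comm _ c, form_sub_right]

@[fun_prop]
lemma measurable_form {α : Type*} [MeasurableSpace α] {f g : α → Fin (n + 1) → ℝ}
    (hf : Measurable f) (hg : Measurable g) : Measurable fun x => form X (f x) (g x) := by
  simp only [form_eq]
  fun_prop

lemma sign_mul_sign (X : Geometry) : X.sign * X.sign = 1 := by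
  cases X <;> simp [Geometry.sign]

lemma sign_ne_zero (X : Geometry) : X.sign ≠ 0 := by
  cases X <;> simp [Geometry.sign]

lemma form_self_of_mem_space {x : Fin (n + 1) → ℝ} (hx : x ∈ space X n) :
    form X x x = X.sign := by
  cases X
  · exact hx
  · exact hx.1

lemma det_formMatrix (X : Geometry) (n : ℕ) : (formMatrix X n).det = X.sign := by
  simp [formMatrix, Matrix.det_diagonal, Finset.prod_ite_eq']

lemma gram_apply {k : ℕ} (f : (Fin k → ℝ) → (Fin (n + 1) → ℝ)) (s : Fin k → ℝ) (i j : Fin k) :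
    ((jacobian f s)ᵀ * formMatrix X n * jacobian f s) i j =
      form X (fderiv ℝ f s (Pi.single j 1)) (fderiv ℝ f s (Pi.single i 1)) := by
  rw [Matrix.mul_assoc]
  simp only [form, Matrix.mul_apply, Matrix.transpose_apply, dotProduct, Matrix.mulVec, jacobian,
    LinearMap.toMatrix'_apply]
  rfl

/-- Multiplicativity of the determinant; since the form has determinant `±1`, the volume it induces
on the ambient space is Lebesgue measure in both geometries. -/
lemma det_gram_eq {f : (Fin (n + 1) → ℝ) → (Fin (n + 1) → ℝ)} {s : Fin (n + 1) → ℝ} :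
    ((jacobian f s)ᵀ * formMatrix X n * jacobian f s).det = X.sign * (fderiv ℝ f s).det ^ 2 := by
  rw [Matrix.det_mul, Matrix.det_mul, Matrix.det_transpose, det_formMatrix, jacobian,
    LinearMap.det_toMatrix']
  simp only [ContinuousLinearMap.det]
  ring

end Form

/-! ### Volume and Euclidean cones -/

section Volume

variable {X : Geometry} {n : ℕ}

/-- The part of the Euclidean cone over `B` between the origin and `B`. -/
def euclCone (B : Set (Fin (n + 1) → ℝ)) : Set (Fin (n + 1) → ℝ) :=
  {y | ∃ s ∈ Set.Ioc (0 : ℝ) 1, ∃ x ∈ B, y = s • x}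

/-- The map `(s, u) ↦ s ψ(u)`. -/
def coneMap (ψ : (Fin n → ℝ) → (Fin (n + 1) → ℝ)) (y : Fin (n + 1) → ℝ) : Fin (n + 1) → ℝ :=
  y 0 • ψ (fun i => y i.succ)

/-- The map `fderiv` is measurable for every `f`, so no regularity has to be assumed. -/
lemma measurable_volumeElement {k : ℕ} (f : (Fin k → ℝ) → (Fin (n + 1) → ℝ)) :
    Measurable (volumeElement X f) := by
  have h : ∀ i j, Measurable fun s => ((jacobian f s)ᵀ * formMatrix X n * jacobian f s) i j := by
    intro i j
    simp only [gram_apply]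
    have h := measurable_fderiv ℝ f
    exact measurable_form (h.apply_continuousLinearMap _) (h.apply_continuousLinearMap _)
  unfold volumeElement
  simp only [Matrix.det_apply]
  refine Measurable.sqrt (Finset.measurable_sum _ fun σ _ => ?_)
  exact Measurable.const_smul (Finset.measurable_prod _ fun i _ => h _ _) _

lemma hasFDerivAt_coneMap {ψ : (Fin n → ℝ) → (Fin (n + 1) → ℝ)} {y : Fin (n + 1) → ℝ}
    (hψ : DifferentiableAt ℝ ψ (fun i => y i.succ)) :
    HasFDerivAt (coneMap ψ)
      (y 0 • (fderiv ℝ ψ (fun i => y i.succ)).comp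
        (ContinuousLinearMap.pi fun i : Fin n => ContinuousLinearMap.proj (R := ℝ) i.succ) +
        (ContinuousLinearMap.proj (R := ℝ) (φ := fun _ : Fin (n + 1) => ℝ) 0).smulRight
          (ψ fun i => y i.succ)) y := by
  have h1 : HasFDerivAt (fun y : Fin (n + 1) → ℝ => y 0)
      (ContinuousLinearMap.proj (R := ℝ) (φ := fun _ : Fin (n + 1) => ℝ) 0) y :=
    (ContinuousLinearMap.proj (R := ℝ) (φ := fun _ : Fin (n + 1) => ℝ) 0).hasFDerivAt
  have h2 : HasFDerivAt (fun (y : Fin (n + 1) → ℝ) (i : Fin n) => y i.succ)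
      (ContinuousLinearMap.pi fun i : Fin n => ContinuousLinearMap.proj (R := ℝ) i.succ) y :=
    (ContinuousLinearMap.pi fun i : Fin n => ContinuousLinearMap.proj (R := ℝ)
      (φ := fun _ : Fin (n + 1) => ℝ) i.succ).hasFDerivAt
  exact h1.smul (hψ.hasFDerivAt.comp y h2)

/-- Differentiating the constant `⟨ψ, ψ⟩`: tangent vectors are orthogonal to the position vector. -/
lemma form_fderiv_eq_zero {ψ : (Fin n → ℝ) → (Fin (n + 1) → ℝ)} {u : Fin n → ℝ}
    (hψ : DifferentiableAt ℝ ψ u) (hs : ∀ᶠ v in nhds u, form X (ψ v) (ψ v) = X.sign)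
    (w : Fin n → ℝ) : form X (fderiv ℝ ψ u w) (ψ u) = 0 := by
  have h := hψ.hasFDerivAt
  have hlin : ∀ a, HasFDerivAt (fun v => form X a (ψ v))
      ((LinearMap.toContinuousLinearMap (formBilin X n a)).comp (fderiv ℝ ψ u)) u := fun a =>
    (LinearMap.toContinuousLinearMap (formBilin X n a)).hasFDerivAt.comp u h
  have hc : ∀ i, HasFDerivAt (fun v => ψ v i)
      ((ContinuousLinearMap.proj (R := ℝ) i).comp (fderiv ℝ ψ u)) u := fun i =>
    hasFDerivAt_pi'.1 h i
  have h1 : HasFDerivAt (fun v => form X (ψ v) (ψ v))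
      (∑ i : Fin n, (ψ u i.castSucc • (ContinuousLinearMap.proj (R := ℝ) i.castSucc).comp
          (fderiv ℝ ψ u) + ψ u i.castSucc • (ContinuousLinearMap.proj (R := ℝ) i.castSucc).comp
          (fderiv ℝ ψ u)) + X.sign • (ψ u (Fin.last n) •
          (ContinuousLinearMap.proj (R := ℝ) (Fin.last n)).comp (fderiv ℝ ψ u) +
          ψ u (Fin.last n) •
          (ContinuousLinearMap.proj (R := ℝ) (Fin.last n)).comp (fderiv ℝ ψ u))) u := by
    simp only [form_eq, mul_assoc]
    exact (HasFDerivAt.fun_sum fun i _ => (hc _).mul (hc _)).add (((hc _).mul (hc _)).const_mul _)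
  have h2 : HasFDerivAt (fun v => form X (ψ v) (ψ v)) (0 : (Fin n → ℝ) →L[ℝ] ℝ) u :=
    (hasFDerivAt_const X.sign u).congr_of_eventuallyEq hs
  have h3 := congrArg (fun L => L w) (h1.unique h2)
  simp only [add_apply, sum_apply,
    smul_apply, ContinuousLinearMap.comp_apply, ContinuousLinearMap.proj_apply,
    smul_eq_mul, zero_apply, ← two_mul, mul_left_comm _ (2 : ℝ),
    ← Finset.mul_sum] at h3
  rw [form_comm, form_eq, mul_assoc]
  linarith

/-- The Gram matrix of `coneMap ψ` splits into the radial entry `σ` and `(y 0)²` times the Gram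
matrix of `ψ`. Its determinant is also `σ` times the square of the Jacobian determinant; comparison
gives the formula. -/
lemma abs_det_fderiv_coneMap {ψ : (Fin n → ℝ) → (Fin (n + 1) → ℝ)} {y : Fin (n + 1) → ℝ}
    (hψ : DifferentiableAt ℝ ψ (fun i => y i.succ))
    (hs : ∀ᶠ v in nhds (fun i => y i.succ), form X (ψ v) (ψ v) = X.sign) (hy : 0 < y 0) :
    |(fderiv ℝ (coneMap ψ) y).det| = y 0 ^ n * volumeElement X ψ (fun i => y i.succ) := by
  set u : Fin n → ℝ := fun i => y i.succ with hu
  have hf := (hasFDerivAt_coneMap hψ).fderiv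
  have e0 : fderiv ℝ (coneMap ψ) y (Pi.single 0 1) = ψ u := by
    rw [hf]
    have : (ContinuousLinearMap.pi fun i : Fin n => ContinuousLinearMap.proj (R := ℝ)
        (φ := fun _ : Fin (n + 1) => ℝ) i.succ) (Pi.single 0 1) = 0 := by
      ext i; simp
    simp [this, hu]
  have e1 : ∀ i : Fin n, fderiv ℝ (coneMap ψ) y (Pi.single i.succ 1) =
      y 0 • fderiv ℝ ψ u (Pi.single i 1) := by
    intro i
    rw [hf]
    have : (ContinuousLinearMap.pi fun i : Fin n => ContinuousLinearMap.proj (R := ℝ)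
        (φ := fun _ : Fin (n + 1) => ℝ) i.succ) (Pi.single i.succ 1) = Pi.single i 1 := by
      ext j; simp [Pi.single_apply]
    simp [this, hu]
  have ht := form_fderiv_eq_zero hψ hs
  have h1 : X.sign * (fderiv ℝ (coneMap ψ) y).det ^ 2 =
      X.sign * (y 0 ^ (2 * n) * ((jacobian ψ u)ᵀ * formMatrix X n * jacobian ψ u).det) := by
    -- Row `0` belongs to the radial vector `ψ u`, which is orthogonal to the tangent vectors, so
    -- only its diagonal entry survives.
    rw [← det_gram_eq, Matrix.det_succ_row_zero, Fin.sum_univ_succ]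
    rw [Finset.sum_eq_zero (fun j _ => ?_)]
    · have : ((jacobian (coneMap ψ) y)ᵀ * formMatrix X n * jacobian (coneMap ψ) y).submatrix
          Fin.succ (Fin.succAbove 0) =
          (y 0 ^ 2) • ((jacobian ψ u)ᵀ * formMatrix X n * jacobian ψ u) := by
        ext i j
        rw [Matrix.submatrix_apply, Matrix.smul_apply, gram_apply, gram_apply,
          Fin.succAbove_zero, e1, e1]
        simp only [form_smul_left, form_smul_right, smul_eq_mul]
        ring
      rw [this, Matrix.det_smul, gram_apply, e0, hs.self_of_nhds]
      simp [pow_mul]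
    · rw [gram_apply, e1, e0, form_smul_left, ht]
      simp
  have h2 := mul_left_cancel₀ (sign_ne_zero X) h1
  rw [volumeElement, ← Real.sqrt_sq_eq_abs, h2, Real.sqrt_mul (by positivity), mul_comm 2 n,
    pow_mul, Real.sqrt_sq (by positivity)]

/-- The volume element of a chart of the space computes the Lebesgue measure of the Euclidean cone
over the image of the chart. -/
theorem lintegral_volumeElement {ψ : (Fin n → ℝ) → (Fin (n + 1) → ℝ)} {U : Set (Fin n → ℝ)}
    (hU : MeasurableSet U) (hψ : ∀ u ∈ U, DifferentiableAt ℝ ψ u)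
    (hs : ∀ u ∈ U, ∀ᶠ v in nhds u, form X (ψ v) (ψ v) = X.sign) (hinj : Set.InjOn ψ U) :
    ∫⁻ u in U, ENNReal.ofReal (volumeElement X ψ u) = (n + 1) * volume (euclCone (ψ '' U)) := by
  set S : Set (Fin (n + 1) → ℝ) := {y | y 0 ∈ Set.Ioc (0 : ℝ) 1 ∧ (fun i => y i.succ) ∈ U} with hS
  have hSm : MeasurableSet S := by
    refine MeasurableSet.inter ?_ ?_
    · exact (measurable_pi_apply 0) measurableSet_Ioc
    · exact (measurable_pi_lambda _ fun i => measurable_pi_apply _) hU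
  have himg : coneMap ψ '' S = euclCone (ψ '' U) := by
    ext z
    constructor
    · rintro ⟨y, hy, rfl⟩
      exact ⟨y 0, hy.1, _, ⟨_, hy.2, rfl⟩, rfl⟩
    · rintro ⟨s, hs, _, ⟨u, hu, rfl⟩, rfl⟩
      exact ⟨Fin.cons s u, ⟨by simpa using hs, by simpa using hu⟩, by simp [coneMap]⟩
  have hSinj : Set.InjOn (coneMap ψ) S := by
    intro y hy z hz hyz
    -- The form takes the value `s² σ` at `s ψ(u)`, which recovers `s > 0`, and then `ψ(u)`.
    have e := congrArg (fun a => form X a a) hyz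
    simp only [coneMap, form_smul_left, form_smul_right, (hs _ hy.2).self_of_nhds,
      (hs _ hz.2).self_of_nhds, ← mul_assoc] at e
    have e1 := mul_right_cancel₀ (sign_ne_zero X) e
    have e2 : y 0 = z 0 := by
      have := hy.1.1; have := hz.1.1
      nlinarith
    have e3 : ψ (fun i => y i.succ) = ψ (fun i => z i.succ) := by
      have := hyz
      simp only [coneMap, e2] at this
      exact smul_right_injective _ hz.1.1.ne' this
    have e4 := hinj hy.2 hz.2 e3
    ext i
    refine Fin.cases e2 (fun j => congrFun e4 j) i
  have h1 := lintegral_abs_det_fderiv_eq_addHaar_image (volume : Measure (Fin (n + 1) → ℝ)) hSm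
    (f := coneMap ψ) (f' := fderiv ℝ (coneMap ψ))
    (fun y hy => ((hasFDerivAt_coneMap (hψ _ hy.2)).differentiableAt.hasFDerivAt).hasFDerivWithinAt)
    hSinj
  rw [himg] at h1
  rw [← h1, setLIntegral_congr_fun (g := fun y => ENNReal.ofReal (y 0 ^ n) *
    ENNReal.ofReal (volumeElement X ψ fun i => y i.succ)) hSm]
  swap
  · intro y hy
    dsimp only
    rw [abs_det_fderiv_coneMap (hψ _ hy.2) (hs _ hy.2) hy.1.1,
      ENNReal.ofReal_mul (pow_nonneg hy.1.1.le _)]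
  have h2 := (volume_preserving_piFinSuccAbove (fun _ : Fin (n + 1) => ℝ) 0)
  have h3 : S = MeasurableEquiv.piFinSuccAbove (fun _ : Fin (n + 1) => ℝ) 0 ⁻¹'
      (Set.Ioc 0 1 ×ˢ U) := by
    ext y
    simp [hS, Fin.tail_def]
  have h4 := h2.setLIntegral_comp_preimage_emb (MeasurableEquiv.measurableEmbedding _)
    (fun p : ℝ × (Fin n → ℝ) => ENNReal.ofReal (p.1 ^ n) *
      ENNReal.ofReal (volumeElement X ψ p.2)) (Set.Ioc 0 1 ×ˢ U)
  rw [← h3] at h4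
  have h5 : (∫⁻ y in S, ENNReal.ofReal (y 0 ^ n) *
      ENNReal.ofReal (volumeElement X ψ fun i => y i.succ)) =
      ∫⁻ p in Set.Ioc (0 : ℝ) 1 ×ˢ U, ENNReal.ofReal (p.1 ^ n) *
        ENNReal.ofReal (volumeElement X ψ p.2) := by
    rw [← h4]; rfl
  rw [h5, Measure.volume_eq_prod, ← Measure.prod_restrict,
    lintegral_prod_mul (f := fun s : ℝ => ENNReal.ofReal (s ^ n))
      (g := fun u => ENNReal.ofReal (volumeElement X ψ u)) (by fun_prop)
      (measurable_volumeElement ψ).ennreal_ofReal.aemeasurable, ← mul_assoc]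
  -- The radial integral is the source of the factor `n + 1`.
  have h6 : ∫⁻ s in Set.Ioc (0 : ℝ) 1, ENNReal.ofReal (s ^ n) = ENNReal.ofReal (1 / (n + 1)) := by
    rw [← ofReal_integral_eq_lintegral_ofReal]
    · rw [← intervalIntegral.integral_of_le zero_le_one]
      simp
    · exact (by fun_prop : Continuous fun s : ℝ => s ^ n).integrableOn_Ioc
    · filter_upwards [ae_restrict_mem measurableSet_Ioc] with s hs
      exact pow_nonneg hs.1.le _
  have h7 : ((n : ℝ≥0∞) + 1) * ENNReal.ofReal (1 / (n + 1)) = 1 := by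
    have : ((n : ℝ≥0∞) + 1) = ENNReal.ofReal (n + 1) := by
      rw [ENNReal.ofReal_add (by positivity) zero_le_one]; simp
    rw [this, ← ENNReal.ofReal_mul (by positivity), mul_one_div_cancel (by positivity),
      ENNReal.ofReal_one]
  rw [h6, h7, one_mul]

end Volume

/-! ### Independence of the volume from the chart -/

section GraphChart

variable {X : Geometry} {n : ℕ}

lemma form_graphChart {ε : ℝ} (hε : ε ^ 2 = 1) {x : Fin n → ℝ} (hx : 0 ≤ 1 - X.sign * (x ⬝ᵥ x)) :
    form X (graphChart X ε x) (graphChart X ε x) = X.sign := by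
  rw [form_eq]
  simp only [graphChart, Fin.snoc_castSucc, Fin.snoc_last]
  have h1 : ∑ i, x i * x i = x ⬝ᵥ x := rfl
  have h2 := Real.mul_self_sqrt hx
  rw [h1]
  linear_combination X.sign * (1 - X.sign * (x ⬝ᵥ x)) * hε + X.sign * ε ^ 2 * h2 -
    (x ⬝ᵥ x) * sign_mul_sign X

lemma continuous_sub_sign_mul : Continuous fun x : Fin n → ℝ => 1 - X.sign * (x ⬝ᵥ x) := by
  simp only [dotProduct]
  fun_prop

lemma measurable_graphChart (ε : ℝ) : Measurable (graphChart X (n := n) ε) := by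
  refine measurable_pi_lambda _ fun i => ?_
  refine Fin.lastCases ?_ (fun j => ?_) i
  · simp only [graphChart, Fin.snoc_last]
    exact (continuous_sub_sign_mul.sqrt.const_mul ε).measurable
  · simp only [graphChart, Fin.snoc_castSucc]
    fun_prop

lemma differentiableAt_graphChart (ε : ℝ) {x : Fin n → ℝ} (hx : 0 < 1 - X.sign * (x ⬝ᵥ x)) :
    DifferentiableAt ℝ (graphChart X ε) x := by
  rw [differentiableAt_pi]
  refine Fin.lastCases ?_ (fun j => ?_)
  · simp only [graphChart, Fin.snoc_last]
    have h : DifferentiableAt ℝ (fun x : Fin n → ℝ => 1 - X.sign * (x ⬝ᵥ x)) x := by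
      simp only [dotProduct]
      fun_prop
    exact (h.sqrt hx.ne').const_mul ε
  · simp only [graphChart, Fin.snoc_castSucc]
    fun_prop

lemma graphChart_injective (ε : ℝ) : Function.Injective (graphChart X (n := n) ε) := by
  intro x y h
  ext i
  have := congrFun h i.castSucc
  simpa [graphChart] using this

lemma lintegral_volumeElement_graphChart {ε : ℝ} (hε : ε ^ 2 = 1) {U : Set (Fin n → ℝ)}
    (hU : MeasurableSet U) (hpos : ∀ x ∈ U, 0 < 1 - X.sign * (x ⬝ᵥ x)) :
    ∫⁻ x in U, ENNReal.ofReal (volumeElement X (graphChart X ε) x) =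
      (n + 1) * volume (euclCone (graphChart X ε '' U)) := by
  refine lintegral_volumeElement hU (fun u hu => differentiableAt_graphChart ε (hpos u hu)) ?_
    (graphChart_injective ε).injOn
  intro u hu
  filter_upwards [continuous_sub_sign_mul.continuousAt.eventually_const_lt (hpos u hu)] with v hv
  exact form_graphChart hε hv.le

lemma eq_graphChart {ε : ℝ} (hε : ε ^ 2 = 1) {z : Fin (n + 1) → ℝ}
    (hz : form X z z = X.sign) (hl : 0 < ε * z (Fin.last n)) :
    z = graphChart X ε (fun i => z i.castSucc) ∧
      0 < 1 - X.sign * ((fun i : Fin n => z i.castSucc) ⬝ᵥ fun i => z i.castSucc) := by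
  have h1 : 1 - X.sign * ((fun i : Fin n => z i.castSucc) ⬝ᵥ fun i => z i.castSucc) =
      z (Fin.last n) ^ 2 := by
    rw [form_eq] at hz
    simp only [dotProduct]
    linear_combination -(X.sign) * hz + (z (Fin.last n) ^ 2 - 1) * sign_mul_sign X
  have hne : z (Fin.last n) ≠ 0 := by rintro h; simp [h] at hl
  constructor
  · ext i
    refine Fin.lastCases ?_ (fun j => ?_) i
    · simp only [graphChart, Fin.snoc_last]
      rw [h1, show z (Fin.last n) ^ 2 = (ε * z (Fin.last n)) ^ 2 by rw [mul_pow, hε, one_mul],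
        Real.sqrt_sq hl.le, ← mul_assoc, ← sq, hε, one_mul]
    · simp [graphChart]
  · rw [h1]; positivity

lemma euclCone_subset_submodule {B : Set (Fin (n + 1) → ℝ)}
    {W : Submodule ℝ (Fin (n + 1) → ℝ)} (h : B ⊆ W) : euclCone B ⊆ W := by
  rintro _ ⟨s, -, x, hx, rfl⟩
  exact W.smul_mem s (h hx)

lemma euclCone_union (B C : Set (Fin (n + 1) → ℝ)) :
    euclCone (B ∪ C) = euclCone B ∪ euclCone C := by
  ext z
  constructor
  · rintro ⟨s, hs, x, hx | hx, rfl⟩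
    · exact Or.inl ⟨s, hs, x, hx, rfl⟩
    · exact Or.inr ⟨s, hs, x, hx, rfl⟩
  · rintro (⟨s, hs, x, hx, rfl⟩ | ⟨s, hs, x, hx, rfl⟩)
    · exact ⟨s, hs, x, Or.inl hx, rfl⟩
    · exact ⟨s, hs, x, Or.inr hx, rfl⟩

lemma volume_submodule {W : Submodule ℝ (Fin (n + 1) → ℝ)} (hW : W ≠ ⊤) :
    volume (W : Set (Fin (n + 1) → ℝ)) = 0 :=
  Measure.addHaar_submodule _ W hW

lemma ker_proj_last_ne_top :
    LinearMap.ker (LinearMap.proj (R := ℝ) (φ := fun _ : Fin (n + 1) => ℝ) (Fin.last n)) ≠ ⊤ := by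
  intro h
  have : Pi.single (Fin.last n) (1 : ℝ) ∈ LinearMap.ker
    (LinearMap.proj (R := ℝ) (φ := fun _ : Fin (n + 1) => ℝ) (Fin.last n)) := h ▸ trivial
  simp at this

/-- The Riemannian volume of `A` is `n + 1` times the Lebesgue measure of the Euclidean cone
over `A`. -/
theorem vol_eq_volume_euclCone {A : Set (Fin (n + 1) → ℝ)} (hA : MeasurableSet A)
    (hAs : A ⊆ space X n) : vol X A = (n + 1) * volume (euclCone A) := by
  cases X
  · have hUm : ∀ ε : ℝ, MeasurableSet
        {x : Fin n → ℝ | x ⬝ᵥ x < 1 ∧ graphChart .spherical ε x ∈ A} := fun ε => by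
      refine MeasurableSet.inter ?_ (measurable_graphChart ε hA)
      have : Continuous fun x : Fin n → ℝ => x ⬝ᵥ x := by simp only [dotProduct]; fun_prop
      exact (isOpen_lt this continuous_const).measurableSet
    have key : ∀ ε : ℝ, ε ^ 2 = 1 →
        graphChart .spherical ε '' {x : Fin n → ℝ | x ⬝ᵥ x < 1 ∧ graphChart .spherical ε x ∈ A} =
          A ∩ {z | 0 < ε * z (Fin.last n)} := by
      intro ε hε
      ext z
      constructor
      · rintro ⟨x, ⟨hx, hxA⟩, rfl⟩
        refine ⟨hxA, ?_⟩
        have : 0 < √(1 - Geometry.spherical.sign * (x ⬝ᵥ x)) := by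
          apply Real.sqrt_pos.2; simp only [Geometry.sign]; linarith
        simp only [graphChart, Set.mem_ofPred_eq, Fin.snoc_last, ← mul_assoc, ← sq, hε, one_mul]
        exact this
      · rintro ⟨hz, hl⟩
        obtain ⟨h1, h2⟩ := eq_graphChart (X := .spherical) hε
          (form_self_of_mem_space (hAs hz)) hl
        refine ⟨_, ⟨?_, h1 ▸ hz⟩, h1.symm⟩
        simp only [Geometry.sign] at h2
        linarith
    have hp : ∀ ε : ℝ, ∀ x ∈ {x : Fin n → ℝ | x ⬝ᵥ x < 1 ∧ graphChart .spherical ε x ∈ A},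
        0 < 1 - Geometry.spherical.sign * (x ⬝ᵥ x) := by
      intro ε x hx
      have := hx.1
      simp only [Geometry.sign]; linarith
    rw [vol, lintegral_volumeElement_graphChart (by norm_num) (hUm 1) (hp 1),
      lintegral_volumeElement_graphChart (by norm_num) (hUm (-1)) (hp (-1)), ← mul_add,
      key 1 (by norm_num), key (-1) (by norm_num)]
    congr 1
    have hm : MeasurableSet {z : Fin (n + 1) → ℝ | 0 < z (Fin.last n)} :=
      (isOpen_lt continuous_const (continuous_apply _)).measurableSet
    -- The Euclidean cone is cut along the hyperplane of the equator. The two hemispherical charts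
    -- fill the open halves, and the hyperplane itself is a null set.
    rw [← measure_inter_add_sdiff (euclCone A) hm]
    congr 1
    · congr 1
      ext z
      constructor
      · rintro ⟨s, hs, x, ⟨hx, hl⟩, rfl⟩
        refine ⟨⟨s, hs, x, hx, rfl⟩, ?_⟩
        simp only [one_mul, Set.mem_ofPred_eq] at hl
        exact mul_pos hs.1 hl
      · rintro ⟨⟨s, hs, x, hx, rfl⟩, hl⟩
        refine ⟨s, hs, x, ⟨hx, ?_⟩, rfl⟩
        simp only [one_mul, Set.mem_ofPred_eq]
        exact (pos_iff_pos_of_mul_pos hl).1 hs.1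
    · refine le_antisymm (measure_mono ?_) ?_
      · rintro z ⟨s, hs, x, ⟨hx, hl⟩, rfl⟩
        refine ⟨⟨s, hs, x, hx, rfl⟩, ?_⟩
        have hl' : 0 < -1 * x (Fin.last n) := hl
        simp only [Set.mem_ofPred_eq, Pi.smul_apply, smul_eq_mul, not_lt]
        nlinarith [hs.1]
      · have hsub : euclCone A \ {z | 0 < z (Fin.last n)} ⊆
            euclCone (A ∩ {z | 0 < -1 * z (Fin.last n)}) ∪ (LinearMap.ker
              (LinearMap.proj (R := ℝ) (φ := fun _ : Fin (n + 1) => ℝ) (Fin.last n)) :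
                Set (Fin (n + 1) → ℝ)) := by
          rintro _ ⟨⟨s, hs, x, hx, rfl⟩, hl⟩
          simp only [Set.mem_ofPred_eq, Pi.smul_apply, smul_eq_mul, not_lt] at hl
          rcases lt_trichotomy (x (Fin.last n)) 0 with h | h | h
          · exact Or.inl ⟨s, hs, x, ⟨hx, by simpa using h⟩, rfl⟩
          · right; simp [h]
          · exact absurd (mul_pos hs.1 h) (not_lt.2 hl)
        refine (measure_mono hsub).trans ((measure_union_le _ _).trans ?_)
        rw [volume_submodule ker_proj_last_ne_top, add_zero]
  · have hUm : MeasurableSet {x : Fin n → ℝ | graphChart .hyperbolic 1 x ∈ A} :=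
      measurable_graphChart 1 hA
    rw [vol, lintegral_volumeElement_graphChart (by norm_num) hUm]
    · congr 3
      ext z
      constructor
      · rintro ⟨x, hx, rfl⟩
        exact hx
      · intro hz
        obtain ⟨h1, -⟩ := eq_graphChart (X := .hyperbolic) (ε := 1) (by norm_num)
          (form_self_of_mem_space (hAs hz)) (by simpa using (hAs hz).2)
        rw [h1] at hz
        exact ⟨_, hz, h1.symm⟩
    · intro x hx
      have : 0 ≤ x ⬝ᵥ x := Finset.sum_nonneg fun i _ => mul_self_nonneg _
      simp only [Geometry.sign]; linarith

/-- The Riemannian volume may be computed in any chart that covers the set up to a part of a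
proper linear subspace. -/
theorem vol_eq_lintegral_chart {A : Set (Fin (n + 1) → ℝ)} (hA : MeasurableSet A)
    (hAs : A ⊆ space X n) {ψ : (Fin n → ℝ) → (Fin (n + 1) → ℝ)} {U : Set (Fin n → ℝ)}
    (hU : MeasurableSet U) (hψm : Measurable ψ) (hψ : ∀ u ∈ U, DifferentiableAt ℝ ψ u)
    (hs : ∀ u ∈ U, ∀ᶠ v in nhds u, form X (ψ v) (ψ v) = X.sign) (hinj : Set.InjOn ψ U)
    {W : Submodule ℝ (Fin (n + 1) → ℝ)} (hW : W ≠ ⊤) (hcov : A \ ψ '' U ⊆ W) :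
    vol X A = ∫⁻ u in U ∩ ψ ⁻¹' A, ENNReal.ofReal (volumeElement X ψ u) := by
  rw [vol_eq_volume_euclCone hA hAs, lintegral_volumeElement (hU.inter (hψm hA))
    (fun u hu => hψ u hu.1) (fun u hu => hs u hu.1) (hinj.mono Set.inter_subset_left)]
  congr 1
  -- The part of `A` missed by the chart lies in `W`, hence so does the Euclidean cone over it,
  -- which is therefore null.
  have h1 : A = ψ '' (U ∩ ψ ⁻¹' A) ∪ A \ ψ '' U := by
    rw [Set.image_inter_preimage, Set.inter_comm, Set.inter_union_sdiff]
  apply le_antisymm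
  · conv_lhs => rw [h1, euclCone_union]
    refine (measure_union_le _ _).trans ?_
    rw [measure_mono_null (euclCone_subset_submodule hcov) (volume_submodule hW), add_zero]
  · conv_rhs => rw [h1, euclCone_union]
    exact measure_mono Set.subset_union_left

end GraphChart

/-! ### Orthonormal frames -/

section Frame

variable {X : Geometry} {n : ℕ}

lemma form_spherical (a b : Fin (n + 1) → ℝ) : form .spherical a b = ∑ i, a i * b i := by
  rw [form_eq, Fin.sum_univ_castSucc]
  simp [Geometry.sign]

lemma form_hyperbolic (a b : Fin (n + 1) → ℝ) : form .hyperbolic a b =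
    ∑ i : Fin n, a i.castSucc * b i.castSucc - a (Fin.last n) * b (Fin.last n) := by
  rw [form_eq]
  simp [Geometry.sign]
  ring

lemma form_spherical_self_pos {y : Fin (n + 1) → ℝ} (hy : y ≠ 0) :
    0 < form .spherical y y := by
  rw [form_spherical]
  obtain ⟨i, hi⟩ := Function.ne_iff.1 hy
  exact Finset.sum_pos' (fun i _ => mul_self_nonneg _) ⟨i, Finset.mem_univ i,
    mul_self_pos.2 hi⟩

/-- The orthogonal complement of a timelike vector is spacelike. With `a`, `Y` the spatial squares
of `o`, `y`, orthogonality and Cauchy–Schwarz give `yₙ₊₁² (1 + a) ≤ a Y < (1 + a) Y`; the last step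
needs `Y > 0`, and `Y = 0` would force `y = 0`. -/
lemma form_hyperbolic_self_pos {o y : Fin (n + 1) → ℝ} (ho : form .hyperbolic o o = -1)
    (hoy : form .hyperbolic y o = 0) (hy : y ≠ 0) : 0 < form .hyperbolic y y := by
  rw [form_hyperbolic] at *
  have hcs := Finset.sum_mul_sq_le_sq_mul_sq Finset.univ (fun i : Fin n => y i.castSucc)
    (fun i => o i.castSucc)
  simp only [sq (_ : ℝ)] at hcs
  set a := ∑ i : Fin n, o i.castSucc * o i.castSucc with ha
  set D := ∑ i : Fin n, y i.castSucc * o i.castSucc with hD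
  set Y := ∑ i : Fin n, y i.castSucc * y i.castSucc with hY
  have ha0 : 0 ≤ a := Finset.sum_nonneg fun i _ => mul_self_nonneg _
  have hY0 : 0 ≤ Y := Finset.sum_nonneg fun i _ => mul_self_nonneg _
  have hol : o (Fin.last n) * o (Fin.last n) = 1 + a := by linarith
  have hYpos : 0 < Y := by
    refine lt_of_le_of_ne hY0 fun h => hy ?_
    have h0 : ∀ i : Fin n, y i.castSucc = 0 := by
      intro i
      have := (Finset.sum_eq_zero_iff_of_nonneg fun (i : Fin n) _ =>
        mul_self_nonneg (y i.castSucc)).1 h.symm i (Finset.mem_univ i)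
      simpa using this
    have hD0 : D = 0 := Finset.sum_eq_zero fun i _ => by rw [h0 i, zero_mul]
    rw [hD0] at hoy
    have hne : o (Fin.last n) ≠ 0 := by rintro h; rw [h] at hol; linarith
    have hl : y (Fin.last n) = 0 := by
      rcases mul_eq_zero.1 (by linarith : y (Fin.last n) * o (Fin.last n) = 0) with h | h
      · exact h
      · exact absurd h hne
    ext i
    exact Fin.lastCases hl h0 i
  have h1 : D * D = y (Fin.last n) * y (Fin.last n) * (1 + a) := by
    rw [← hol, show D = y (Fin.last n) * o (Fin.last n) by linarith]; ring
  have h2 : 0 < (1 + a) * (Y - y (Fin.last n) * y (Fin.last n)) := by nlinarith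
  exact (pos_iff_pos_of_mul_pos h2).1 (by linarith)

/-- A family that is orthonormal for the form, and whose orthogonal complement is positive
definite, extends to an orthonormal frame. -/
theorem exists_frame {k m : ℕ} (hkm : m + k = n + 1) (b : Fin k → Fin (n + 1) → ℝ)
    (δ : Fin k → ℝ) (hδ : ∀ i, δ i * δ i = 1)
    (hb : ∀ i j, form X (b i) (b j) = if i = j then δ i else 0)
    (hpos : ∀ y, (∀ i, form X y (b i) = 0) → y ≠ 0 → 0 < form X y y) :
    ∃ d : Fin m → Fin (n + 1) → ℝ, (∀ i j, form X (d i) (d j) = if i = j then 1 else 0) ∧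
      (∀ i j, form X (b i) (d j) = 0) ∧
      ∀ x, x = ∑ i, (δ i * form X x (b i)) • b i + ∑ i, form X x (d i) • d i := by
  let Φ : (Fin (n + 1) → ℝ) →ₗ[ℝ] (Fin k → ℝ) :=
    LinearMap.pi fun i => (formBilin X n).flip (b i)
  have hΦ : ∀ y i, Φ y i = form X y (b i) := fun y i => rfl
  have hker : ∀ y, y ∈ LinearMap.ker Φ ↔ ∀ i, form X y (b i) = 0 := by
    intro y
    rw [LinearMap.mem_ker, funext_iff]
    rfl
  have hsurj : LinearMap.range Φ = ⊤ := by
    rw [LinearMap.range_eq_top]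
    intro a
    refine ⟨∑ j, (a j * δ j) • b j, ?_⟩
    ext i
    rw [hΦ, form_sum_left]
    simp [hb, mul_assoc, hδ]
  have hdim := LinearMap.finrank_range_add_finrank_ker Φ
  rw [hsurj, finrank_top, Module.finrank_fin_fun, Module.finrank_fin_fun] at hdim
  -- The orthogonal complement of the family is the kernel of `Φ`. Its dimension is the right one
  -- because `Φ` is onto.
  obtain rfl : m = Module.finrank ℝ (LinearMap.ker Φ) := by omega
  let B : LinearMap.BilinForm ℝ (LinearMap.ker Φ) := (formBilin X n).restrict _
  have hBsymm : LinearMap.IsSymm B := ⟨fun x y => form_comm _ _⟩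
  have : Invertible (2 : ℝ) := invertibleOfNonzero two_ne_zero
  -- An orthogonal basis of the complement exists for any symmetric form; `hpos` is what allows it
  -- to be normalized to squares `+1`.
  obtain ⟨v, hv⟩ := LinearMap.BilinForm.exists_orthogonal_basis hBsymm
  have hv' : ∀ i j, i ≠ j → form X (v i : Fin (n + 1) → ℝ) (v j) = 0 := fun i j hij => hv hij
  have hvp : ∀ i, 0 < form X (v i : Fin (n + 1) → ℝ) (v i) := by
    intro i
    refine hpos _ ((hker _).1 (v i).2) ?_
    have := v.ne_zero i
    simpa using this
  set q : Fin _ → ℝ := fun i => √(form X (v i : Fin (n + 1) → ℝ) (v i)) with hq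
  have hqp : ∀ i, 0 < q i := fun i => Real.sqrt_pos.2 (hvp i)
  have hqq : ∀ i, form X (v i : Fin (n + 1) → ℝ) (v i) = q i * q i := fun i =>
    (Real.mul_self_sqrt (hvp i).le).symm
  refine ⟨fun i => (q i)⁻¹ • (v i : Fin (n + 1) → ℝ), ?_, ?_, ?_⟩
  · intro i j
    rw [form_smul_left, form_smul_right]
    split_ifs with h
    · subst h
      rw [hqq]
      have := (hqp i).ne'
      field_simp
    · rw [hv' i j h]; simp
  · intro i j
    rw [form_smul_right, form_comm, (hker _).1 (v j).2 i, mul_zero]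
  · intro x
    set y := x - ∑ i, (δ i * form X x (b i)) • b i with hy
    have hyk : y ∈ LinearMap.ker Φ := by
      rw [hker]
      intro i
      simp [hy, hb, mul_comm (δ i), mul_assoc, hδ]
    obtain ⟨α, h1⟩ : ∃ α : Fin _ → ℝ, y = ∑ i, α i • (v i : Fin (n + 1) → ℝ) := by
      refine ⟨v.repr ⟨y, hyk⟩, ?_⟩
      have := congrArg (LinearMap.ker Φ).subtype (v.sum_repr ⟨y, hyk⟩)
      rw [map_sum] at this
      exact this.symm
    have h2 : ∀ i, form X x (v i : Fin (n + 1) → ℝ) = α i * (q i * q i) := by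
      intro i
      have h3 : form X x (v i : Fin (n + 1) → ℝ) = form X y (v i) := by
        rw [hy, form_sub_left, form_sum_left, Finset.sum_eq_zero, sub_zero]
        intro j _
        rw [form_smul_left, form_comm (b j), (hker _).1 (v i).2 j, mul_zero]
      rw [h3, h1, form_sum_left, Finset.sum_eq_single i]
      · rw [form_smul_left, hqq]
      · intro j _ hji
        rw [form_smul_left, hv' j i hji, mul_zero]
      · simp
    have h4 : ∑ i, form X x ((q i)⁻¹ • (v i : Fin (n + 1) → ℝ)) • (q i)⁻¹ •
        (v i : Fin (n + 1) → ℝ) = y := by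
      conv_rhs => rw [h1]
      refine Finset.sum_congr rfl fun i _ => ?_
      rw [form_smul_right, h2, smul_smul]
      congr 1
      have := (hqp i).ne'
      field_simp
    rw [h4, hy]
    abel

end Frame

/-! ### Cylindrical charts -/

section Cylinder

/-- A moving frame `E`, `E'` in a plane, and a frame `d` orthogonal to that plane. -/
structure IsCylinder (X : Geometry) {m : ℕ} (E E' : ℝ → Fin (m + 1 + 1) → ℝ)
    (d : Fin m → Fin (m + 1 + 1) → ℝ) (κ : ℝ) (ε : Fin m → ℝ) : Prop where
  hasDerivAt : ∀ t, HasDerivAt E (E' t) t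
  form_E_E : ∀ t, form X (E t) (E t) = κ
  form_E_E' : ∀ t, form X (E t) (E' t) = 0
  form_E'_E' : ∀ t, form X (E' t) (E' t) = 1
  form_E_d : ∀ t i, form X (E t) (d i) = 0
  form_E'_d : ∀ t i, form X (E' t) (d i) = 0
  form_d_d : ∀ i j, form X (d i) (d j) = if i = j then ε i else 0
  κ_mul_self : κ * κ = 1
  ε_mul_self : ∀ i, ε i * ε i = 1
  signature : κ * X.sign * ∏ i, ε i = 1

/-- The square of the distance to the axis in the cylindrical chart. -/
noncomputable def cylRadSq (X : Geometry) {m : ℕ} (κ : ℝ) (ε : Fin m → ℝ) (v : Fin m → ℝ) : ℝ :=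
  κ * (X.sign - ∑ i, ε i * v i ^ 2)

/-- The cylindrical chart. -/
noncomputable def cyl (X : Geometry) {m : ℕ} (E : ℝ → Fin (m + 1 + 1) → ℝ)
    (d : Fin m → Fin (m + 1 + 1) → ℝ) (κ : ℝ) (ε : Fin m → ℝ) (t : ℝ) (v : Fin m → ℝ) :
    Fin (m + 1 + 1) → ℝ :=
  √(cylRadSq X κ ε v) • E t + ∑ i, v i • d i

variable {X : Geometry} {m : ℕ} {E E' : ℝ → Fin (m + 1 + 1) → ℝ}
  {d : Fin m → Fin (m + 1 + 1) → ℝ} {κ : ℝ} {ε : Fin m → ℝ}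

@[fun_prop]
lemma continuous_cylRadSq : Continuous (cylRadSq X κ ε) := by
  unfold cylRadSq
  fun_prop

namespace IsCylinder

lemma form_cyl_self (h : IsCylinder X E E' d κ ε) (t : ℝ) {v : Fin m → ℝ}
    (hv : 0 ≤ cylRadSq X κ ε v) :
    form X (cyl X E d κ ε t v) (cyl X E d κ ε t v) = X.sign := by
  have h1 : ∀ i, form X (d i) (E t) = 0 := fun i => by rw [form_comm, h.form_E_d]
  simp only [cyl, form_add_left, form_add_right, form_smul_left, form_smul_right, form_sum_left,
    form_sum_right, h.form_E_E, h.form_E_d, h.form_d_d, h1, mul_zero, Finset.sum_const_zero,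
    add_zero, zero_add, mul_ite, Finset.sum_ite_eq', Finset.mem_univ, if_true]
  rw [← mul_assoc, Real.mul_self_sqrt hv, cylRadSq]
  have : ∑ i, v i * (v i * ε i) = ∑ i, ε i * v i ^ 2 :=
    Finset.sum_congr rfl fun i _ => by ring
  rw [this]
  linear_combination (X.sign - ∑ i, ε i * v i ^ 2) * h.κ_mul_self

/-- Since `ε i = ±1`, this recovers the coordinates `v` from the point. -/
lemma form_cyl_d (h : IsCylinder X E E' d κ ε) (t : ℝ) (v : Fin m → ℝ) (i : Fin m) :
    form X (cyl X E d κ ε t v) (d i) = v i * ε i := by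
  simp [cyl, h.form_E_d, h.form_d_d]

lemma continuous_E (h : IsCylinder X E E' d κ ε) : Continuous E :=
  continuous_iff_continuousAt.2 fun t => (h.hasDerivAt t).continuousAt

lemma hasFDerivAt_cyl (h : IsCylinder X E E' d κ ε) {u : Fin (m + 1) → ℝ}
    (hu : 0 < cylRadSq X κ ε fun i => u i.succ) :
    HasFDerivAt (fun u : Fin (m + 1) → ℝ => cyl X E d κ ε (u 0) fun i => u i.succ)
      (√(cylRadSq X κ ε fun i => u i.succ) • (ContinuousLinearMap.toSpanSingleton ℝ (E' (u 0))).comp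
          (ContinuousLinearMap.proj (R := ℝ) (φ := fun _ : Fin (m + 1) => ℝ) 0) +
        (∑ i : Fin m, (-(κ * ε i * u i.succ) / √(cylRadSq X κ ε fun i => u i.succ)) •
          ContinuousLinearMap.proj (R := ℝ) (φ := fun _ : Fin (m + 1) => ℝ) i.succ).smulRight
            (E (u 0)) +
        ∑ i : Fin m, (ContinuousLinearMap.proj (R := ℝ)
          (φ := fun _ : Fin (m + 1) => ℝ) i.succ).smulRight (d i)) u := by
  have hp : ∀ j : Fin (m + 1), HasFDerivAt (fun u : Fin (m + 1) → ℝ => u j)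
      (ContinuousLinearMap.proj (R := ℝ) (φ := fun _ : Fin (m + 1) => ℝ) j) u := fun j =>
    (ContinuousLinearMap.proj (R := ℝ) (φ := fun _ : Fin (m + 1) => ℝ) j).hasFDerivAt
  have hE : HasFDerivAt (fun u : Fin (m + 1) → ℝ => E (u 0)) _ u :=
    (h.hasDerivAt (u 0)).hasFDerivAt.comp u (hp 0)
  have hr : HasFDerivAt (fun u : Fin (m + 1) → ℝ => cylRadSq X κ ε fun i => u i.succ)
      (κ • (-∑ i : Fin m, ε i • ((2 * u i.succ) •
        ContinuousLinearMap.proj (R := ℝ) (φ := fun _ : Fin (m + 1) => ℝ) i.succ))) u := by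
    unfold cylRadSq
    refine HasFDerivAt.const_mul (HasFDerivAt.const_sub (HasFDerivAt.fun_sum fun i _ => ?_) _) κ
    refine HasFDerivAt.const_mul ?_ (ε i)
    simpa using (hp i.succ).pow 2
  have hd : HasFDerivAt (fun u : Fin (m + 1) → ℝ => ∑ i : Fin m, u i.succ • d i)
      (∑ i : Fin m, (ContinuousLinearMap.proj (R := ℝ)
          (φ := fun _ : Fin (m + 1) => ℝ) i.succ).smulRight (d i)) u :=
    HasFDerivAt.fun_sum fun i _ => (hp i.succ).smul_const (d i)
  refine (((hr.sqrt hu.ne').smul hE).add hd).congr_fderiv ?_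
  congr 3
  ext w
  simp only [smul_apply, sum_apply, neg_apply, ContinuousLinearMap.proj_apply, smul_eq_mul]
  rw [← Finset.sum_neg_distrib, Finset.mul_sum, Finset.mul_sum]
  refine Finset.sum_congr rfl fun i _ => ?_
  have := (Real.sqrt_pos.2 hu).ne'
  field_simp

/-- With `c = √(cylRadSq …)`, the coordinate vectors are `c E'` and `gⱼ E + dⱼ`, where `gⱼ = -κ εⱼ
vⱼ / c`. The first is orthogonal to the others, so the Gram determinant is `c² det (diag ε + κ g gᵀ)
= ∏ εᵢ · (c² + κ ∑ εᵢ vᵢ²) = κ σ ∏ εᵢ`, which the signature condition makes `1`. -/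
lemma volumeElement_cyl (h : IsCylinder X E E' d κ ε) {u : Fin (m + 1) → ℝ}
    (hu : 0 < cylRadSq X κ ε fun i => u i.succ) :
    volumeElement X (fun u : Fin (m + 1) → ℝ => cyl X E d κ ε (u 0) fun i => u i.succ) u = 1 := by
  set ψ := fun u : Fin (m + 1) → ℝ => cyl X E d κ ε (u 0) fun i => u i.succ with hψ
  have hf := (h.hasFDerivAt_cyl hu).fderiv
  set c := √(cylRadSq X κ ε fun i => u i.succ) with hc
  have hc0 : 0 < c := Real.sqrt_pos.2 hu
  have hcc : c * c = κ * (X.sign - ∑ i : Fin m, ε i * u i.succ ^ 2) := Real.mul_self_sqrt hu.le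
  set g : Fin m → ℝ := fun i => -(κ * ε i * u i.succ) / c with hg
  have e0 : fderiv ℝ ψ u (Pi.single 0 1) = c • E' (u 0) := by
    rw [hf]
    simp
  have e1 : ∀ j : Fin m, fderiv ℝ ψ u (Pi.single j.succ 1) = g j • E (u 0) + d j := by
    intro j
    rw [hf]
    simp [Pi.single_apply, hg, ite_smul]
  have hdE : ∀ i, form X (d i) (E (u 0)) = 0 := fun i => by rw [form_comm, h.form_E_d]
  rw [volumeElement, Matrix.det_succ_row_zero, Fin.sum_univ_succ, Finset.sum_eq_zero, add_zero]
  swap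
  · intro j _
    rw [gram_apply, e1, e0]
    simp [h.form_E_E', h.form_E'_d, form_comm (d j)]
  -- Factoring out `diag ε` leaves a rank-one perturbation of the identity, ready for the matrix
  -- determinant lemma.
  have hsub : ((jacobian ψ u)ᵀ * formMatrix X (m + 1) * jacobian ψ u).submatrix
      Fin.succ (Fin.succAbove 0) = Matrix.diagonal ε * (1 +
        Matrix.replicateCol Unit (fun i => κ * ε i * g i) * Matrix.replicateRow Unit g) := by
    ext i j
    rw [Matrix.submatrix_apply, gram_apply, Fin.succAbove_zero, e1, e1, Matrix.diagonal_mul]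
    simp only [form_add_left, form_add_right, form_smul_left, form_smul_right, h.form_E_E,
      h.form_E_d, hdE, h.form_d_d, Matrix.add_apply, Matrix.one_apply, Matrix.mul_apply,
      Matrix.replicateCol_apply, Matrix.replicateRow_apply, Finset.univ_unique,
      Finset.sum_singleton]
    have := h.ε_mul_self i
    by_cases hij : i = j
    · subst hij
      simp only [if_true]
      linear_combination -(κ * g i * g i) * this
    · rw [if_neg hij, if_neg (Ne.symm hij)]
      linear_combination -(κ * g i * g j) * this
  rw [hsub, Matrix.det_mul, Matrix.det_diagonal, Matrix.det_one_add_replicateCol_mul_replicateRow,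
    gram_apply, e0, form_smul_left, form_smul_right, h.form_E'_E']
  have hdot : g ⬝ᵥ (fun i => κ * ε i * g i) = κ * (∑ i : Fin m, ε i * u i.succ ^ 2) / (c * c) := by
    rw [dotProduct, Finset.mul_sum, Finset.sum_div]
    refine Finset.sum_congr rfl fun i _ => ?_
    simp only [hg]
    field_simp
    linear_combination κ * ε i * u i.succ ^ 2 * ε i * ε i * h.κ_mul_self +
      κ * ε i * u i.succ ^ 2 * h.ε_mul_self i
  rw [hdot, Real.sqrt_eq_one]
  have hcc0 : c * c ≠ 0 := (mul_pos hc0 hc0).ne'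
  field_simp
  simp only [Fin.val_zero, pow_zero, one_mul]
  have hsig := h.signature
  rw [sq c, hcc]
  linear_combination hsig

/-- The Riemannian volume is Lebesgue measure in cylindrical coordinates. -/
theorem vol_eq (h : IsCylinder X E E' d κ ε) {A : Set (Fin (m + 1 + 1) → ℝ)}
    (hA : MeasurableSet A) (hAs : A ⊆ space X (m + 1)) {T : Set ℝ} (hT : MeasurableSet T)
    (hinj : Set.InjOn E T) {W : Submodule ℝ (Fin (m + 1 + 1) → ℝ)} (hW : W ≠ ⊤)
    (hcov : ∀ x ∈ A, x ∈ W ∨ ∃ t ∈ T, ∃ v, 0 < cylRadSq X κ ε v ∧ x = cyl X E d κ ε t v) :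
    vol X A = volume {p : ℝ × (Fin m → ℝ) | p.1 ∈ T ∧ 0 < cylRadSq X κ ε p.2 ∧
      cyl X E d κ ε p.1 p.2 ∈ A} := by
  set ψ := fun u : Fin (m + 1) → ℝ => cyl X E d κ ε (u 0) fun i => u i.succ with hψ
  set U : Set (Fin (m + 1) → ℝ) := {u | u 0 ∈ T ∧ 0 < cylRadSq X κ ε fun i => u i.succ} with hU
  have hrc : Continuous fun u : Fin (m + 1) → ℝ => cylRadSq X κ ε fun i => u i.succ := by
    fun_prop
  have hUm : MeasurableSet U :=
    ((measurable_pi_apply 0) hT).inter (isOpen_lt continuous_const hrc).measurableSet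
  have hψc : Continuous ψ := by
    have := h.continuous_E
    simp only [hψ]
    unfold cyl
    fun_prop
  rw [vol_eq_lintegral_chart hA hAs (ψ := ψ) hUm hψc.measurable
    (fun u hu => (h.hasFDerivAt_cyl hu.2).differentiableAt) ?_ ?_ hW ?_]
  · rw [setLIntegral_congr_fun (g := fun _ => 1) (hUm.inter (hψc.measurable hA))]
    · rw [setLIntegral_one]
      have h2 := (volume_preserving_piFinSuccAbove (fun _ : Fin (m + 1) => ℝ) 0)
      rw [← h2.measure_preimage_equiv]
      congr 1
      ext u
      constructor
      · rintro ⟨⟨h1, h2⟩, h3⟩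
        exact ⟨h1, h2, h3⟩
      · rintro ⟨h1, h2, h3⟩
        exact ⟨⟨h1, h2⟩, h3⟩
    · intro u hu
      dsimp only
      rw [h.volumeElement_cyl hu.1.2, ENNReal.ofReal_one]
  · intro u hu
    filter_upwards [hrc.continuousAt.eventually_const_lt hu.2] with v hv
    exact h.form_cyl_self _ hv.le
  · intro u hu w hw huw
    have hv : (fun i => u i.succ : Fin m → ℝ) = fun i => w i.succ := by
      ext i
      have := congrArg (fun x => form X x (d i)) huw
      simp only [hψ, h.form_cyl_d] at this
      refine mul_right_cancel₀ (b := ε i) ?_ this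
      intro h0
      have := h.ε_mul_self i
      rw [h0] at this
      simp at this
    have ht : u 0 = w 0 := by
      refine hinj hu.1 hw.1 ?_
      have h1 := huw
      simp only [hψ, cyl, congrFun hv] at h1
      exact smul_right_injective _ (Real.sqrt_pos.2 hw.2).ne' (add_right_cancel h1)
    ext i
    exact Fin.cases ht (fun j => congrFun hv j) i
  · rintro x ⟨hx, hxU⟩
    refine (hcov x hx).resolve_right ?_
    rintro ⟨t, ht, v, hv, rfl⟩
    exact hxU ⟨Fin.cons t v, ⟨by simpa using ht, by simpa using hv⟩, by simp [hψ]⟩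

end IsCylinder

end Cylinder

/-! ### Points and distances -/

section Points

variable {X : Geometry} {n : ℕ}

/-- Cauchy–Schwarz for the spatial parts, whose squares and inner product are expressed through the
last coordinates and the form. -/
lemma sq_form_spatial_le {x p : Fin (n + 1) → ℝ} (hx : form .hyperbolic x x = -1)
    (hp : form .hyperbolic p p = -1) :
    1 ≤ x (Fin.last n) ^ 2 ∧ 1 ≤ p (Fin.last n) ^ 2 ∧
      (form .hyperbolic x p + x (Fin.last n) * p (Fin.last n)) ^ 2 ≤
        (x (Fin.last n) ^ 2 - 1) * (p (Fin.last n) ^ 2 - 1) := by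
  rw [form_hyperbolic] at *
  have hcs := Finset.sum_mul_sq_le_sq_mul_sq Finset.univ (fun i : Fin n => x i.castSucc)
    (fun i => p i.castSucc)
  simp only [sq (_ : ℝ)] at hcs ⊢
  have h1 : 0 ≤ ∑ i : Fin n, x i.castSucc * x i.castSucc :=
    Finset.sum_nonneg fun i _ => mul_self_nonneg _
  have h2 : 0 ≤ ∑ i : Fin n, p i.castSucc * p i.castSucc :=
    Finset.sum_nonneg fun i _ => mul_self_nonneg _
  rw [sub_eq_iff_eq_add] at hx hp
  rw [hx, hp] at hcs
  refine ⟨by linarith, by linarith, ?_⟩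
  rw [sub_add_cancel]
  linarith

/-- The sign of the form against a point of the upper sheet tells the two sheets apart: if `xₙ₊₁ ≤
0`, the spatial inner product would be less than `xₙ₊₁ pₙ₊₁ ≤ 0`, too large in absolute value for
Cauchy–Schwarz. -/
lemma mem_space_of_form_neg {x p : Fin (n + 1) → ℝ} (hp : p ∈ space .hyperbolic n)
    (hx : form .hyperbolic x x = -1) (hxp : form .hyperbolic x p < 0) :
    x ∈ space .hyperbolic n := by
  refine ⟨hx, ?_⟩
  by_contra hl
  push Not at hl
  obtain ⟨h1, h2, h3⟩ := sq_form_spatial_le hx hp.1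
  have hpl : 0 < p (Fin.last n) := hp.2
  set D := form .hyperbolic x p + x (Fin.last n) * p (Fin.last n) with hD
  have hxl : x (Fin.last n) * p (Fin.last n) ≤ 0 := mul_nonpos_of_nonpos_of_nonneg hl hpl.le
  have h4 : D < x (Fin.last n) * p (Fin.last n) := by linarith
  nlinarith

/-- The reversed Cauchy–Schwarz inequality, from `(u² - 1)(w² - 1) ≤ (u w - 1)²` for the last
coordinates `u`, `w`. -/
lemma form_le_neg_one {x p : Fin (n + 1) → ℝ} (hx : x ∈ space .hyperbolic n)
    (hp : p ∈ space .hyperbolic n) : form .hyperbolic x p ≤ -1 := by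
  obtain ⟨h1, h2, h3⟩ := sq_form_spatial_le hx.1 hp.1
  have hpl : 1 ≤ p (Fin.last n) := by have := hp.2; nlinarith
  have hxl : 1 ≤ x (Fin.last n) := by have := hx.2; nlinarith
  have h4 : 0 ≤ x (Fin.last n) * p (Fin.last n) - 1 := by nlinarith
  have h5 := abs_le_of_sq_le_sq (a := form .hyperbolic x p + x (Fin.last n) * p (Fin.last n))
    (b := x (Fin.last n) * p (Fin.last n) - 1) (by nlinarith [sq_nonneg (x (Fin.last n) -
      p (Fin.last n))]) h4
  linarith [le_of_abs_le h5]

/-- The strict bound `r < π` disposes of arguments below `-1`, where `arccos` is constantly `π`;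
thus `x` and `y` need not be known to lie on the sphere. -/
lemma gdist_spherical_le_iff {x y : Fin (n + 1) → ℝ} {r : ℝ} (h0 : 0 ≤ r) (hr : r < π) :
    gdist .spherical x y ≤ r ↔ Real.cos r ≤ form .spherical x y := by
  rw [gdist]
  constructor
  · intro h
    rcases lt_or_ge (form .spherical x y) (-1) with h1 | h1
    · rw [Real.arccos_of_le_neg_one h1.le] at h
      linarith
    rcases le_or_gt (form .spherical x y) 1 with h2 | h2
    · rw [← Real.cos_arccos h1 h2]
      exact Real.cos_le_cos_of_nonneg_of_le_pi (Real.arccos_nonneg _) hr.le h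
    · exact (Real.cos_le_one r).trans h2.le
  · intro h
    rw [← Real.arccos_cos h0 hr.le]
    exact Real.arccos_le_arccos h

lemma gdist_hyperbolic_le_iff {x y : Fin (n + 1) → ℝ} {r : ℝ} (h0 : 0 ≤ r)
    (hx : x ∈ space .hyperbolic n) (hy : y ∈ space .hyperbolic n) :
    gdist .hyperbolic x y ≤ r ↔ -Real.cosh r ≤ form .hyperbolic x y := by
  have h := form_le_neg_one hx hy
  rw [gdist]
  conv_lhs => rw [← Real.arcosh_cosh h0]
  rw [Real.arcosh_le_arcosh (by linarith) (Real.cosh_pos _), neg_le]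

lemma measurableSet_space : MeasurableSet (space X n) := by
  cases X
  · exact measurableSet_eq_fun (by fun_prop) measurable_const
  · exact (measurableSet_eq_fun (f := fun x => form .hyperbolic x x) (by fun_prop)
      measurable_const).inter (isOpen_lt continuous_const (continuous_apply _)).measurableSet

lemma ker_formBilin_ne_top {b : Fin (n + 1) → ℝ} (hb : form X b b ≠ 0) :
    LinearMap.ker (formBilin X n b) ≠ ⊤ := by
  intro h
  have : b ∈ LinearMap.ker (formBilin X n b) := h ▸ trivial
  exact hb this

end Points

/-! ### Polar angles -/

section Polar

lemma exists_polar_angle (a b : ℝ) : ∃ t ∈ Set.Ioc (-π) π,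
    a = √(a ^ 2 + b ^ 2) * Real.cos t ∧ b = √(a ^ 2 + b ^ 2) * Real.sin t := by
  set z : ℂ := ⟨a, b⟩ with hz
  have hn : ‖z‖ = √(a ^ 2 + b ^ 2) := by
    rw [Complex.norm_def, Complex.normSq_apply]
    congr 1
    simp only [hz]
    ring
  refine ⟨z.arg, Complex.arg_mem_Ioc z, ?_, ?_⟩
  · rw [← hn, Complex.norm_mul_cos_arg]
  · rw [← hn, Complex.norm_mul_sin_arg]

lemma eq_of_cos_eq_of_sin_eq {s t : ℝ} (hs : s ∈ Set.Ioc (-π) π) (ht : t ∈ Set.Ioc (-π) π)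
    (hc : Real.cos s = Real.cos t) (hsin : Real.sin s = Real.sin t) : s = t := by
  rw [← Complex.arg_cos_add_sin_mul_I hs, ← Complex.arg_cos_add_sin_mul_I ht,
    ← Complex.ofReal_cos, ← Complex.ofReal_sin, ← Complex.ofReal_cos, ← Complex.ofReal_sin,
    hc, hsin]

variable {X : Geometry} {m : ℕ} {b₀ b₁ : Fin (m + 1 + 1) → ℝ}
  {d : Fin m → Fin (m + 1 + 1) → ℝ} {ε : Fin m → ℝ}

/-- Rotation in a positive definite plane: used for tori in both geometries and for spherical cones.
-/
lemma isCylinder_circle (h00 : form X b₀ b₀ = 1) (h11 : form X b₁ b₁ = 1)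
    (h01 : form X b₀ b₁ = 0) (h0d : ∀ i, form X b₀ (d i) = 0) (h1d : ∀ i, form X b₁ (d i) = 0)
    (hdd : ∀ i j, form X (d i) (d j) = if i = j then ε i else 0) (hε : ∀ i, ε i * ε i = 1)
    (hsig : X.sign * ∏ i, ε i = 1) :
    IsCylinder X (fun t => Real.cos t • b₀ + Real.sin t • b₁)
      (fun t => -Real.sin t • b₀ + Real.cos t • b₁) d 1 ε where
  hasDerivAt t := ((Real.hasDerivAt_cos t).smul_const b₀).add
    ((Real.hasDerivAt_sin t).smul_const b₁)
  form_E_E t := by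
    simp [h00, h11, h01, form_comm b₁ b₀]
    linear_combination Real.sin_sq_add_cos_sq t
  form_E_E' t := by
    simp [h00, h11, h01, form_comm b₁ b₀]
    ring
  form_E'_E' t := by
    simp [h00, h11, h01, form_comm b₁ b₀]
    linear_combination Real.sin_sq_add_cos_sq t
  form_E_d t i := by simp [h0d, h1d]
  form_E'_d t i := by simp [h0d, h1d]
  form_d_d := hdd
  κ_mul_self := one_mul 1
  ε_mul_self := hε
  signature := by rw [one_mul, hsig]

lemma injOn_circle (h00 : form X b₀ b₀ = 1) (h11 : form X b₁ b₁ = 1) (h01 : form X b₀ b₁ = 0) :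
    Set.InjOn (fun t => Real.cos t • b₀ + Real.sin t • b₁) (Set.Ioc (-π) π) := by
  intro s hs t ht h
  have h0 := congrArg (form X b₀) h
  have h1 := congrArg (form X b₁) h
  simp only [form_add_right, form_smul_right, h00, h11, h01, form_comm b₁ b₀, mul_one, mul_zero,
    add_zero, zero_add] at h0 h1
  exact eq_of_cos_eq_of_sin_eq hs ht h0 h1

/-- The Lorentz boost in a plane of signature `(-, +)`: used for hyperbolic cones. -/
lemma isCylinder_hyperbola (h00 : form X b₀ b₀ = -1) (h11 : form X b₁ b₁ = 1)
    (h01 : form X b₀ b₁ = 0) (h0d : ∀ i, form X b₀ (d i) = 0) (h1d : ∀ i, form X b₁ (d i) = 0)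
    (hdd : ∀ i j, form X (d i) (d j) = if i = j then ε i else 0) (hε : ∀ i, ε i * ε i = 1)
    (hsig : -X.sign * ∏ i, ε i = 1) :
    IsCylinder X (fun t => Real.cosh t • b₀ + Real.sinh t • b₁)
      (fun t => Real.sinh t • b₀ + Real.cosh t • b₁) d (-1) ε where
  hasDerivAt t := ((Real.hasDerivAt_cosh t).smul_const b₀).add
    ((Real.hasDerivAt_sinh t).smul_const b₁)
  form_E_E t := by
    simp [h00, h11, h01, form_comm b₁ b₀]
    linear_combination -Real.cosh_sq t
  form_E_E' t := by
    simp [h00, h11, h01, form_comm b₁ b₀]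
    ring
  form_E'_E' t := by
    simp [h00, h11, h01, form_comm b₁ b₀]
    linear_combination Real.cosh_sq t
  form_E_d t i := by simp [h0d, h1d]
  form_E'_d t i := by simp [h0d, h1d]
  form_d_d := hdd
  κ_mul_self := by norm_num
  ε_mul_self := hε
  signature := by linear_combination hsig

lemma injective_hyperbola (h11 : form X b₁ b₁ = 1) (h01 : form X b₀ b₁ = 0) :
    Function.Injective (fun t => Real.cosh t • b₀ + Real.sinh t • b₁) := by
  intro s t h
  have h1 := congrArg (form X b₁) h
  simp only [form_add_right, form_smul_right, h11, h01, form_comm b₁ b₀, mul_one, mul_zero,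
    zero_add] at h1
  exact Real.sinh_injective h1

end Polar

/-! ### Euclidean balls -/

section Balls

/-- Open and closed balls are both needed, since the parameter sets below are squeezed between them.
The case `m = 0`, where the set is a point, serves cones in dimension 1. -/
lemma volume_sum_sq_lt (m : ℕ) {s : ℝ} (hs : 0 < s) :
    volume {v : Fin m → ℝ | ∑ i, v i ^ 2 < s ^ 2} =
      ENNReal.ofReal (√π ^ m / Real.Gamma (m / 2 + 1) * s ^ m) := by
  rcases Nat.eq_zero_or_pos m with rfl | hm
  · have : {v : Fin 0 → ℝ | ∑ i, v i ^ 2 < s ^ 2} = Set.univ := by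
      ext v; simpa using pow_pos hs 2
    rw [this, volume_pi, Measure.pi_of_empty]
    simp
  · have : Nonempty (Fin m) := ⟨⟨0, hm⟩⟩
    have h := EuclideanSpace.volume_ball (Fin m) 0 s
    rw [EuclideanSpace.ball_zero_eq _ hs.le, ← MeasurePreserving.measure_preimage_equiv
      (f := MeasurableEquiv.toLp 2 (Fin m → ℝ)) (PiLp.volume_preserving_toLp (Fin m))] at h
    rw [ENNReal.ofReal_mul (by positivity), ENNReal.ofReal_pow hs.le, mul_comm]
    simpa using h

lemma volume_sum_sq_le (m : ℕ) {s : ℝ} (hs : 0 < s) :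
    volume {v : Fin m → ℝ | ∑ i, v i ^ 2 ≤ s ^ 2} =
      ENNReal.ofReal (√π ^ m / Real.Gamma (m / 2 + 1) * s ^ m) := by
  rcases Nat.eq_zero_or_pos m with rfl | hm
  · have : {v : Fin 0 → ℝ | ∑ i, v i ^ 2 ≤ s ^ 2} = Set.univ := by
      ext v; simp [sq_nonneg]
    rw [this, volume_pi, Measure.pi_of_empty]
    simp
  · have : Nonempty (Fin m) := ⟨⟨0, hm⟩⟩
    have h := EuclideanSpace.volume_closedBall (Fin m) 0 s
    rw [EuclideanSpace.closedBall_zero_eq _ hs.le, ← MeasurePreserving.measure_preimage_equiv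
      (f := MeasurableEquiv.toLp 2 (Fin m → ℝ)) (PiLp.volume_preserving_toLp (Fin m))] at h
    rw [ENNReal.ofReal_mul (by positivity), ENNReal.ofReal_pow hs.le, mul_comm]
    simpa using h

lemma volume_preimage_affine (P : Set (Fin 2 → ℝ)) (c : ℝ) {s : ℝ} (hs : 0 < s) :
    volume {v : Fin 2 → ℝ | ![v 0 - c, s * v 1] ∈ P} = ENNReal.ofReal s⁻¹ * volume P := by
  have hdet : LinearMap.det (Matrix.toLin' (Matrix.diagonal ![1, s])) = s := by
    simp [LinearMap.det_toLin']
  have h := Measure.addHaar_preimage_linearMap volume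
    (f := Matrix.toLin' (Matrix.diagonal ![1, s])) (by rw [hdet]; exact hs.ne') P
  rw [hdet, abs_of_pos (inv_pos.2 hs), ← measure_preimage_add_right _ ![-c, 0]] at h
  rw [← h]
  congr 1
  ext v
  have : Matrix.toLin' (Matrix.diagonal ![1, s]) (v + ![-c, 0]) = ![v 0 - c, s * v 1] := by
    ext i
    rw [Matrix.toLin'_apply, Matrix.mulVec_diagonal]
    fin_cases i <;> simp [sub_eq_add_neg]
  simp only [Set.mem_preimage, Set.mem_ofPred_eq, this]

lemma volume_ellipse_lt (c : ℝ) {s ρ : ℝ} (hs : 0 < s) (hρ : 0 < ρ) :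
    volume {v : Fin 2 → ℝ | (v 0 - c) ^ 2 + s ^ 2 * v 1 ^ 2 < ρ ^ 2} =
      ENNReal.ofReal (π * ρ ^ 2 / s) := by
  have h := volume_preimage_affine {v | ∑ i, v i ^ 2 < ρ ^ 2} c hs
  rw [volume_sum_sq_lt 2 hρ, ← ENNReal.ofReal_mul (inv_pos.2 hs).le] at h
  simp only [Fin.sum_univ_two, Set.mem_ofPred_eq, Matrix.cons_val_zero, Matrix.cons_val_one,
    mul_pow] at h
  rw [h, Real.sq_sqrt Real.pi_pos.le]
  congr 1
  norm_num
  field_simp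

lemma volume_ellipse_le (c : ℝ) {s ρ : ℝ} (hs : 0 < s) (hρ : 0 < ρ) :
    volume {v : Fin 2 → ℝ | (v 0 - c) ^ 2 + s ^ 2 * v 1 ^ 2 ≤ ρ ^ 2} =
      ENNReal.ofReal (π * ρ ^ 2 / s) := by
  have h := volume_preimage_affine {v | ∑ i, v i ^ 2 ≤ ρ ^ 2} c hs
  rw [volume_sum_sq_le 2 hρ, ← ENNReal.ofReal_mul (inv_pos.2 hs).le] at h
  simp only [Fin.sum_univ_two, Set.mem_ofPred_eq, Matrix.cons_val_zero, Matrix.cons_val_one,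
    mul_pow] at h
  rw [h, Real.sq_sqrt Real.pi_pos.le]
  congr 1
  norm_num
  field_simp

end Balls

/-! ### Solid tori -/

section Torus

variable {X : Geometry}

lemma form_circlePoint {n : ℕ} {p e₁ e₂ x : Fin (n + 1) → ℝ} (R θ : ℝ) :
    form X (circlePoint X p e₁ e₂ R θ) x = X.cosX R * form X x p +
      X.sinX R * (form X x e₁ * Real.cos θ + form X x e₂ * Real.sin θ) := by
  rw [form_comm]
  simp only [circlePoint, form_add_right, form_smul_right]
  ring

lemma form_circlePoint_self {n : ℕ} {p e₁ e₂ : Fin (n + 1) → ℝ} (h : IsTangentFrame X p e₁ e₂)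
    {R : ℝ} (hR : X.cosX R ^ 2 + X.sign * X.sinX R ^ 2 = 1) (θ : ℝ) :
    form X (circlePoint X p e₁ e₂ R θ) (circlePoint X p e₁ e₂ R θ) = X.sign := by
  obtain ⟨hp, h11, h22, h12, h1p, h2p⟩ := h
  rw [form_circlePoint]
  simp only [circlePoint, form_add_left, form_smul_left, form_comm p e₁, form_comm p e₂,
    form_comm e₂ e₁, h11, h22, h12, h1p, h2p, form_self_of_mem_space hp]
  linear_combination X.sign * hR + X.sinX R ^ 2 * Real.sin_sq_add_cos_sq θ -
    X.sinX R ^ 2 * sign_mul_sign X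

/-- Among the points of the circle, the nearest to `x` is the one whose angle is the polar angle of
`(⟨x, e₁⟩, ⟨x, e₂⟩)`. There `x` is perpendicular to the circle, and `⟨x, e₁⟩ cos θ + ⟨x, e₂⟩ sin θ`
attains its maximum, the square root. So the union over `θ` collapses to a single inequality. -/
lemma mem_solidTorus_iff {n : ℕ} {p e₁ e₂ x : Fin (n + 1) → ℝ} {R r : ℝ}
    (hS : 0 ≤ X.sinX R) (hd : ∀ θ, ∀ x ∈ space X n,
      gdist X (circlePoint X p e₁ e₂ R θ) x ≤ r ↔
        X.sign * X.cosX r ≤ form X (circlePoint X p e₁ e₂ R θ) x) :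
    x ∈ solidTorus X p e₁ e₂ R r ↔ x ∈ space X n ∧ X.sign * X.cosX r ≤
      X.cosX R * form X x p + X.sinX R * √(form X x e₁ ^ 2 + form X x e₂ ^ 2) := by
  simp only [solidTorus, Set.mem_iUnion, Set.mem_ofPred_eq]
  constructor
  · rintro ⟨θ, hx, -, hdist⟩
    refine ⟨hx, ?_⟩
    rw [hd θ x hx, form_circlePoint] at hdist
    refine hdist.trans ?_
    gcongr
    apply Real.le_sqrt_of_sq_le
    nlinarith [sq_nonneg (form X x e₁ * Real.sin θ - form X x e₂ * Real.cos θ),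
      Real.sin_sq_add_cos_sq θ]
  · rintro ⟨hx, h⟩
    obtain ⟨θ, -, h1, h2⟩ := exists_polar_angle (form X x e₁) (form X x e₂)
    refine ⟨θ, hx, ?_, ?_⟩
    · simp only [circleTangent, form_add_right, form_smul_right]
      linear_combination -Real.sin θ * h1 + Real.cos θ * h2
    · rw [hd θ x hx, form_circlePoint]
      convert! h using 3
      linear_combination Real.cos θ * h1 + Real.sin θ * h2 +
        √(form X x e₁ ^ 2 + form X x e₂ ^ 2) * Real.sin_sq_add_cos_sq θ

/-- Both geometries at once. The hypothesis `hfar` makes the two sides of the torus inequality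
comparable by squaring, and `hnear` puts the points over the ellipse on the right sheet. -/
lemma vol_solidTorus {p e₁ e₂ : Fin (3 + 1) → ℝ} {R r : ℝ} (h : IsTangentFrame X p e₁ e₂)
    (hS : 0 < X.sinX R) (hs : 0 < X.sinX r) (hR : X.cosX R ^ 2 + X.sign * X.sinX R ^ 2 = 1)
    (hr : X.cosX r ^ 2 + X.sign * X.sinX r ^ 2 = 1)
    (hd : ∀ θ, ∀ x ∈ space X 3, gdist X (circlePoint X p e₁ e₂ R θ) x ≤ r ↔
      X.sign * X.cosX r ≤ form X (circlePoint X p e₁ e₂ R θ) x)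
    (hpos : ∀ y : Fin (3 + 1) → ℝ, form X y p = 0 → y ≠ 0 → 0 < form X y y)
    (hfar : ∀ x ∈ space X 3, X.cosX R * form X x p ≤ X.sign * X.cosX r)
    (hnear : ∀ x : Fin (3 + 1) → ℝ, form X x x = X.sign →
      (X.sign * form X x p - X.cosX R * X.cosX r) ^ 2 < (X.sinX R * X.sinX r) ^ 2 →
      x ∈ space X 3) :
    vol X (solidTorus X p e₁ e₂ R r) =
      ENNReal.ofReal (2 * π ^ 2 * X.sinX R * X.sinX r ^ 2) := by
  obtain ⟨hp, h11, h22, h12, h1p, h2p⟩ := h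
  have hpp := form_self_of_mem_space hp
  have hσ := sign_mul_sign X
  obtain ⟨w, hww, hbw, hrec⟩ := exists_frame (X := X) (n := 3) (k := 3) (m := 1) rfl
    ![p, e₁, e₂] ![X.sign, 1, 1] (by intro i; fin_cases i <;> simp [hσ])
    (by intro i j; fin_cases i <;> fin_cases j <;>
          simp [hpp, h11, h22, h12, h1p, h2p, form_comm p e₁, form_comm p e₂, form_comm e₂ e₁])
    (fun y hy hy0 => hpos y (hy 0) hy0)
  have hww' : form X (w 0) (w 0) = 1 := by simpa using hww 0 0
  have hpw : form X p (w 0) = 0 := hbw 0 0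
  have h1w : form X e₁ (w 0) = 0 := hbw 1 0
  have h2w : form X e₂ (w 0) = 0 := hbw 2 0
  set d : Fin 2 → Fin (3 + 1) → ℝ := ![p, w 0] with hdd
  have hcyl : IsCylinder X (fun t => Real.cos t • e₁ + Real.sin t • e₂)
      (fun t => -Real.sin t • e₁ + Real.cos t • e₂) d 1 ![X.sign, 1] := by
    refine isCylinder_circle h11 h22 h12 ?_ ?_ ?_ ?_ ?_
    · intro i; fin_cases i <;> simp [hdd, h1p, h1w]
    · intro i; fin_cases i <;> simp [hdd, h2p, h2w]
    · intro i j; fin_cases i <;> fin_cases j <;> simp [hdd, hpp, hww', hpw, form_comm (w 0) p]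
    · intro i; fin_cases i <;> simp [hσ]
    · simp [hσ]
  have hrad : ∀ v, cylRadSq X 1 ![X.sign, 1] v = X.sign - X.sign * v 0 ^ 2 - v 1 ^ 2 := by
    intro v
    simp [cylRadSq]
    ring
  have hmem := fun x => mem_solidTorus_iff (x := x) hS.le hd
  have hA : solidTorus X p e₁ e₂ R r = space X 3 ∩ {x | X.sign * X.cosX r ≤
      X.cosX R * form X x p + X.sinX R * √(form X x e₁ ^ 2 + form X x e₂ ^ 2)} := by
    ext x; exact hmem x
  have hAm : MeasurableSet (solidTorus X p e₁ e₂ R r) := by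
    rw [hA]
    exact measurableSet_space.inter (measurableSet_le (by fun_prop) (by fun_prop))
  have hAs : solidTorus X p e₁ e₂ R r ⊆ space X 3 := by
    rw [hA]; exact Set.inter_subset_left
  rw [hcyl.vol_eq hAm hAs (T := Set.Ioc (-π) π) measurableSet_Ioc (injOn_circle h11 h22 h12)
    (W := LinearMap.ker (formBilin X 3 e₁)) (ker_formBilin_ne_top (by rw [h11]; norm_num))]
  swap
  · intro x hx
    have hrecx : x = (X.sign * form X x p) • p + form X x e₁ • e₁ + form X x e₂ • e₂ +
        form X x (w 0) • w 0 := by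
      have := hrec x
      simp only [Fin.sum_univ_three, Fin.sum_univ_one] at this
      simpa using this
    have hxx := form_self_of_mem_space (hAs hx)
    have hsq : form X x e₁ ^ 2 + form X x e₂ ^ 2 =
        X.sign - X.sign * (X.sign * form X x p) ^ 2 - form X x (w 0) ^ 2 := by
      have h3 := congrArg (form X x) hrecx
      simp only [form_add_right, form_smul_right, hxx] at h3
      linear_combination -h3 + X.sign * form X x p ^ 2 * hσ
    -- Points with `⟨x, e₁⟩ = 0` lie in a null hyperplane; elsewhere the squared radius is positive
    -- and the polar angle is the coordinate `t`.
    by_cases h0 : form X x e₁ = 0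
    · left
      rw [LinearMap.mem_ker, formBilin_apply, form_comm, h0]
    · right
      obtain ⟨t, ht, hc, hs'⟩ := exists_polar_angle (form X x e₁) (form X x e₂)
      refine ⟨t, ht, ![X.sign * form X x p, form X x (w 0)], ?_, ?_⟩
      · rw [hrad]
        simp only [Matrix.cons_val_zero, Matrix.cons_val_one]
        rw [← hsq]
        positivity
      · rw [cyl, hrad]
        simp only [Matrix.cons_val_zero, Matrix.cons_val_one, Fin.sum_univ_two, hdd]
        rw [← hsq, smul_add, smul_smul, smul_smul, ← hc, ← hs']
        conv_lhs => rw [hrecx]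
        abel
  have hcp : ∀ t v, form X (cyl X (fun t => Real.cos t • e₁ + Real.sin t • e₂) d 1
      ![X.sign, 1] t v) p = X.sign * v 0 := fun t v => by
    have := hcyl.form_cyl_d t v 0
    simp only [hdd, Matrix.cons_val_zero] at this
    rw [this, mul_comm]
  have hce : ∀ t v, form X (cyl X (fun t => Real.cos t • e₁ + Real.sin t • e₂) d 1
      ![X.sign, 1] t v) e₁ ^ 2 + form X (cyl X (fun t => Real.cos t • e₁ + Real.sin t • e₂) d 1
      ![X.sign, 1] t v) e₂ ^ 2 = √(cylRadSq X 1 ![X.sign, 1] v) ^ 2 := fun t v => by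
    simp [cyl, hdd, h11, h22, h12, h1p, h2p, form_comm p e₁, form_comm p e₂, form_comm e₂ e₁,
      form_comm (w 0), h1w, h2w]
    linear_combination √(cylRadSq X 1 ![X.sign, 1] v) ^ 2 * Real.sin_sq_add_cos_sq t
  -- Completing the square: the squared torus inequality says that `v` lies in an ellipse centred at
  -- `(cos R cos r, 0)`.
  have hid : ∀ v : Fin 2 → ℝ, X.sinX R ^ 2 * cylRadSq X 1 ![X.sign, 1] v -
      (X.sign * X.cosX r - X.sign * X.cosX R * v 0) ^ 2 = (X.sinX R * X.sinX r) ^ 2 -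
        ((v 0 - X.cosX R * X.cosX r) ^ 2 + X.sinX R ^ 2 * v 1 ^ 2) := by
    intro v
    rw [hrad]
    have e1 : X.sinX R ^ 2 = X.sign * (1 - X.cosX R ^ 2) := by
      linear_combination X.sign * hR - X.sinX R ^ 2 * hσ
    have e2 : X.sinX r ^ 2 = X.sign * (1 - X.cosX r ^ 2) := by
      linear_combination X.sign * hr - X.sinX r ^ 2 * hσ
    rw [mul_pow, e1, e2]
    linear_combination (-(1 - X.cosX R ^ 2) * v 0 ^ 2 - (X.cosX r - X.cosX R * v 0) ^ 2 +
      (1 - X.cosX R ^ 2) - (1 - X.cosX R ^ 2) * (1 - X.cosX r ^ 2)) * hσ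
  have hvol : ∀ P : Set (Fin 2 → ℝ), volume P = ENNReal.ofReal
      (π * (X.sinX R * X.sinX r) ^ 2 / X.sinX R) → volume (Set.Ioc (-π) π ×ˢ P) =
      ENNReal.ofReal (2 * π ^ 2 * X.sinX R * X.sinX r ^ 2) := by
    intro P hP
    rw [Measure.volume_eq_prod, Measure.prod_prod, hP, Real.volume_Ioc,
      ← ENNReal.ofReal_mul (by linarith [Real.pi_pos])]
    congr 1
    field_simp
    ring
  -- The parameter set lies between an open and a closed ellipse of equal area. Strict inequality is
  -- what yields a positive squared radius in the lower bound.
  apply le_antisymm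
  · rw [← hvol _ (volume_ellipse_le (X.cosX R * X.cosX r) hS (mul_pos hS hs))]
    refine measure_mono ?_
    rintro ⟨t, v⟩ ⟨ht, hv, hx⟩
    refine ⟨ht, ?_⟩
    simp only at hv hx ⊢
    rw [hmem, hce, hcp, Real.sqrt_sq (Real.sqrt_nonneg _)] at hx
    have hf := hfar _ hx.1
    rw [hcp] at hf
    have h2 := pow_le_pow_left₀ (by linarith) (by linarith [hx.2] :
      X.sign * X.cosX r - X.cosX R * (X.sign * v 0) ≤
        X.sinX R * √(cylRadSq X 1 ![X.sign, 1] v)) 2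
    rw [mul_pow, Real.sq_sqrt hv.le] at h2
    have := hid v
    simp only [Set.mem_ofPred_eq]
    linarith [show (X.sign * X.cosX r - X.cosX R * (X.sign * v 0)) ^ 2 =
      (X.sign * X.cosX r - X.sign * X.cosX R * v 0) ^ 2 by ring]
  · rw [← hvol _ (volume_ellipse_lt (X.cosX R * X.cosX r) hS (mul_pos hS hs))]
    refine measure_mono ?_
    rintro ⟨t, v⟩ ⟨ht, hv⟩
    simp only [Set.mem_ofPred_eq] at hv ht ⊢
    have h1 := hid v
    have h2 : 0 < X.sinX R ^ 2 * cylRadSq X 1 ![X.sign, 1] v := by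
      have := sq_nonneg (X.sign * X.cosX r - X.sign * X.cosX R * v 0)
      linarith
    have hrv : 0 < cylRadSq X 1 ![X.sign, 1] v := (pos_iff_pos_of_mul_pos h2).1 (by positivity)
    refine ⟨ht, hrv, ?_⟩
    rw [hmem, hce, hcp, Real.sqrt_sq (Real.sqrt_nonneg _)]
    constructor
    · refine hnear _ (hcyl.form_cyl_self t hrv.le) ?_
      rw [hcp, ← mul_assoc, hσ, one_mul]
      have : 0 ≤ X.sinX R ^ 2 * v 1 ^ 2 := by positivity
      linarith
    · have h3 : (X.sign * X.cosX r - X.sign * X.cosX R * v 0) ^ 2 ≤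
          (X.sinX R * √(cylRadSq X 1 ![X.sign, 1] v)) ^ 2 := by
        rw [mul_pow, Real.sq_sqrt hrv.le]
        linarith
      have := abs_le_of_sq_le_sq h3 (by positivity)
      linarith [le_of_abs_le this]

theorem vol_solidTorus_spherical {p e₁ e₂ : Fin (3 + 1) → ℝ} {R r : ℝ}
    (h : IsTangentFrame .spherical p e₁ e₂) (hr : 0 < r) (hrR : r ≤ R) (hR : r + R ≤ π) :
    vol .spherical (solidTorus .spherical p e₁ e₂ R r) =
      ENNReal.ofReal (2 * π ^ 2 * Real.sin R * Real.sin r ^ 2) := by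
  have hc : ∀ t, Geometry.spherical.cosX t ^ 2 +
      Geometry.spherical.sign * Geometry.spherical.sinX t ^ 2 = 1 := fun t => by
    simp [Geometry.cosX, Geometry.sinX, Geometry.sign]
  refine vol_solidTorus h (Real.sin_pos_of_pos_of_lt_pi (by linarith) (by linarith))
    (Real.sin_pos_of_pos_of_lt_pi hr (by linarith)) (hc R) (hc r) ?_
    (fun y _ hy => form_spherical_self_pos hy) ?_ (fun x hx _ => hx)
  · intro θ x hx
    rw [gdist_spherical_le_iff hr.le (by linarith)]
    simp [Geometry.cosX, Geometry.sign]
  · intro x hx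
    have hx1 : form .spherical x x = 1 := hx
    have hp1 : form .spherical p p = 1 := h.1
    have hcs := Finset.sum_mul_sq_le_sq_mul_sq Finset.univ x p
    simp only [form_spherical, ← sq] at hx1 hp1
    rw [hx1, hp1, ← form_spherical, one_mul] at hcs
    have h1 : |form .spherical x p| ≤ 1 := by
      rwa [← sq_le_one_iff_abs_le_one]
    -- The bound on `-cos R` uses `r + R ≤ π`, the one on `cos R` uses `r ≤ R`.
    have h2 : |Real.cos R| ≤ Real.cos r := by
      rw [abs_le]
      constructor
      · have := Real.cos_le_cos_of_nonneg_of_le_pi (x := r) (y := π - R) hr.le (by linarith)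
          (by linarith)
        rw [Real.cos_pi_sub] at this
        linarith
      · exact Real.cos_le_cos_of_nonneg_of_le_pi hr.le (by linarith) hrR
    simp only [Geometry.cosX, Geometry.sign, one_mul]
    calc Real.cos R * form .spherical x p ≤ |Real.cos R| * |form .spherical x p| := by
          rw [← abs_mul]; exact le_abs_self _
      _ ≤ |Real.cos R| * 1 := by gcongr
      _ ≤ Real.cos r := by rwa [mul_one]

theorem vol_solidTorus_hyperbolic {p e₁ e₂ : Fin (3 + 1) → ℝ} {R r : ℝ}
    (h : IsTangentFrame .hyperbolic p e₁ e₂) (hr : 0 < r) (hrR : r ≤ R) :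
    vol .hyperbolic (solidTorus .hyperbolic p e₁ e₂ R r) =
      ENNReal.ofReal (2 * π ^ 2 * Real.sinh R * Real.sinh r ^ 2) := by
  have hc : ∀ t, Geometry.hyperbolic.cosX t ^ 2 +
      Geometry.hyperbolic.sign * Geometry.hyperbolic.sinX t ^ 2 = 1 := fun t => by
    simp only [Geometry.cosX, Geometry.sinX, Geometry.sign]
    linear_combination Real.cosh_sq t
  have hcR : Real.cosh r ≤ Real.cosh R := by
    rw [Real.cosh_le_cosh, abs_of_pos hr, abs_of_pos (hr.trans_le hrR)]
    exact hrR
  have hp := h.1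
  refine vol_solidTorus h (Real.sinh_pos_iff.2 (by linarith))
    (Real.sinh_pos_iff.2 hr) (hc R) (hc r) ?_
    (fun y hyp hy => form_hyperbolic_self_pos hp.1 hyp hy) ?_ ?_
  · intro θ x hx
    have hq : circlePoint .hyperbolic p e₁ e₂ R θ ∈ space .hyperbolic 3 := by
      refine mem_space_of_form_neg hp (form_circlePoint_self h (hc R) θ) ?_
      obtain ⟨-, -, -, -, h1p, h2p⟩ := h
      rw [form_circlePoint, form_comm p e₁, form_comm p e₂, h1p, h2p, hp.1]
      simp [Geometry.cosX, Real.cosh_pos]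
    rw [gdist_hyperbolic_le_iff hr.le hq hx]
    simp [Geometry.cosX, Geometry.sign]
  · intro x hx
    have := form_le_neg_one hx hp
    simp only [Geometry.cosX, Geometry.sign]
    nlinarith [Real.cosh_pos R]
  · intro x hx hxp
    refine mem_space_of_form_neg hp hx ?_
    simp only [Geometry.cosX, Geometry.sinX, Geometry.sign] at hxp
    have h1 := Real.cosh_sq R
    have h2 := Real.cosh_sq r
    have h3 : 0 < Real.cosh R * Real.cosh r := mul_pos (Real.cosh_pos R) (Real.cosh_pos r)
    have h4 : (Real.sinh R * Real.sinh r) ^ 2 ≤ (Real.cosh R * Real.cosh r) ^ 2 := by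
      rw [mul_pow, mul_pow, h1, h2]
      nlinarith [sq_nonneg (Real.sinh R), sq_nonneg (Real.sinh r)]
    have h5 := abs_lt_of_sq_lt_sq (hxp.trans_le h4) h3.le
    have := (abs_lt.1 h5).1
    linarith

end Torus

/-! ### Cones -/

section Cone

/-- A frame `o`, `b`, `d` adapted to the geodesic of length `h` from `o` to `p`. -/
structure IsConeFrame (X : Geometry) {m : ℕ} (o p b : Fin (m + 1 + 1) → ℝ)
    (d : Fin m → Fin (m + 1 + 1) → ℝ) (h : ℝ) : Prop where
  o_mem : o ∈ space X (m + 1)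
  p_mem : p ∈ space X (m + 1)
  h_pos : 0 < h
  h_lt : X = .spherical → h < π
  p_eq : p = X.cosX h • o + X.sinX h • b
  form_b_b : form X b b = 1
  form_o_b : form X o b = 0
  form_o_d : ∀ i, form X o (d i) = 0
  form_b_d : ∀ i, form X b (d i) = 0
  form_d_d : ∀ i j, form X (d i) (d j) = if i = j then 1 else 0
  eq_sum : ∀ x, x = (X.sign * form X x o) • o + form X x b • b + ∑ i, form X x (d i) • d i

lemma cosX_sq_add (X : Geometry) (t : ℝ) : X.cosX t ^ 2 + X.sign * X.sinX t ^ 2 = 1 := by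
  cases X
  · simp [Geometry.cosX, Geometry.sinX, Geometry.sign]
  · simp only [Geometry.cosX, Geometry.sinX, Geometry.sign]
    linear_combination Real.cosh_sq t

lemma continuous_sinX (X : Geometry) : Continuous X.sinX := by
  cases X
  · exact Real.continuous_sin
  · exact Real.continuous_sinh

variable {X : Geometry} {m : ℕ} {o p b : Fin (m + 1 + 1) → ℝ}
  {d : Fin m → Fin (m + 1 + 1) → ℝ} {h : ℝ}

/-- On the sphere, `0 < h < π` rules out the arguments at which `arccos` is clamped. -/
lemma form_eq_of_gdist_eq {n : ℕ} {o p : Fin (n + 1) → ℝ} (ho : o ∈ space X n)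
    (hp : p ∈ space X n) (hd : gdist X o p = h) (h0 : 0 < h) (hπ : X = .spherical → h < π) :
    form X o p = X.sign * X.cosX h := by
  cases X
  · simp only [gdist] at hd
    simp only [Geometry.sign, Geometry.cosX, one_mul]
    rw [← hd, Real.cos_arccos]
    · by_contra! hlt
      rw [Real.arccos_of_le_neg_one hlt.le] at hd
      exact (hπ rfl).ne hd.symm
    · by_contra! hlt
      rw [Real.arccos_of_one_le hlt.le] at hd
      exact h0.ne hd
  · simp only [gdist] at hd
    simp only [Geometry.sign, Geometry.cosX]
    rw [← hd, Real.cosh_arcosh]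
    · ring
    · linarith [form_le_neg_one ho hp]

lemma sinX_pos {t : ℝ} (h0 : 0 < t) (hπ : X = .spherical → t < π) : 0 < X.sinX t := by
  cases X
  · exact Real.sin_pos_of_pos_of_lt_pi h0 (hπ rfl)
  · exact Real.sinh_pos_iff.2 h0

lemma pos_of_form_eq_zero {n : ℕ} {o y : Fin (n + 1) → ℝ} (ho : o ∈ space X n)
    (hy : form X y o = 0) (hy0 : y ≠ 0) : 0 < form X y y := by
  cases X
  · exact form_spherical_self_pos hy0
  · exact form_hyperbolic_self_pos ho.1 hy hy0

/-- The unit tangent vector at `o` in the direction of `p`. -/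
lemma exists_direction {n : ℕ} {o p : Fin (n + 1) → ℝ} (ho : o ∈ space X n) (hp : p ∈ space X n)
    (hd : gdist X o p = h) (h0 : 0 < h) (hπ : X = .spherical → h < π) :
    ∃ b : Fin (n + 1) → ℝ, p = X.cosX h • o + X.sinX h • b ∧ form X b b = 1 ∧
      form X o b = 0 := by
  have hS := sinX_pos h0 hπ
  have hop := form_eq_of_gdist_eq ho hp hd h0 hπ
  have hoo := form_self_of_mem_space ho
  have hpp := form_self_of_mem_space hp
  have hσ := sign_mul_sign X
  have hC := cosX_sq_add X h
  refine ⟨(X.sinX h)⁻¹ • (p - X.cosX h • o), ?_, ?_, ?_⟩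
  · rw [smul_smul, mul_inv_cancel₀ hS.ne', one_smul]
    abel
  · simp only [form_smul_left, form_smul_right, form_sub_left, form_sub_right, form_comm p o, hop,
      hoo, hpp]
    field_simp
    linear_combination -X.sign * hC + X.sinX h ^ 2 * hσ
  · simp only [form_smul_right, form_sub_right, hop, hoo]
    ring

lemma exists_isConeFrame (ho : o ∈ space X (m + 1)) (hp : p ∈ space X (m + 1))
    (hd : gdist X o p = h) (h0 : 0 < h) (hπ : X = .spherical → h < π) :
    ∃ b d, IsConeFrame X (m := m) o p b d h := by
  obtain ⟨b, hpb, hbb, hob⟩ := exists_direction ho hp hd h0 hπ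
  have hoo := form_self_of_mem_space ho
  have hσ := sign_mul_sign X
  obtain ⟨d, hdd, hbd, hrec⟩ := exists_frame (X := X) (n := m + 1) (k := 2) (m := m) rfl
    ![o, b] ![X.sign, 1] (by intro i; fin_cases i <;> simp [hσ])
    (by intro i j; fin_cases i <;> fin_cases j <;> simp [hoo, hbb, hob, form_comm b o])
    (fun y hy hy0 => pos_of_form_eq_zero ho (hy 0) hy0)
  refine ⟨b, d, ho, hp, h0, hπ, hpb, hbb, hob, hbd 0, hbd 1, hdd, fun x => ?_⟩
  have := hrec x
  simp only [Fin.sum_univ_two] at this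
  simpa using this

namespace IsConeFrame

lemma sinX_pos (hf : IsConeFrame X o p b d h) : 0 < X.sinX h :=
  NonEuclid.sinX_pos hf.h_pos hf.h_lt

lemma form_self_eq (hf : IsConeFrame X o p b d h) (x : Fin (m + 1 + 1) → ℝ) :
    form X x x = X.sign * form X x o ^ 2 + form X x b ^ 2 + ∑ i, form X x (d i) ^ 2 := by
  have h1 := congrArg (form X x) (hf.eq_sum x)
  simp only [form_add_right, form_smul_right, form_sum_right] at h1
  rw [h1]
  simp only [sq, mul_assoc]

lemma form_p (hf : IsConeFrame X o p b d h) (x : Fin (m + 1 + 1) → ℝ) :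
    form X x p = X.cosX h * form X x o + X.sinX h * form X x b := by
  rw [hf.p_eq, form_add_right, form_smul_right, form_smul_right]

/-- The equation says that the component of `x` in the plane of `o` and `b` is a multiple of `p`. -/
lemma mem_perpHyperplane_iff (hf : IsConeFrame X o p b d h) {x : Fin (m + 1 + 1) → ℝ} :
    x ∈ perpHyperplane X p o ↔ x ∈ space X (m + 1) ∧
      X.sinX h * (X.sign * form X x o) = X.cosX h * form X x b := by
  have hS := hf.sinX_pos
  have hC := cosX_sq_add X h
  have hop : form X o p / form X p p = X.cosX h := by
    rw [hf.form_p, form_self_of_mem_space hf.p_mem, form_self_of_mem_space hf.o_mem, hf.form_o_b]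
    have := sign_ne_zero X
    field_simp
    ring
  have h1 : form X x (o - (form X o p / form X p p) • p) = X.sinX h *
      (X.sinX h * (X.sign * form X x o) - X.cosX h * form X x b) := by
    rw [form_sub_right, form_smul_right, hop, hf.form_p]
    linear_combination -form X x o * hC
  unfold perpHyperplane
  rw [Set.mem_ofPred_eq, h1, mul_eq_zero, or_iff_right hS.ne', sub_eq_zero]

lemma form_p_of_perp (hf : IsConeFrame X o p b d h) {x : Fin (m + 1 + 1) → ℝ}
    (hx : X.sinX h * (X.sign * form X x o) = X.cosX h * form X x b) :
    X.sinX h * form X x p = X.sign * form X x b := by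
  rw [hf.form_p]
  linear_combination X.sign * X.cosX h * hx -
    X.sinX h * X.cosX h * form X x o * sign_mul_sign X +
    X.sign * form X x b * cosX_sq_add X h - X.sinX h ^ 2 * form X x b * sign_mul_sign X

/-- Here `x = (⟨x, b⟩ / sin h) p + ∑ ⟨x, dᵢ⟩ dᵢ`, an orthogonal decomposition. -/
lemma form_self_of_perp (hf : IsConeFrame X o p b d h) {x : Fin (m + 1 + 1) → ℝ}
    (hx : X.sinX h * (X.sign * form X x o) = X.cosX h * form X x b) :
    X.sign * form X x x = (form X x b / X.sinX h) ^ 2 + X.sign * ∑ i, form X x (d i) ^ 2 := by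
  have hS := hf.sinX_pos
  have hC := cosX_sq_add X h
  have hσ := sign_mul_sign X
  rw [hf.form_self_eq]
  have h0 : X.sign * form X x o = X.cosX h * form X x b / X.sinX h := by
    rw [eq_div_iff hS.ne']; linarith
  have h1 : X.sign * (X.sign * form X x o ^ 2) = (X.sign * form X x o) ^ 2 := by ring
  rw [mul_add, mul_add, h1, h0]
  field_simp
  linear_combination form X x b ^ 2 * hC

lemma mem_space_of_perp (hf : IsConeFrame X o p b d h) {x : Fin (m + 1 + 1) → ℝ}
    (hx : X.sinX h * (X.sign * form X x o) = X.cosX h * form X x b)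
    (hxx : form X x x = X.sign) (hxb : 0 ≤ form X x b) : x ∈ space X (m + 1) := by
  have hS := hf.sinX_pos
  have h1 := hf.form_p_of_perp hx
  have h2 := hf.form_self_of_perp hx
  cases X
  · exact hxx
  · refine mem_space_of_form_neg hf.p_mem hxx ?_
    have hne : form .hyperbolic x b ≠ 0 := by
      intro h0
      rw [h0, hxx] at h2
      have : 0 ≤ ∑ i, form .hyperbolic x (d i) ^ 2 := Finset.sum_nonneg fun i _ => sq_nonneg _
      simp only [Geometry.sign] at h2
      norm_num at h2
      linarith
    have hpos : 0 < form .hyperbolic x b := lt_of_le_of_ne hxb hne.symm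
    simp only [Geometry.sign] at h1
    nlinarith

/-- A cone over a base that is homogeneous in the coordinates of the frame. -/
lemma coneOver_eq (hf : IsConeFrame X o p b d h) {B : Set (Fin (m + 1 + 1) → ℝ)}
    {Q : Set (ℝ × (Fin m → ℝ))}
    (hB : ∀ x, x ∈ B ↔ x ∈ perpHyperplane X p o ∧ (form X x b, fun i => form X x (d i)) ∈ Q)
    (hQs : ∀ s : ℝ, 0 ≤ s → ∀ q ∈ Q, s • q ∈ Q) (hQ1 : ∀ q ∈ Q, 0 ≤ q.1)
    (hQN : ∀ q ∈ Q, q ≠ 0 → 0 < (q.1 / X.sinX h) ^ 2 + X.sign * ∑ i, q.2 i ^ 2)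
    (hpB : p ∈ B) (z : Fin (m + 1 + 1) → ℝ) :
    z ∈ coneOver X o B ↔ z ∈ space X (m + 1) ∧
      X.cosX h * form X z b ≤ X.sinX h * (X.sign * form X z o) ∧
      (form X z b, fun i => form X z (d i)) ∈ Q := by
  have hS := hf.sinX_pos
  have hσ := sign_mul_sign X
  have hoo := form_self_of_mem_space hf.o_mem
  simp only [coneOver, geodesicSegment, Set.mem_iUnion, exists_prop, Set.mem_ofPred_eq]
  constructor
  · rintro ⟨x, hx, hz, s, t, hs, ht, rfl⟩
    obtain ⟨hxp, hxQ⟩ := (hB x).1 hx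
    have hx0 := (hf.mem_perpHyperplane_iff.1 hxp).2
    refine ⟨hz, ?_, ?_⟩
    · simp only [form_add_left, form_smul_left, hoo, hf.form_o_b, mul_zero, zero_add]
      have : 0 ≤ s * X.sinX h := by positivity
      linear_combination this + t * hx0.symm - s * X.sinX h * hσ
    · convert! hQs t ht _ hxQ using 1
      simp [hf.form_o_b, hf.form_o_d, Prod.ext_iff, funext_iff]
  · rintro ⟨hz, hle, hQ⟩
    -- The multiple of `o` whose removal moves `z` into the linear hyperplane of the base; the
    -- inequality on `z` says precisely that it is nonnegative.
    set s := X.sign * form X z o - X.cosX h * form X z b / X.sinX h with hs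
    have hs0 : 0 ≤ s := by
      rw [hs, sub_nonneg, div_le_iff₀ hS]; linarith
    set y := z - s • o with hy
    have hyb : form X y b = form X z b := by simp [hy, hf.form_o_b]
    have hyd : ∀ i, form X y (d i) = form X z (d i) := fun i => by simp [hy, hf.form_o_d]
    have hyo : X.sinX h * (X.sign * form X y o) = X.cosX h * form X y b := by
      rw [hyb]
      simp only [hy, form_sub_left, form_smul_left, hoo]
      have : s * X.sinX h = X.sign * form X z o * X.sinX h - X.cosX h * form X z b := by
        rw [hs]; field_simp
      linear_combination -this - s * X.sinX h * hσ
    have hzy : z = s • o + y := by rw [hy]; abel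
    -- If all these coordinates vanish, `z` is a multiple of the apex, and any base point, such as
    -- `p`, will do with weight `0`. Otherwise `hQN` makes `y` normalizable to a point of the base.
    by_cases hq : ((form X z b, fun i => form X z (d i)) : ℝ × (Fin m → ℝ)) = 0
    · have h1 : form X z b = 0 := congrArg Prod.fst hq
      have h2 : ∀ i, form X z (d i) = 0 := fun i => congrFun (congrArg Prod.snd hq) i
      have hy0 : y = 0 := by
        have h3 : X.sign * form X y o = 0 := by
          rw [hyb, h1, mul_zero] at hyo
          exact (mul_eq_zero.1 hyo).resolve_left hS.ne'
        rw [hf.eq_sum y, h3, hyb, h1]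
        simp [hyd, h2]
      exact ⟨p, hpB, hz, s, 0, hs0, le_rfl, by rw [hzy, hy0]; simp⟩
    · have hN := hQN _ hQ hq
      have hN2 := hf.form_self_of_perp hyo
      simp only [hyb, hyd] at hN2
      simp only [← hN2] at hN
      set t := √(X.sign * form X y y) with ht
      have ht0 : 0 < t := Real.sqrt_pos.2 hN
      have htt : t * t = X.sign * form X y y := Real.mul_self_sqrt hN.le
      have hxo : X.sinX h * (X.sign * form X (t⁻¹ • y) o) = X.cosX h * form X (t⁻¹ • y) b := by
        simp only [form_smul_left]
        linear_combination t⁻¹ * hyo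
      refine ⟨t⁻¹ • y, ?_, hz, s, t, hs0, ht0.le, ?_⟩
      · rw [hB, hf.mem_perpHyperplane_iff]
        refine ⟨⟨hf.mem_space_of_perp hxo ?_ ?_, hxo⟩, ?_⟩
        · simp only [form_smul_left, form_smul_right]
          field_simp
          linear_combination -X.sign * htt - form X y y * hσ
        · rw [form_smul_left, hyb]
          exact mul_nonneg (inv_nonneg.2 ht0.le) (hQ1 _ hQ)
        · convert! hQs t⁻¹ (inv_nonneg.2 ht0.le) _ hQ using 1
          simp [hyb, hyd, Prod.ext_iff, funext_iff]
      · rw [smul_smul, mul_inv_cancel₀ ht0.ne', one_smul, ← hzy]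

lemma isCylinder (hf : IsConeFrame X o p b d h) : ∃ E',
    IsCylinder X (fun t => X.cosX t • o + X.sinX t • b) E' d X.sign (fun _ => 1) := by
  have hoo := form_self_of_mem_space hf.o_mem
  cases X
  · exact ⟨_, isCylinder_circle hoo hf.form_b_b hf.form_o_b hf.form_o_d hf.form_b_d hf.form_d_d
      (fun _ => one_mul 1) (by simp [Geometry.sign])⟩
  · exact ⟨_, isCylinder_hyperbola hoo hf.form_b_b hf.form_o_b hf.form_o_d hf.form_b_d hf.form_d_d
      (fun _ => one_mul 1) (by simp [Geometry.sign])⟩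

lemma cylRadSq_eq (v : Fin m → ℝ) :
    cylRadSq X X.sign (fun _ => 1) v = 1 - X.sign * ∑ i, v i ^ 2 := by
  simp only [cylRadSq, one_mul]
  linear_combination sign_mul_sign X

/-- The `(o, b)` coordinates trace a circle or one branch of a hyperbola: the parameter is a polar
angle or an `arsinh`, the branch being selected by `⟨z, o⟩ ≤ -1`. -/
lemma exists_angle (hf : IsConeFrame X o p b d h) {z : Fin (m + 1 + 1) → ℝ}
    (hz : z ∈ space X (m + 1)) (hr : 0 < 1 - X.sign * ∑ i, form X z (d i) ^ 2) :
    ∃ t, (X = .spherical → t ∈ Set.Ioc (-π) π) ∧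
      X.sign * form X z o = √(1 - X.sign * ∑ i, form X z (d i) ^ 2) * X.cosX t ∧
      form X z b = √(1 - X.sign * ∑ i, form X z (d i) ^ 2) * X.sinX t := by
  have hzz := hf.form_self_eq z
  rw [form_self_of_mem_space hz] at hzz
  cases X
  · obtain ⟨t, ht, h1, h2⟩ := exists_polar_angle (form .spherical z o) (form .spherical z b)
    have : form .spherical z o ^ 2 + form .spherical z b ^ 2 =
        1 - Geometry.spherical.sign * ∑ i, form .spherical z (d i) ^ 2 := by
      simp only [Geometry.sign] at *
      linarith
    rw [this] at h1 h2
    exact ⟨t, fun _ => ht, by simpa [Geometry.sign, Geometry.cosX] using h1, h2⟩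
  · set c := √(1 - Geometry.hyperbolic.sign * ∑ i, form .hyperbolic z (d i) ^ 2) with hc
    have hc0 : 0 < c := Real.sqrt_pos.2 hr
    have hcc : c ^ 2 = 1 - Geometry.hyperbolic.sign * ∑ i, form .hyperbolic z (d i) ^ 2 :=
      Real.sq_sqrt hr.le
    have hzo := form_le_neg_one hz hf.o_mem
    refine ⟨Real.arsinh (form .hyperbolic z b / c), (fun hX => nomatch hX), ?_, ?_⟩
    · simp only [Geometry.sign, Geometry.cosX] at *
      rw [Real.cosh_arsinh]
      have : 1 + (form .hyperbolic z b / c) ^ 2 = (-form .hyperbolic z o / c) ^ 2 := by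
        field_simp
        linarith
      rw [this, Real.sqrt_sq (div_nonneg (by linarith) hc0.le)]
      field_simp
    · simp only [Geometry.sinX]
      rw [Real.sinh_arsinh]
      field_simp

/-- The volume of a cone as a Lebesgue measure. -/
theorem vol_coneOver (hf : IsConeFrame X o p b d h) {B : Set (Fin (m + 1 + 1) → ℝ)}
    {Q : Set (ℝ × (Fin m → ℝ))} (hQm : MeasurableSet Q)
    (hB : ∀ x, x ∈ B ↔ x ∈ perpHyperplane X p o ∧ (form X x b, fun i => form X x (d i)) ∈ Q)
    (hQs : ∀ s : ℝ, 0 ≤ s → ∀ q ∈ Q, s • q ∈ Q) (hQ1 : ∀ q ∈ Q, 0 ≤ q.1)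
    (hQN : ∀ q ∈ Q, q ≠ 0 → 0 < (q.1 / X.sinX h) ^ 2 + X.sign * ∑ i, q.2 i ^ 2)
    (hpB : p ∈ B) :
    vol X (coneOver X o B) = ∫⁻ t in Set.Ioc 0 h,
      volume {v : Fin m → ℝ | 0 < 1 - X.sign * ∑ i, v i ^ 2 ∧
        (√(1 - X.sign * ∑ i, v i ^ 2) * X.sinX t, v) ∈ Q} := by
  have hoo := form_self_of_mem_space hf.o_mem
  have hσ := sign_mul_sign X
  obtain ⟨E', hcyl⟩ := hf.isCylinder
  have hmem := hf.coneOver_eq hB hQs hQ1 hQN hpB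
  have hAs : coneOver X o B ⊆ space X (m + 1) := fun z hz => ((hmem z).1 hz).1
  have hA : coneOver X o B = space X (m + 1) ∩ ({z | X.cosX h * form X z b ≤
      X.sinX h * (X.sign * form X z o)} ∩
      (fun z => (form X z b, fun i => form X z (d i))) ⁻¹' Q) := by
    ext z; exact hmem z
  have hAm : MeasurableSet (coneOver X o B) := by
    rw [hA]
    refine measurableSet_space.inter ((measurableSet_le (by fun_prop) (by fun_prop)).inter ?_)
    refine Measurable.prodMk (by fun_prop) ?_ hQm
    exact measurable_pi_lambda _ fun i => by fun_prop
  -- One full turn on the sphere, the whole line in hyperbolic space.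
  set T : Set ℝ := {t | X = .spherical → t ∈ Set.Ioc (-π) π} with hT
  have hTm : MeasurableSet T := by
    cases X
    · simp only [hT, forall_const]; exact measurableSet_Ioc
    · simp [hT]
  have hinj : Set.InjOn (fun t => X.cosX t • o + X.sinX t • b) T := by
    cases X
    · simp only [hT, forall_const]
      exact injOn_circle hoo hf.form_b_b hf.form_o_b
    · exact (injective_hyperbola hf.form_b_b hf.form_o_b).injOn
  rw [hcyl.vol_eq hAm hAs hTm hinj (ker_formBilin_ne_top (b := o)
    (by rw [hoo]; exact sign_ne_zero X))]
  swap
  · intro z hz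
    by_cases h0 : form X z o = 0
    · left
      rw [LinearMap.mem_ker, formBilin_apply, form_comm, h0]
    · right
      have hr : 0 < 1 - X.sign * ∑ i, form X z (d i) ^ 2 := by
        have hzz := hf.form_self_eq z
        rw [form_self_of_mem_space (hAs hz)] at hzz
        cases X
        · simp only [Geometry.sign, one_mul] at *
          have : 0 < form .spherical z o ^ 2 := by positivity
          nlinarith [sq_nonneg (form .spherical z b)]
        · simp only [Geometry.sign] at *
          have : 0 ≤ ∑ i, form .hyperbolic z (d i) ^ 2 := Finset.sum_nonneg fun i _ => sq_nonneg _
          linarith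
      obtain ⟨t, ht, h1, h2⟩ := hf.exists_angle (hAs hz) hr
      refine ⟨t, ht, fun i => form X z (d i), by rwa [cylRadSq_eq], ?_⟩
      rw [cyl, cylRadSq_eq, smul_add, smul_smul, smul_smul, ← h1, ← h2]
      exact hf.eq_sum z
  -- By the addition formula the inequality of `coneOver_eq` becomes `sin (h - t) ≥ 0`, that is `t ≤
  -- h`, while nonnegativity of the first coordinate on `Q` becomes `sin t ≥ 0`, that is `t ≥ 0`.
  have hset : {q : ℝ × (Fin m → ℝ) | q.1 ∈ T ∧ 0 < cylRadSq X X.sign (fun _ => 1) q.2 ∧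
      cyl X (fun t => X.cosX t • o + X.sinX t • b) d X.sign (fun _ => 1) q.1 q.2 ∈
        coneOver X o B} = {q | q.1 ∈ Set.Icc 0 h ∧ 0 < 1 - X.sign * ∑ i, q.2 i ^ 2 ∧
        (√(1 - X.sign * ∑ i, q.2 i ^ 2) * X.sinX q.1, q.2) ∈ Q} := by
    ext ⟨t, v⟩
    simp only [Set.mem_ofPred_eq, cylRadSq_eq, hmem]
    have hbd : ∀ i, form X (d i) b = 0 := fun i => by rw [form_comm, hf.form_b_d]
    have hdo : ∀ i, form X (d i) o = 0 := fun i => by rw [form_comm, hf.form_o_d]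
    have e1 : form X (cyl X (fun t => X.cosX t • o + X.sinX t • b) d X.sign (fun _ => 1) t v) b =
        √(1 - X.sign * ∑ i, v i ^ 2) * X.sinX t := by
      simp [cyl, cylRadSq_eq, hf.form_o_b, hf.form_b_b, hbd]
    have e0 : X.sign * form X (cyl X (fun t => X.cosX t • o + X.sinX t • b) d X.sign
        (fun _ => 1) t v) o = √(1 - X.sign * ∑ i, v i ^ 2) * X.cosX t := by
      simp only [cyl, cylRadSq_eq, form_add_left, form_smul_left, form_sum_left, hdo,
        form_comm b o, hf.form_o_b, hoo, mul_zero, Finset.sum_const_zero, add_zero]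
      linear_combination √(1 - X.sign * ∑ i, v i ^ 2) * X.cosX t * hσ
    have e2 : (fun i => form X (cyl X (fun t => X.cosX t • o + X.sinX t • b) d X.sign
        (fun _ => 1) t v) (d i)) = v := by
      ext i; rw [hcyl.form_cyl_d, mul_one]
    rw [e0, e1, e2]
    have hh := hf.h_pos
    constructor
    · rintro ⟨ht, hv, hsp, hle, hQ⟩
      refine ⟨?_, hv, hQ⟩
      have hc : 0 < √(1 - X.sign * ∑ i, v i ^ 2) := Real.sqrt_pos.2 hv
      have h1 : 0 ≤ X.sinX t := nonneg_of_mul_nonneg_right (hQ1 _ hQ) hc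
      have h2 : 0 ≤ X.sinX h * X.cosX t - X.cosX h * X.sinX t := by
        have : 0 ≤ √(1 - X.sign * ∑ i, v i ^ 2) *
          (X.sinX h * X.cosX t - X.cosX h * X.sinX t) := by linarith
        exact nonneg_of_mul_nonneg_right this hc
      cases X
      · have ht' := ht rfl
        have hπ := hf.h_lt rfl
        simp only [Geometry.sinX, Geometry.cosX] at h1 h2
        rw [← Real.sin_sub] at h2
        have ht0 : 0 ≤ t := by
          by_contra! hneg
          exact absurd (Real.sin_neg_of_neg_of_neg_pi_lt hneg ht'.1) (not_lt.2 h1)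
        refine ⟨ht0, ?_⟩
        by_contra! hlt
        exact absurd (Real.sin_neg_of_neg_of_neg_pi_lt (by linarith : h - t < 0)
          (by linarith [ht'.2])) (not_lt.2 h2)
      · simp only [Geometry.sinX, Geometry.cosX] at h1 h2
        rw [mul_comm (Real.cosh h), mul_comm, mul_comm (Real.sinh t), mul_comm (Real.cosh t),
          ← Real.sinh_sub] at h2
        exact ⟨Real.sinh_nonneg_iff.1 h1, by linarith [Real.sinh_nonneg_iff.1 h2]⟩
    · rintro ⟨ht, hv, hQ⟩
      have hc : 0 < √(1 - X.sign * ∑ i, v i ^ 2) := Real.sqrt_pos.2 hv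
      have hself := hcyl.form_cyl_self t (v := v) (by rw [cylRadSq_eq]; exact hv.le)
      have key : 0 ≤ X.sinX h * X.cosX t - X.cosX h * X.sinX t := by
        cases X
        · have hπ := hf.h_lt rfl
          simp only [Geometry.sinX, Geometry.cosX]
          rw [← Real.sin_sub]
          exact Real.sin_nonneg_of_nonneg_of_le_pi (by linarith [ht.2]) (by linarith [ht.1])
        · simp only [Geometry.sinX, Geometry.cosX]
          rw [← Real.sinh_sub, Real.sinh_nonneg_iff]
          linarith [ht.2]
      refine ⟨?_, hv, ?_, ?_, hQ⟩
      · intro hX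
        have hπ := hf.h_lt hX
        exact ⟨by linarith [ht.1, Real.pi_pos], by linarith [ht.2]⟩
      · cases X
        · exact hself
        · refine mem_space_of_form_neg hf.o_mem hself ?_
          have := mul_pos hc (Real.cosh_pos t)
          rw [show Real.cosh t = Geometry.hyperbolic.cosX t from rfl, ← e0] at this
          exact (neg_iff_neg_of_mul_pos this).1 (by norm_num [Geometry.sign])
      · have := mul_nonneg hc.le key
        linarith
  have hm : MeasurableSet {q : ℝ × (Fin m → ℝ) | 0 < 1 - X.sign * ∑ i, q.2 i ^ 2 ∧
        (√(1 - X.sign * ∑ i, q.2 i ^ 2) * X.sinX q.1, q.2) ∈ Q} := by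
    have hS := continuous_sinX X
    have hr : Continuous fun q : ℝ × (Fin m → ℝ) => 1 - X.sign * ∑ i, q.2 i ^ 2 := by fun_prop
    have hc : Continuous fun q : ℝ × (Fin m → ℝ) =>
      √(1 - X.sign * ∑ i, q.2 i ^ 2) * X.sinX q.1 := by fun_prop
    exact (measurableSet_lt measurable_const hr.measurable).inter
      ((hc.measurable.prodMk measurable_snd) hQm)
  have hm2 : MeasurableSet {q : ℝ × (Fin m → ℝ) | q.1 ∈ Set.Icc 0 h ∧
        0 < 1 - X.sign * ∑ i, q.2 i ^ 2 ∧
        (√(1 - X.sign * ∑ i, q.2 i ^ 2) * X.sinX q.1, q.2) ∈ Q} :=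
    (measurable_fst measurableSet_Icc).inter hm
  rw [hset, Measure.volume_eq_prod, Measure.prod_apply hm2, ← setLIntegral_congr Ioc_ae_eq_Icc.symm,
    ← lintegral_indicator measurableSet_Icc]
  refine lintegral_congr fun t => ?_
  by_cases ht : t ∈ Set.Icc 0 h
  · rw [Set.indicator_of_mem ht]
    congr 1
    ext v
    simp only [Set.mem_preimage, Set.mem_ofPred_eq, ht, true_and]
  · rw [Set.indicator_of_notMem ht]
    convert! measure_empty (μ := (volume : Measure (Fin m → ℝ)))
    exact Set.eq_empty_of_forall_notMem fun v hv => ht hv.1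

end IsConeFrame

end Cone

/-! ### Cones over balls as integrals of Euclidean slices -/

section BallCone

/-- Boundedness replaces continuity, because the integrands below contain `1 / sin t`, which has a
junk value at `t = 0`. -/
lemma lintegral_Ioc_ofReal {f : ℝ → ℝ} (hf : Measurable f) {h M : ℝ} (h0 : 0 ≤ h)
    (hb : ∀ t ∈ Set.Ioc 0 h, 0 ≤ f t ∧ f t ≤ M) :
    ∫⁻ t in Set.Ioc 0 h, ENNReal.ofReal (f t) = ENNReal.ofReal (∫ t in (0 : ℝ)..h, f t) := by
  rw [intervalIntegral.integral_of_le h0, ofReal_integral_eq_lintegral_ofReal]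
  · refine Measure.integrableOn_of_bounded (M := M) (by simp) hf.aestronglyMeasurable ?_
    filter_upwards [ae_restrict_mem measurableSet_Ioc] with t ht
    rw [Real.norm_of_nonneg (hb t ht).1]
    exact (hb t ht).2
  · filter_upwards [ae_restrict_mem measurableSet_Ioc] with t ht
    exact (hb t ht).1

variable {X : Geometry} {m : ℕ} {o p b : Fin (m + 1 + 1) → ℝ}
  {d : Fin m → Fin (m + 1 + 1) → ℝ} {h : ℝ}

namespace IsConeFrame

lemma sinX_pos_of_mem (hf : IsConeFrame X o p b d h) {t : ℝ} (ht : t ∈ Set.Ioc 0 h) :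
    0 < X.sinX t :=
  NonEuclid.sinX_pos ht.1 fun hX => ht.2.trans_lt (hf.h_lt hX)

lemma form_p_b (hf : IsConeFrame X o p b d h) : form X p b = X.sinX h := by
  rw [hf.p_eq]
  simp [hf.form_o_b, hf.form_b_b]

lemma form_p_d (hf : IsConeFrame X o p b d h) (i : Fin m) : form X p (d i) = 0 := by
  rw [hf.p_eq]
  simp [hf.form_o_d, hf.form_b_d]

lemma p_mem_perpHyperplane (hf : IsConeFrame X o p b d h) : p ∈ perpHyperplane X p o := by
  rw [hf.mem_perpHyperplane_iff, hf.form_p_b, form_comm, hf.form_p,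
    form_self_of_mem_space hf.o_mem, hf.form_o_b]
  refine ⟨hf.p_mem, ?_⟩
  linear_combination X.cosX h * X.sinX h * sign_mul_sign X

/-- The coordinates of the points of the Euclidean cone over the base of a right cone. -/
def ballBase (X : Geometry) (m : ℕ) (r h : ℝ) : Set (ℝ × (Fin m → ℝ)) :=
  {q | 0 ≤ q.1 ∧ (X.cosX r * X.sinX h) ^ 2 * ∑ i, q.2 i ^ 2 ≤ (X.sinX r * q.1) ^ 2}

/-- With `η = ⟨x, b⟩ / sin h` one has `⟨x, p⟩ = σ η` and `η² + σ ∑ ⟨x, dᵢ⟩² = 1`. This turns the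
distance bound into the homogeneous `cos² r ∑ ⟨x, dᵢ⟩² ≤ sin² r η²`; not dividing by `cos r` keeps
`r = π / 2` on the sphere. -/
lemma mem_ballBase_iff (hf : IsConeFrame X o p b d h) {r : ℝ} (hc : 0 ≤ X.cosX r)
    (hd : ∀ x ∈ space X (m + 1), gdist X p x ≤ r ↔ X.sign * X.cosX r ≤ form X p x)
    (x : Fin (m + 1 + 1) → ℝ) :
    x ∈ {x ∈ perpHyperplane X p o | gdist X p x ≤ r} ↔ x ∈ perpHyperplane X p o ∧
      (form X x b, fun i => form X x (d i)) ∈ ballBase X m r h := by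
  rw [Set.mem_ofPred_eq]
  refine and_congr_right fun hx => ?_
  obtain ⟨hxs, hx0⟩ := hf.mem_perpHyperplane_iff.1 hx
  have hS := hf.sinX_pos
  rw [hd x hxs, form_comm]
  have h1 := hf.form_p_of_perp hx0
  have h2 := hf.form_self_of_perp hx0
  rw [form_self_of_mem_space hxs, sign_mul_sign] at h2
  set η := form X x b / X.sinX h with hη
  have hb : form X x b = X.sinX h * η := by rw [hη]; field_simp
  have h3 : form X x p = X.sign * η := by
    refine mul_left_cancel₀ hS.ne' ?_
    rw [h1, hb]; ring
  have hcs := cosX_sq_add X r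
  rw [h3, ballBase, Set.mem_ofPred_eq, hb, show (X.cosX r * X.sinX h) ^ 2 *
    ∑ i, form X x (d i) ^ 2 = X.sinX h ^ 2 * (X.cosX r ^ 2 * ∑ i, form X x (d i) ^ 2) by ring,
    show (X.sinX r * (X.sinX h * η)) ^ 2 = X.sinX h ^ 2 * (X.sinX r ^ 2 * η ^ 2) by ring,
    mul_le_mul_iff_right₀ (pow_pos hS 2), mul_nonneg_iff_of_pos_left hS]
  cases X
  · simp only [Geometry.sign, one_mul] at *
    have hsum : ∑ i, form .spherical x (d i) ^ 2 = 1 - η ^ 2 := by linarith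
    have hs2 : Geometry.spherical.sinX r ^ 2 = 1 - Geometry.spherical.cosX r ^ 2 := by linarith
    rw [hsum, hs2]
    constructor
    · intro h
      refine ⟨hc.trans h, ?_⟩
      nlinarith
    · rintro ⟨h4, h5⟩
      exact abs_le_of_sq_le_sq (by linarith) h4 |> le_of_abs_le
  · simp only [Geometry.sign] at *
    have hη0 : 0 ≤ η := by
      have := form_le_neg_one hxs hf.p_mem
      linarith
    have hsum : ∑ i, form .hyperbolic x (d i) ^ 2 = η ^ 2 - 1 := by linarith
    have hs2 : Geometry.hyperbolic.sinX r ^ 2 = Geometry.hyperbolic.cosX r ^ 2 - 1 := by linarith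
    rw [hsum, hs2]
    constructor
    · intro h
      refine ⟨hη0, ?_⟩
      nlinarith
    · rintro ⟨h4, h5⟩
      have := le_of_abs_le (abs_le_of_sq_le_sq (a := η) (by linarith) hc)
      linarith

/-- The volume of a right cone over a ball. -/
theorem vol_rightBallCone (hf : IsConeFrame X o p b d h) {r : ℝ} (hs : 0 < X.sinX r)
    (hc : 0 ≤ X.cosX r)
    (hd : ∀ x ∈ space X (m + 1), gdist X p x ≤ r ↔ X.sign * X.cosX r ≤ form X p x) :
    vol X (rightBallCone X o p r) = ENNReal.ofReal (√π ^ m / Real.Gamma (m / 2 + 1) *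
      ∫ t in (0 : ℝ)..h, 1 / ((X.cosX r / X.sinX r * X.sinX h) ^ 2 * (1 / X.sinX t) ^ 2 +
        X.sign) ^ ((m : ℝ) / 2)) := by
  have hS := hf.sinX_pos
  have hcs := cosX_sq_add X r
  have hQm : MeasurableSet (ballBase X m r h) :=
    (measurableSet_le measurable_const measurable_fst).inter (measurableSet_le
      (f := fun q : ℝ × (Fin m → ℝ) => (X.cosX r * X.sinX h) ^ 2 * ∑ i, q.2 i ^ 2)
      (g := fun q => (X.sinX r * q.1) ^ 2) (by fun_prop) (by fun_prop))
  rw [rightBallCone, hf.vol_coneOver hQm (hf.mem_ballBase_iff hc hd)]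
  rotate_left
  · rintro s hs' q ⟨h1, h2⟩
    refine ⟨mul_nonneg hs' h1, ?_⟩
    simp only [Prod.smul_fst, Prod.smul_snd, Pi.smul_apply, smul_eq_mul, mul_pow] at h2 ⊢
    rw [← Finset.mul_sum]
    nlinarith [sq_nonneg s, mul_le_mul_of_nonneg_left h2 (sq_nonneg s)]
  · exact fun q hq => hq.1
  · rintro q ⟨h1, h2⟩ hq
    have hsum : 0 ≤ ∑ i, q.2 i ^ 2 := Finset.sum_nonneg fun i _ => sq_nonneg _
    have hne : q.1 ^ 2 + ∑ i, q.2 i ^ 2 ≠ 0 := by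
      intro h0
      have h3 : q.1 ^ 2 = 0 := by nlinarith [sq_nonneg q.1]
      have h4 : ∑ i, q.2 i ^ 2 = 0 := by nlinarith [sq_nonneg q.1]
      rw [Finset.sum_eq_zero_iff_of_nonneg fun i _ => sq_nonneg _] at h4
      refine hq (Prod.ext (by simpa using h3) (funext fun i => by
        simpa using h4 i (Finset.mem_univ i)))
    have hpos : 0 < q.1 ^ 2 + ∑ i, q.2 i ^ 2 := lt_of_le_of_ne (by positivity) hne.symm
    cases X
    · simp only [Geometry.sign, one_mul]
      rcases hsum.eq_or_lt with h0 | h0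
      · have : 0 < q.1 ^ 2 := by linarith
        rw [← h0, div_pow]
        positivity
      · positivity
    · simp only [Geometry.sign] at hcs ⊢
      have h5 : (Geometry.hyperbolic.cosX r) ^ 2 * ∑ i, q.2 i ^ 2 ≤
          Geometry.hyperbolic.sinX r ^ 2 * (q.1 / Geometry.hyperbolic.sinX h) ^ 2 := by
        rw [div_pow, ← mul_div_assoc, le_div_iff₀ (by positivity)]
        linarith
      have h6 : 0 < (q.1 / Geometry.hyperbolic.sinX h) ^ 2 := by
        have h7 : q.1 ≠ 0 := by
          intro h0
          rw [h0] at h5 hpos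
          norm_num at h5 hpos
          nlinarith
        positivity
      nlinarith
  · rw [hf.mem_ballBase_iff hc hd]
    refine ⟨hf.p_mem_perpHyperplane, ?_, ?_⟩
    · simp only [hf.form_p_b]; exact hS.le
    · simp only [hf.form_p_d]
      simp only [ne_eq, OfNat.ofNat_ne_zero, not_false_eq_true, zero_pow, Finset.sum_const_zero,
        mul_zero]
      positivity
  set V := √π ^ m / Real.Gamma (m / 2 + 1) with hV
  have hV0 : 0 ≤ V := div_nonneg (by positivity) (Real.Gamma_pos_of_pos (by positivity)).le
  set D : ℝ → ℝ := fun t => (X.cosX r / X.sinX r * X.sinX h) ^ 2 * (1 / X.sinX t) ^ 2 + X.sign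
    with hD
  -- A positive lower bound makes the integrand bounded. In hyperbolic space `sinh t ≤ sinh h` gives
  -- `D t ≥ coth² r - 1 = 1 / sinh² r`.
  obtain ⟨β, hβ, hDβ⟩ : ∃ β > 0, ∀ t ∈ Set.Ioc 0 h, β ≤ D t := by
    cases X
    · refine ⟨1, one_pos, fun t _ => ?_⟩
      simp only [hD, Geometry.sign]
      have := mul_nonneg (sq_nonneg (Geometry.spherical.cosX r / Geometry.spherical.sinX r *
        Geometry.spherical.sinX h)) (sq_nonneg (1 / Geometry.spherical.sinX t))
      linarith
    · refine ⟨(1 / Geometry.hyperbolic.sinX r) ^ 2, by positivity, fun t ht => ?_⟩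
      have ht0 := hf.sinX_pos_of_mem ht
      have hle : Geometry.hyperbolic.sinX t ≤ Geometry.hyperbolic.sinX h := by
        simp only [Geometry.sinX]
        exact Real.sinh_le_sinh.2 ht.2
      have h1 : 1 ≤ (Geometry.hyperbolic.sinX h / Geometry.hyperbolic.sinX t) ^ 2 :=
        one_le_pow₀ ((one_le_div ht0).2 hle)
      have h2 : D t = (Geometry.hyperbolic.cosX r / Geometry.hyperbolic.sinX r) ^ 2 *
          (Geometry.hyperbolic.sinX h / Geometry.hyperbolic.sinX t) ^ 2 - 1 := by
        simp only [hD, Geometry.sign]; ring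
      have h3 : (1 / Geometry.hyperbolic.sinX r) ^ 2 =
          (Geometry.hyperbolic.cosX r / Geometry.hyperbolic.sinX r) ^ 2 - 1 := by
        simp only [Geometry.sign] at hcs
        field_simp
        linarith
      rw [h2, h3]
      nlinarith [sq_nonneg (Geometry.hyperbolic.cosX r / Geometry.hyperbolic.sinX r)]
  have hslice : ∀ t ∈ Set.Ioc 0 h, volume {v : Fin m → ℝ | 0 < 1 - X.sign * ∑ i, v i ^ 2 ∧
      (√(1 - X.sign * ∑ i, v i ^ 2) * X.sinX t, v) ∈ ballBase X m r h} =
      ENNReal.ofReal (V * (1 / D t ^ ((m : ℝ) / 2))) := by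
    intro t ht
    have ht0 := hf.sinX_pos_of_mem ht
    have hDt : 0 < D t := hβ.trans_le (hDβ t ht)
    set ρ := (√(D t))⁻¹ with hρ
    have hρ0 : 0 < ρ := inv_pos.2 (Real.sqrt_pos.2 hDt)
    have hρ2 : ρ ^ 2 = 1 / D t := by
      rw [hρ, inv_pow, Real.sq_sqrt hDt.le, one_div]
    have hρm : 1 / D t ^ ((m : ℝ) / 2) = ρ ^ m := by
      rw [hρ, inv_pow, Real.sqrt_eq_rpow, ← Real.rpow_natCast, ← Real.rpow_mul hDt.le, one_div]
      congr 2
      ring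
    -- The slice condition is `|v|² D(t) ≤ 1`, a ball of radius `D(t)^(-1/2)`.
    have hiff : ∀ v : Fin m → ℝ, 0 < 1 - X.sign * ∑ i, v i ^ 2 →
        ((√(1 - X.sign * ∑ i, v i ^ 2) * X.sinX t, v) ∈ ballBase X m r h ↔
          ∑ i, v i ^ 2 ≤ ρ ^ 2) := by
      intro v hv
      have h0 : 0 ≤ √(1 - X.sign * ∑ i, v i ^ 2) * X.sinX t :=
        mul_nonneg (Real.sqrt_nonneg _) ht0.le
      simp only [ballBase, Set.mem_ofPred_eq, h0, true_and]
      rw [mul_pow (X.sinX r), mul_pow (√(1 - X.sign * ∑ i, v i ^ 2)), Real.sq_sqrt hv.le, hρ2,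
        le_div_iff₀ hDt]
      have h1 : (∑ i, v i ^ 2) * D t * (X.sinX r ^ 2 * X.sinX t ^ 2) =
          (X.cosX r * X.sinX h) ^ 2 * ∑ i, v i ^ 2 +
            X.sign * (∑ i, v i ^ 2) * (X.sinX r ^ 2 * X.sinX t ^ 2) := by
        simp only [hD]
        field_simp
      have h2 : 0 < X.sinX r ^ 2 * X.sinX t ^ 2 := by positivity
      have h3 : (∑ i, v i ^ 2) * D t ≤ 1 ↔ _ := (mul_le_mul_iff_left₀ h2).symm
      rw [h3, h1]
      constructor <;> intro h <;> linarith
    rw [hρm]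
    apply le_antisymm
    · rw [← volume_sum_sq_le m hρ0]
      exact measure_mono fun v hv => (hiff v hv.1).1 hv.2
    · rw [← volume_sum_sq_lt m hρ0]
      refine measure_mono fun v hv => ?_
      have hv' : ∑ i, v i ^ 2 < ρ ^ 2 := hv
      have hsum : 0 ≤ ∑ i, v i ^ 2 := Finset.sum_nonneg fun i _ => sq_nonneg _
      have hpos : 0 < 1 - X.sign * ∑ i, v i ^ 2 := by
        cases X
        · have h1 : 1 ≤ D t := by
            simp only [hD, Geometry.sign]
            have := mul_nonneg (sq_nonneg (Geometry.spherical.cosX r / Geometry.spherical.sinX r *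
              Geometry.spherical.sinX h)) (sq_nonneg (1 / Geometry.spherical.sinX t))
            linarith
          have h2 : ρ ^ 2 ≤ 1 := by rw [hρ2]; exact (div_le_one hDt).2 h1
          simp only [Geometry.sign]
          linarith
        · simp only [Geometry.sign]
          linarith
      exact ⟨hpos, (hiff v hpos).2 hv'.le⟩
  rw [setLIntegral_congr_fun measurableSet_Ioc hslice, lintegral_Ioc_ofReal
    (M := V * (1 / β ^ ((m : ℝ) / 2))) ?_ hf.h_pos.le ?_, intervalIntegral.integral_const_mul]
  · have := (continuous_sinX X).measurable
    fun_prop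
  · intro t ht
    have h1 := hDβ t ht
    have hDt := hβ.trans_le h1
    refine ⟨by positivity, ?_⟩
    gcongr

end IsConeFrame

end BallCone

/-! ### Explicit formulas for cones over balls -/

section BallConeFormulas

theorem vol_rightBallCone_spherical (n : ℕ) (o p : Fin (n + 1) → ℝ) (r h a : ℝ) (hn : 1 ≤ n)
    (ho : o ∈ space .spherical n) (hp : p ∈ space .spherical n)
    (hd : gdist .spherical o p = h) (h0 : 0 < h) (hπ : h < π) (hr : 0 < r) (hr' : r ≤ π / 2)
    (ha : a = Real.cot r * Real.sin h) :
    vol .spherical (rightBallCone .spherical o p r) =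
      ENNReal.ofReal (π ^ (((n : ℝ) - 1) / 2) / Real.Gamma (((n : ℝ) + 1) / 2) *
        ∫ t in (0 : ℝ)..h,
          1 / (a ^ 2 * (1 / Real.sin t) ^ 2 + 1) ^ (((n : ℝ) - 1) / 2)) := by
  obtain ⟨m, rfl⟩ : ∃ m, n = m + 1 := ⟨n - 1, by omega⟩
  obtain ⟨b, d, hf⟩ := exists_isConeFrame ho hp hd h0 fun _ => hπ
  rw [hf.vol_rightBallCone (r := r) (Real.sin_pos_of_pos_of_lt_pi hr (by linarith))
    (Real.cos_nonneg_of_neg_pi_div_two_le_of_le (by linarith) hr')]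
  · have e1 : (((m + 1 : ℕ) : ℝ) - 1) / 2 = (m : ℝ) / 2 := by push_cast; ring
    have e2 : (((m + 1 : ℕ) : ℝ) + 1) / 2 = (m : ℝ) / 2 + 1 := by push_cast; ring
    have e3 : √π ^ m = π ^ ((m : ℝ) / 2) := by
      rw [Real.sqrt_eq_rpow, ← Real.rpow_natCast, ← Real.rpow_mul Real.pi_pos.le]
      congr 1
      ring
    rw [e1, e2, e3, ha, Real.cot_eq_cos_div_sin]
    rfl
  · intro x _
    rw [gdist_spherical_le_iff hr.le (by linarith)]
    simp [Geometry.cosX, Geometry.sign]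

theorem vol_rightBallCone_hyperbolic (n : ℕ) (o p : Fin (n + 1) → ℝ) (r h a : ℝ) (hn : 1 ≤ n)
    (ho : o ∈ space .hyperbolic n) (hp : p ∈ space .hyperbolic n)
    (hd : gdist .hyperbolic o p = h) (h0 : 0 < h) (hr : 0 < r)
    (ha : a = Real.cosh r / Real.sinh r * Real.sinh h) :
    vol .hyperbolic (rightBallCone .hyperbolic o p r) =
      ENNReal.ofReal (π ^ (((n : ℝ) - 1) / 2) / Real.Gamma (((n : ℝ) + 1) / 2) *
        ∫ t in (0 : ℝ)..h,
          1 / (a ^ 2 * (1 / Real.sinh t) ^ 2 - 1) ^ (((n : ℝ) - 1) / 2)) := by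
  obtain ⟨m, rfl⟩ : ∃ m, n = m + 1 := ⟨n - 1, by omega⟩
  obtain ⟨b, d, hf⟩ := exists_isConeFrame ho hp hd h0 nofun
  rw [hf.vol_rightBallCone (r := r) (Real.sinh_pos_iff.2 hr) (Real.cosh_pos r).le]
  · have e1 : (((m + 1 : ℕ) : ℝ) - 1) / 2 = (m : ℝ) / 2 := by push_cast; ring
    have e2 : (((m + 1 : ℕ) : ℝ) + 1) / 2 = (m : ℝ) / 2 + 1 := by push_cast; ring
    have e3 : √π ^ m = π ^ ((m : ℝ) / 2) := by
      rw [Real.sqrt_eq_rpow, ← Real.rpow_natCast, ← Real.rpow_mul Real.pi_pos.le]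
      congr 1
      ring
    rw [e1, e2, e3, ha]
    rfl
  · intro x hx
    rw [gdist_hyperbolic_le_iff hr.le hp hx]
    simp [Geometry.cosX, Geometry.sign]

lemma hasDerivAt_artanh {x : ℝ} (hx : x ∈ Set.Ioo (-1 : ℝ) 1) :
    HasDerivAt Real.artanh (1 / (1 - x ^ 2)) x := by
  have h1 : 0 < 1 + x := by linarith [hx.1]
  have h2 : 0 < 1 - x := by linarith [hx.2]
  have h : HasDerivAt (fun y : ℝ => 1 / 2 * Real.log ((1 + y) / (1 - y)))
      (1 / 2 * (((1 * (1 - x) - (1 + x) * (-1)) / (1 - x) ^ 2) / ((1 + x) / (1 - x)))) x := by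
    refine HasDerivAt.const_mul _ (HasDerivAt.log (HasDerivAt.div ?_ ?_ h2.ne') (by positivity))
    · exact (hasDerivAt_id x).const_add 1
    · exact (hasDerivAt_id x).const_sub 1
  have h' : HasDerivAt Real.artanh _ x := h.congr_of_eventuallyEq (by
    filter_upwards [isOpen_Ioo.mem_nhds hx] with y hy
    exact Real.artanh_eq_half_log ⟨hy.1.le, hy.2.le⟩)
  convert! h' using 1
  have : 1 - x ^ 2 = (1 + x) * (1 - x) := by ring
  rw [this]
  field_simp
  ring

lemma hasDerivAt_tanh (t : ℝ) : HasDerivAt Real.tanh (1 / Real.cosh t ^ 2) t := by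
  have h := (Real.hasDerivAt_sinh t).div (Real.hasDerivAt_cosh t) (Real.cosh_pos t).ne'
  have h2 : HasDerivAt Real.tanh _ t := h.congr_of_eventuallyEq
    (Filter.Eventually.of_forall fun y => Real.tanh_eq_sinh_div_cosh y)
  convert! h2 using 1
  congr 1
  linarith [Real.cosh_sq t]

/-- The integrand equals `T² sin² t / (S² + T² sin² t)` and has an elementary primitive, valid as
long as `tan` is smooth on `[0, h]`, whence `h < π / 2`. -/
lemma integral_cone_spherical {T S h : ℝ} (hT : T ≠ 0) (hS : 0 < S) (h0 : 0 < h)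
    (hπ : h < π / 2) :
    ∫ t in (0 : ℝ)..h, 1 / ((S / T) ^ 2 * (1 / Real.sin t) ^ 2 + 1) =
      h - S / √(T ^ 2 + S ^ 2) * Real.arctan (√(T ^ 2 + S ^ 2) / S * Real.tan h) := by
  set q := √(T ^ 2 + S ^ 2) with hq
  have hq0 : 0 < q := Real.sqrt_pos.2 (by positivity)
  have hqq : q ^ 2 = T ^ 2 + S ^ 2 := Real.sq_sqrt (by positivity)
  have hden : ∀ t, 0 < S ^ 2 + T ^ 2 * Real.sin t ^ 2 := fun t => by positivity
  have hderiv : ∀ t ∈ Set.uIcc 0 h, HasDerivAt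
      (fun t => t - S / q * Real.arctan (q / S * Real.tan t))
      (T ^ 2 * Real.sin t ^ 2 / (S ^ 2 + T ^ 2 * Real.sin t ^ 2)) t := by
    intro t ht
    rw [Set.uIcc_of_le h0.le] at ht
    have hc : 0 < Real.cos t := Real.cos_pos_of_mem_Ioo ⟨by linarith [ht.1], by linarith [ht.2]⟩
    have h1 := (((Real.hasDerivAt_tan hc.ne').const_mul (q / S)).arctan).const_mul (S / q)
    convert! (hasDerivAt_id t).sub h1 using 1
    rw [Real.tan_eq_sin_div_cos, mul_pow, div_pow, hqq, div_pow]
    have hden2 : S ^ 2 * Real.cos t ^ 2 + (T ^ 2 + S ^ 2) * Real.sin t ^ 2 =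
        S ^ 2 + T ^ 2 * Real.sin t ^ 2 := by
      linear_combination S ^ 2 * Real.sin_sq_add_cos_sq t
    have h3 : 1 + (T ^ 2 + S ^ 2) / S ^ 2 * (Real.sin t ^ 2 / Real.cos t ^ 2) =
        (S ^ 2 + T ^ 2 * Real.sin t ^ 2) / (S ^ 2 * Real.cos t ^ 2) := by
      rw [← hden2]
      field_simp
    rw [h3]
    have := (hden t).ne'
    field_simp
    ring
  have hcont : Continuous fun t => T ^ 2 * Real.sin t ^ 2 / (S ^ 2 + T ^ 2 * Real.sin t ^ 2) :=
    Continuous.div (by fun_prop) (by fun_prop) fun t => (hden t).ne'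
  -- The two integrands are compared on the open interval only: at `t = 0`, division by zero gives
  -- the first one the value `1` instead of `0`.
  rw [intervalIntegral.integral_congr_Ioo_of_le (g := fun t => T ^ 2 * Real.sin t ^ 2 /
    (S ^ 2 + T ^ 2 * Real.sin t ^ 2)) h0.le, intervalIntegral.integral_eq_sub_of_hasDerivAt hderiv
    (hcont.intervalIntegrable _ _)]
  · simp
  · intro t ht
    have hs : 0 < Real.sin t := Real.sin_pos_of_pos_of_lt_pi ht.1 (by linarith [ht.2])
    have := (hden t).ne'
    dsimp only
    field_simp

/-- The condition `T < 1` keeps `S² - T² sinh² t` positive up to `t = h`, hence the argument of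
`artanh` inside `(-1, 1)`. -/
lemma integral_cone_hyperbolic {T h : ℝ} (hT : 0 < T) (hT1 : T < 1) (h0 : 0 < h) :
    ∫ t in (0 : ℝ)..h, 1 / ((Real.sinh h / T) ^ 2 * (1 / Real.sinh t) ^ 2 - 1) =
      -h + Real.sinh h / √(T ^ 2 + Real.sinh h ^ 2) *
        Real.artanh (√(T ^ 2 + Real.sinh h ^ 2) / Real.sinh h * Real.tanh h) := by
  set S := Real.sinh h with hS'
  have hS : 0 < S := Real.sinh_pos_iff.2 h0
  set q := √(T ^ 2 + S ^ 2) with hq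
  have hq0 : 0 < q := Real.sqrt_pos.2 (by positivity)
  have hqq : q ^ 2 = T ^ 2 + S ^ 2 := Real.sq_sqrt (by positivity)
  have hden : ∀ t ∈ Set.Icc 0 h, 0 < S ^ 2 - T ^ 2 * Real.sinh t ^ 2 := fun t ht => by
    have h1 : Real.sinh t ≤ S := Real.sinh_le_sinh.2 ht.2
    have h2 : 0 ≤ Real.sinh t := Real.sinh_nonneg_iff.2 ht.1
    have h3 : Real.sinh t ^ 2 ≤ S ^ 2 := pow_le_pow_left₀ h2 h1 2
    have h4 : T ^ 2 < 1 := by nlinarith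
    nlinarith [sq_nonneg (Real.sinh t), pow_pos hS 2]
  have hderiv : ∀ t ∈ Set.uIcc 0 h, HasDerivAt
      (fun t => -t + S / q * Real.artanh (q / S * Real.tanh t))
      (T ^ 2 * Real.sinh t ^ 2 / (S ^ 2 - T ^ 2 * Real.sinh t ^ 2)) t := by
    intro t ht
    rw [Set.uIcc_of_le h0.le] at ht
    have hc : 0 < Real.cosh t := Real.cosh_pos t
    have hden2 : S ^ 2 * Real.cosh t ^ 2 - (T ^ 2 + S ^ 2) * Real.sinh t ^ 2 =
        S ^ 2 - T ^ 2 * Real.sinh t ^ 2 := by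
      linear_combination S ^ 2 * Real.cosh_sq t
    have h3 : 1 - (q / S * Real.tanh t) ^ 2 =
        (S ^ 2 - T ^ 2 * Real.sinh t ^ 2) / (S ^ 2 * Real.cosh t ^ 2) := by
      rw [← hden2, Real.tanh_eq_sinh_div_cosh, mul_pow, div_pow, hqq, div_pow]
      field_simp
    have h4 : q / S * Real.tanh t ∈ Set.Ioo (-1 : ℝ) 1 := by
      have h5 : (q / S * Real.tanh t) ^ 2 < 1 := by
        have := div_pos (hden t ht) (by positivity : 0 < S ^ 2 * Real.cosh t ^ 2)
        linarith
      rw [sq_lt_one_iff_abs_lt_one, abs_lt] at h5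
      exact h5
    have h1 := ((hasDerivAt_artanh h4).comp t
      ((hasDerivAt_tanh t).const_mul (q / S))).const_mul (S / q)
    convert! (hasDerivAt_id t).neg.add h1 using 1
    rw [h3]
    have := (hden t ht).ne'
    field_simp
    ring
  have hcont : ContinuousOn (fun t => T ^ 2 * Real.sinh t ^ 2 / (S ^ 2 - T ^ 2 * Real.sinh t ^ 2))
      (Set.uIcc 0 h) := by
    refine ContinuousOn.div (by fun_prop) (by fun_prop) fun t ht => ?_
    rw [Set.uIcc_of_le h0.le] at ht
    exact (hden t ht).ne'
  rw [intervalIntegral.integral_congr_Ioo_of_le (g := fun t => T ^ 2 * Real.sinh t ^ 2 /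
    (S ^ 2 - T ^ 2 * Real.sinh t ^ 2)) h0.le, intervalIntegral.integral_eq_sub_of_hasDerivAt hderiv
    hcont.intervalIntegrable]
  · simp
  · intro t ht
    have hs : 0 < Real.sinh t := Real.sinh_pos_iff.2 ht.1
    have := (hden t ⟨ht.1.le, ht.2.le⟩).ne'
    have h1 : (S / T) ^ 2 * (1 / Real.sinh t) ^ 2 - 1 =
        (S ^ 2 - T ^ 2 * Real.sinh t ^ 2) / (T ^ 2 * Real.sinh t ^ 2) := by
      field_simp
    dsimp only
    rw [h1, one_div_div]

theorem vol_rightCone_spherical (o p : Fin (3 + 1) → ℝ) (r h : ℝ) (ho : o ∈ space .spherical 3)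
    (hp : p ∈ space .spherical 3) (hd : gdist .spherical o p = h) (h0 : 0 < h) (hπ : h < π / 2)
    (hr : 0 < r) (hr' : r < π / 2) :
    vol .spherical (rightBallCone .spherical o p r) =
      ENNReal.ofReal (π * (h - Real.sin h / √(Real.tan r ^ 2 + Real.sin h ^ 2) *
        Real.arctan (√(Real.tan r ^ 2 + Real.sin h ^ 2) / Real.cos h))) := by
  have hS : 0 < Real.sin h := Real.sin_pos_of_pos_of_lt_pi h0 (by linarith)
  have hT : 0 < Real.tan r := Real.tan_pos_of_pos_of_lt_pi_div_two hr hr'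
  rw [vol_rightBallCone_spherical 3 o p r h _ (by norm_num) ho hp hd h0 (by linarith) hr hr'.le rfl]
  have e1 : (((3 : ℕ) : ℝ) - 1) / 2 = 1 := by norm_num
  have e2 : (((3 : ℕ) : ℝ) + 1) / 2 = 2 := by norm_num
  have e3 : Real.cot r * Real.sin h = Real.sin h / Real.tan r := by
    rw [← Real.tan_inv_eq_cot]; ring
  simp only [e1, e2, e3, Real.rpow_one, Real.Gamma_two, div_one]
  rw [integral_cone_spherical hT.ne' hS h0 hπ, Real.tan_eq_sin_div_cos h]
  congr 5
  field_simp

theorem vol_rightCone_hyperbolic (o p : Fin (3 + 1) → ℝ) (r h : ℝ)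
    (ho : o ∈ space .hyperbolic 3) (hp : p ∈ space .hyperbolic 3)
    (hd : gdist .hyperbolic o p = h) (h0 : 0 < h) (hr : 0 < r) :
    vol .hyperbolic (rightBallCone .hyperbolic o p r) =
      ENNReal.ofReal (π * (-h + Real.sinh h / √(Real.tanh r ^ 2 + Real.sinh h ^ 2) *
        Real.artanh (√(Real.tanh r ^ 2 + Real.sinh h ^ 2) / Real.cosh h))) := by
  have hS : 0 < Real.sinh h := Real.sinh_pos_iff.2 h0
  have hT : 0 < Real.tanh r := by
    rw [Real.tanh_eq_sinh_div_cosh]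
    exact div_pos (Real.sinh_pos_iff.2 hr) (Real.cosh_pos r)
  rw [vol_rightBallCone_hyperbolic 3 o p r h _ (by norm_num) ho hp hd h0 hr rfl]
  have e1 : (((3 : ℕ) : ℝ) - 1) / 2 = 1 := by norm_num
  have e2 : (((3 : ℕ) : ℝ) + 1) / 2 = 2 := by norm_num
  have e3 : Real.cosh r / Real.sinh r * Real.sinh h = Real.sinh h / Real.tanh r := by
    rw [Real.tanh_eq_sinh_div_cosh]
    field_simp
  simp only [e1, e2, e3, Real.rpow_one, Real.Gamma_two, div_one]
  rw [integral_cone_hyperbolic hT (Real.tanh_lt_one r) h0, Real.tanh_eq_sinh_div_cosh h]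
  congr 5
  field_simp

end BallConeFormulas

/-! ### Regular polygons in the plane -/

section Planar

variable {n : ℕ}

/-- Among its translates by multiples of `2π/n`, `x` is nearest to `0` modulo `2π`. After reducing
`i` modulo `n`, the difference of cosines is a product of sines of angles in `[0, π]`. -/
lemma cos_add_two_pi_mul_div_le (hn : 0 < n) {x : ℝ} (hx : |x| ≤ π / n) (i : ℤ) :
    Real.cos (x + 2 * π * i / n) ≤ Real.cos x := by
  have hn' : (0 : ℝ) < n := Nat.cast_pos.2 hn
  have hni : (n : ℤ) ≠ 0 := by exact_mod_cast hn.ne'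
  obtain ⟨hx1, hx2⟩ := abs_le.1 hx
  set j := i % n with hj
  have hj0 : 0 ≤ j := Int.emod_nonneg i hni
  have hjn : j < n := Int.emod_lt_of_pos i (by exact_mod_cast hn)
  have hij : (i : ℝ) = j + n * (i / (n : ℤ) : ℤ) := by
    rw [hj]
    exact_mod_cast (Int.emod_add_mul_ediv i n).symm
  have h1 : x + 2 * π * i / n = x + 2 * π * j / n + (i / (n : ℤ) : ℤ) * (2 * π) := by
    rw [hij]
    field_simp
    ring
  rw [h1, Real.cos_add_int_mul_two_pi]
  rcases hj0.eq_or_lt with h0 | h0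
  · rw [← h0]; simp
  · have hj1 : (1 : ℝ) ≤ j := by exact_mod_cast h0
    have hj2 : (j : ℝ) + 1 ≤ n := by exact_mod_cast hjn
    have h2 : Real.cos x - Real.cos (x + 2 * π * j / n) =
        2 * Real.sin (x + π * j / n) * Real.sin (π * j / n) := by
      rw [Real.cos_sub_cos, show (x + (x + 2 * π * j / n)) / 2 = x + π * j / n by ring,
        show (x - (x + 2 * π * j / n)) / 2 = -(π * j / n) by ring, Real.sin_neg]
      ring
    have h3 : π / n ≤ π * j / n := by
      rw [div_le_div_iff_of_pos_right hn']
      nlinarith [Real.pi_pos]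
    have h4 : π * j / n + π / n ≤ π := by
      rw [← add_div, div_le_iff₀ hn']
      nlinarith [Real.pi_pos]
    have h5 : 0 ≤ Real.sin (x + π * j / n) :=
      Real.sin_nonneg_of_nonneg_of_le_pi (by linarith) (by linarith)
    have h6 : 0 ≤ Real.sin (π * j / n) := by
      have : 0 < π / n := div_pos Real.pi_pos hn'
      exact Real.sin_nonneg_of_nonneg_of_le_pi (by linarith) (by linarith)
    have := mul_nonneg h5 h6
    linarith

/-- The angle `φ` reduced to the sector `[0, 2π/n)`. -/
noncomputable def sectorAngle (n : ℕ) (φ : ℝ) : ℝ := 2 * π / n * Int.fract (φ / (2 * π / n))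

lemma sectorAngle_mem (hn : 0 < n) (φ : ℝ) : sectorAngle n φ ∈ Set.Ico 0 (2 * π / n) := by
  have hn' : (0 : ℝ) < n := Nat.cast_pos.2 hn
  have : 0 < 2 * π / n := by positivity
  refine ⟨mul_nonneg this.le (Int.fract_nonneg _), ?_⟩
  exact mul_lt_of_lt_one_right this (Int.fract_lt_one _)

lemma abs_sectorAngle_sub_le (hn : 0 < n) (φ : ℝ) : |sectorAngle n φ - π / n| ≤ π / n := by
  obtain ⟨h1, h2⟩ := sectorAngle_mem hn φ
  have : 2 * π / n = π / n + π / n := by ring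
  rw [abs_le]
  constructor <;> linarith

lemma exists_sector (hn : 0 < n) (φ : ℝ) : ∃ (k : Fin n) (l : ℤ),
    φ = sectorAngle n φ + 2 * π * k / n + l * (2 * π) := by
  have hn' : (0 : ℝ) < n := Nat.cast_pos.2 hn
  have hni : (n : ℤ) ≠ 0 := by exact_mod_cast hn.ne'
  set i := ⌊φ / (2 * π / n)⌋ with hi
  have hj0 : 0 ≤ i % n := Int.emod_nonneg i hni
  have hjn : i % n < n := Int.emod_lt_of_pos i (by exact_mod_cast hn)
  refine ⟨⟨(i % n).toNat, by omega⟩, i / n, ?_⟩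
  have h1 : (((i % n).toNat : ℕ) : ℝ) = ((i % n : ℤ) : ℝ) := by
    exact_mod_cast Int.toNat_of_nonneg hj0
  have hij : (i : ℝ) = (i % n : ℤ) + n * (i / (n : ℤ) : ℤ) := by
    exact_mod_cast (Int.emod_add_mul_ediv i n).symm
  simp only [h1]
  have h2 : φ = sectorAngle n φ + 2 * π / n * i := by
    rw [sectorAngle, ← mul_add, Int.fract, ← hi, sub_add_cancel]
    field_simp
  calc φ = sectorAngle n φ + 2 * π / n * i := h2
    _ = _ := by
      rw [hij]
      field_simp
      ring

lemma periodic_sectorAngle (hn : 0 < n) : Function.Periodic (sectorAngle n) (2 * π / n) := by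
  intro φ
  have hn' : (0 : ℝ) < n := Nat.cast_pos.2 hn
  have : 2 * π / n ≠ 0 := by positivity
  rw [sectorAngle, sectorAngle, add_div, div_self this, Int.fract_add_one]

lemma sectorAngle_of_mem (hn : 0 < n) {φ : ℝ} (h : φ ∈ Set.Ico 0 (2 * π / n)) :
    sectorAngle n φ = φ := by
  have hn' : (0 : ℝ) < n := Nat.cast_pos.2 hn
  have h0 : 0 < 2 * π / n := by positivity
  rw [sectorAngle, Int.fract_eq_self.2 ⟨div_nonneg h.1 h0.le, (div_lt_one h0).2 h.2⟩]
  field_simp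

lemma measurable_sectorAngle : Measurable (sectorAngle n) := by
  unfold sectorAngle
  fun_prop

/-- The angles `(2k+1)π/n` are the normals to the sides; the one in the sector of `φ` makes the
smallest angle with `φ`. -/
lemma cos_le_cos_sectorAngle (hn : 0 < n) (φ : ℝ) (k : ℕ) :
    Real.cos (φ - (2 * k + 1) * π / n) ≤ Real.cos (sectorAngle n φ - π / n) := by
  have hn' : (0 : ℝ) < n := Nat.cast_pos.2 hn
  obtain ⟨j, l, hj⟩ := exists_sector hn φ
  have h1 : φ - (2 * k + 1) * π / n = sectorAngle n φ - π / n +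
      2 * π * ((j : ℤ) - (k : ℤ) + n * l : ℤ) / n := by
    push_cast
    conv_lhs => rw [hj]
    field_simp
    ring
  rw [h1]
  exact cos_add_two_pi_mul_div_le hn (abs_sectorAngle_sub_le hn φ) _

lemma exists_cos_eq_cos_sectorAngle (hn : 0 < n) (φ : ℝ) : ∃ k : Fin n,
    Real.cos (φ - (2 * k + 1) * π / n) = Real.cos (sectorAngle n φ - π / n) := by
  obtain ⟨k, l, hk⟩ := exists_sector hn φ
  refine ⟨k, ?_⟩
  have h1 : φ - (2 * k + 1) * π / n = sectorAngle n φ - π / n + l * (2 * π) := by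
    conv_lhs => rw [hk]
    ring
  rw [h1, Real.cos_add_int_mul_two_pi]

lemma pi_div_le (hn : 3 ≤ n) : π / n ≤ π / 3 := by
  have : (3 : ℝ) ≤ n := by exact_mod_cast hn
  gcongr

lemma pi_div_pos (hn : 3 ≤ n) : 0 < π / n := by
  have : (3 : ℝ) ≤ n := by exact_mod_cast hn
  positivity

lemma cos_pi_div_pos (hn : 3 ≤ n) : 0 < Real.cos (π / n) := by
  have h1 := pi_div_le hn
  have h2 := pi_div_pos hn
  exact Real.cos_pos_of_mem_Ioo ⟨by linarith, by linarith [Real.pi_pos]⟩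

lemma sin_pi_div_pos (hn : 3 ≤ n) : 0 < Real.sin (π / n) := by
  have h1 := pi_div_le hn
  exact Real.sin_pos_of_pos_of_lt_pi (pi_div_pos hn) (by linarith [Real.pi_pos])

lemma cos_pi_div_le_cos_sectorAngle (hn : 3 ≤ n) (φ : ℝ) :
    Real.cos (π / n) ≤ Real.cos (sectorAngle n φ - π / n) := by
  rw [← Real.cos_abs (sectorAngle n φ - π / n)]
  have h1 := pi_div_le hn
  exact Real.cos_le_cos_of_nonneg_of_le_pi (abs_nonneg _) (by linarith [Real.pi_pos])
    (abs_sectorAngle_sub_le (by omega) φ)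

lemma sum_exp_vertices (hn : 2 ≤ n) :
    ∑ k : Fin n, Complex.exp (((2 * π * k / n : ℝ) : ℂ) * Complex.I) = 0 := by
  have h := (Complex.isPrimitiveRoot_exp n (by omega)).geom_sum_eq_zero (by omega)
  rw [← Fin.sum_univ_eq_sum_range (fun k => Complex.exp (2 * π * Complex.I / n) ^ k)] at h
  rw [← h]
  refine Finset.sum_congr rfl fun k _ => ?_
  rw [← Complex.exp_nat_mul]
  congr 1
  push_cast
  ring

lemma sum_cos_vertices (hn : 2 ≤ n) : ∑ k : Fin n, Real.cos (2 * π * k / n) = 0 := by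
  have h := congrArg Complex.re (sum_exp_vertices hn)
  rw [Complex.re_sum] at h
  simpa only [Complex.exp_ofReal_mul_I_re, Complex.zero_re] using h

lemma sum_sin_vertices (hn : 2 ≤ n) : ∑ k : Fin n, Real.sin (2 * π * k / n) = 0 := by
  have h := congrArg Complex.im (sum_exp_vertices hn)
  rw [Complex.im_sum] at h
  simpa only [Complex.exp_ofReal_mul_I_im, Complex.zero_im] using h

/-- A regular polygon is the intersection of the half-planes bounded by its sides. -/
lemma exists_weights (hn : 3 ≤ n) {v₀ v₁ μ : ℝ}
    (hv : ∀ k : Fin n, v₀ * Real.cos ((2 * k + 1) * π / n) + v₁ * Real.sin ((2 * k + 1) * π / n) ≤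
      μ * Real.cos (π / n)) :
    ∃ w : Fin n → ℝ, (∀ k, 0 ≤ w k) ∧ ∑ k, w k = μ ∧
      ∑ k, w k * Real.cos (2 * π * k / n) = v₀ ∧ ∑ k, w k * Real.sin (2 * π * k / n) = v₁ := by
  have hn0 : 0 < n := by omega
  have hn' : (0 : ℝ) < n := Nat.cast_pos.2 hn0
  obtain ⟨φ, -, h0, h1⟩ := exists_polar_angle v₀ v₁
  set ρ := √(v₀ ^ 2 + v₁ ^ 2) with hρ
  have hρ0 : 0 ≤ ρ := Real.sqrt_nonneg _
  obtain ⟨k, l, hk⟩ := exists_sector hn0 φ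
  set ψ := sectorAngle n φ with hψ
  obtain ⟨hψ0, hψ1⟩ := sectorAngle_mem hn0 φ
  set x := π / n with hx
  have h2x : 2 * π / n = 2 * x := by rw [hx]; ring
  rw [h2x] at hψ1
  have hx3 := pi_div_le hn
  have hxpos := pi_div_pos hn
  have hc : 0 < Real.cos x := cos_pi_div_pos hn
  have hs : 0 < Real.sin x := sin_pi_div_pos hn
  have hc2 : Real.cos (2 * x) = 1 - 2 * Real.sin x ^ 2 := by
    rw [Real.cos_two_mul]
    linear_combination 2 * Real.sin_sq_add_cos_sq x
  have hs2 : Real.sin (2 * x) = 2 * Real.sin x * Real.cos x := Real.sin_two_mul x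
  have hs2pos : 0 < Real.sin (2 * x) := by rw [hs2]; positivity
  set θ : ℝ := 2 * π * k / n with hθ
  have hcφ : Real.cos φ = Real.cos (ψ + θ) := by rw [hk, Real.cos_add_int_mul_two_pi]
  have hsφ : Real.sin φ = Real.sin (ψ + θ) := by rw [hk, Real.sin_add_int_mul_two_pi]
  -- By the law of sines, `α` and `β` are the coordinates of `(v₀, v₁)` with respect to the two
  -- vertices bounding its sector.
  set α := ρ * Real.sin (2 * x - ψ) / Real.sin (2 * x) with hα
  set β := ρ * Real.sin ψ / Real.sin (2 * x) with hβ
  have hα0 : 0 ≤ α := div_nonneg (mul_nonneg hρ0 (Real.sin_nonneg_of_nonneg_of_le_pi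
    (by linarith) (by linarith [Real.pi_pos]))) hs2pos.le
  have hβ0 : 0 ≤ β := div_nonneg (mul_nonneg hρ0 (Real.sin_nonneg_of_nonneg_of_le_pi
    (by linarith) (by linarith [Real.pi_pos]))) hs2pos.le
  have hαβ : (α + β) * Real.cos x = ρ * Real.cos (ψ - x) := by
    rw [hα, hβ, hs2, Real.sin_sub, hs2, hc2, Real.cos_sub]
    field_simp
    ring
  -- This is the half-plane condition of the side joining those two vertices.
  have hle : α + β ≤ μ := by
    have h2 := hv k
    have h3 : v₀ * Real.cos ((2 * k + 1) * π / n) + v₁ * Real.sin ((2 * k + 1) * π / n) =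
        ρ * Real.cos (ψ - x) := by
      have h4 : (2 * k + 1) * π / n = θ + x := by rw [hθ, hx]; ring
      rw [h0, h1, hcφ, hsφ, h4, show ψ - x = (ψ + θ) - (θ + x) by ring, Real.cos_sub (ψ + θ)]
      ring
    rw [h3, ← hαβ] at h2
    exact le_of_mul_le_mul_right h2 hc
  obtain ⟨k', hk'c, hk's⟩ : ∃ k' : Fin n, Real.cos (2 * π * k' / n) = Real.cos (θ + 2 * x) ∧
      Real.sin (2 * π * k' / n) = Real.sin (θ + 2 * x) := by
    have h4 : θ + 2 * x = 2 * π * (k + 1 : ℕ) / n := by rw [hθ, hx]; push_cast; ring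
    by_cases hkn : (k : ℕ) + 1 < n
    · exact ⟨⟨k + 1, hkn⟩, by rw [h4], by rw [h4]⟩
    · refine ⟨⟨0, hn0⟩, ?_⟩
      have h5 : (k : ℕ) + 1 = n := by omega
      rw [h4, h5, mul_div_cancel_right₀ _ hn'.ne']
      simp
  have hγ : 0 ≤ (μ - α - β) / n := div_nonneg (by linarith) hn'.le
  have hcomb : ∀ f : Fin n → ℝ, ∑ j, ((μ - α - β) / n + (if j = k then α else 0) +
      if j = k' then β else 0) * f j = (μ - α - β) / n * ∑ j, f j + α * f k + β * f k' := by
    intro f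
    simp [add_mul, Finset.sum_add_distrib, Finset.mul_sum, ite_mul]
  -- The surplus weight is spread evenly over all vertices; their sum is zero, so the point does not
  -- move.
  refine ⟨fun j => (μ - α - β) / n + (if j = k then α else 0) + if j = k' then β else 0,
    ?_, ?_, ?_, ?_⟩
  · intro j
    have h6 : 0 ≤ if j = k then α else 0 := by split_ifs <;> linarith
    have h7 : 0 ≤ if j = k' then β else 0 := by split_ifs <;> linarith
    positivity
  · have := hcomb fun _ => 1
    simp only [mul_one, Finset.sum_const, Finset.card_univ, Fintype.card_fin, nsmul_eq_mul] at this
    rw [this]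
    field_simp
    ring
  · rw [hcomb, sum_cos_vertices (by omega), hk'c, h0, hcφ, ← hθ, hα, hβ, Real.cos_add θ,
      Real.cos_add ψ, Real.sin_sub]
    field_simp
    ring
  · rw [hcomb, sum_sin_vertices (by omega), hk's, h1, hsφ, ← hθ, hα, hβ, Real.sin_add θ,
      Real.sin_add ψ, Real.sin_sub]
    field_simp
    ring

/-- The polygon lies in its circumscribed disc: some side normal makes an angle at most `π/n` with
the vector, and its half-plane already bounds the length. -/
lemma sum_sq_le_of_halfPlanes (hn : 3 ≤ n) {v₀ v₁ μ : ℝ}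
    (hv : ∀ k : Fin n, v₀ * Real.cos ((2 * k + 1) * π / n) + v₁ * Real.sin ((2 * k + 1) * π / n) ≤
      μ * Real.cos (π / n)) : v₀ ^ 2 + v₁ ^ 2 ≤ μ ^ 2 := by
  obtain ⟨φ, -, h0, h1⟩ := exists_polar_angle v₀ v₁
  have hsq : √(v₀ ^ 2 + v₁ ^ 2) ^ 2 = v₀ ^ 2 + v₁ ^ 2 := Real.sq_sqrt (by positivity)
  have hρ0 := Real.sqrt_nonneg (v₀ ^ 2 + v₁ ^ 2)
  set ρ := √(v₀ ^ 2 + v₁ ^ 2) with hρ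
  obtain ⟨k, hk⟩ := exists_cos_eq_cos_sectorAngle (by omega : 0 < n) φ
  have h2 := hv k
  have h3 : v₀ * Real.cos ((2 * k + 1) * π / n) + v₁ * Real.sin ((2 * k + 1) * π / n) =
      ρ * Real.cos (φ - (2 * k + 1) * π / n) := by
    rw [h0, h1, Real.cos_sub]; ring
  rw [h3, hk] at h2
  have h4 : ρ * Real.cos (π / n) ≤ μ * Real.cos (π / n) :=
    (mul_le_mul_of_nonneg_left (cos_pi_div_le_cos_sectorAngle hn φ) hρ0).trans h2
  have h5 := le_of_mul_le_mul_right h4 (cos_pi_div_pos hn)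
  rw [← hsq]
  exact pow_le_pow_left₀ hρ0 h5 2

/-- The area of a set that is star-shaped with respect to the origin, in polar coordinates. -/
lemma volume_eq_lintegral_polar {P : Set (Fin 2 → ℝ)} (hP : MeasurableSet P) {f : ℝ → ℝ}
    (hf : ∀ φ, 0 ≤ f φ)
    (h : ∀ r φ, 0 < r → (![r * Real.cos φ, r * Real.sin φ] ∈ P ↔ r ^ 2 ≤ f φ)) :
    volume P = ∫⁻ φ in Set.Ioo (-π) π, ENNReal.ofReal (f φ / 2) := by
  have hP' : MeasurableSet {q : ℝ × ℝ | ![q.1, q.2] ∈ P} :=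
    (MeasurableEquiv.finTwoArrow (α := ℝ)).symm.measurable hP
  have h1 : volume P = volume {q : ℝ × ℝ | ![q.1, q.2] ∈ P} :=
    ((volume_preserving_finTwoArrow ℝ).symm.measure_preimage_equiv P).symm
  rw [h1, ← lintegral_indicator_one hP', ← lintegral_comp_polarCoord_symm, polarCoord_target,
    Measure.volume_eq_prod, ← Measure.prod_restrict, lintegral_prod_symm']
  · refine setLIntegral_congr_fun measurableSet_Ioo fun φ _ => ?_
    have h2 : ∀ r ∈ Set.Ioi (0 : ℝ), ENNReal.ofReal r •
        Set.indicator {q : ℝ × ℝ | ![q.1, q.2] ∈ P} 1 (polarCoord.symm (r, φ)) =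
        Set.indicator (Set.Iic (√(f φ))) (fun r => ENNReal.ofReal r) r := by
      intro r hr
      have hmem : polarCoord.symm (r, φ) ∈ {q : ℝ × ℝ | ![q.1, q.2] ∈ P} ↔
          r ∈ Set.Iic (√(f φ)) := by
        rw [Set.mem_Iic, Real.le_sqrt' hr, ← h r φ hr]
        simp [polarCoord_symm_apply]
      by_cases h3 : r ∈ Set.Iic (√(f φ))
      · rw [Set.indicator_of_mem h3, Set.indicator_of_mem (hmem.2 h3)]
        simp
      · rw [Set.indicator_of_notMem h3, Set.indicator_of_notMem (mt hmem.1 h3)]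
        simp
    dsimp only
    rw [setLIntegral_congr_fun measurableSet_Ioi h2, lintegral_indicator measurableSet_Iic,
      Measure.restrict_restrict measurableSet_Iic, Set.Iic_inter_Ioi,
      ← ofReal_integral_eq_lintegral_ofReal, ← intervalIntegral.integral_of_le (Real.sqrt_nonneg _)]
    · simp [Real.sq_sqrt (hf φ)]
    · exact continuous_id.integrableOn_Ioc
    · filter_upwards [ae_restrict_mem measurableSet_Ioc] with r hr
      exact hr.1.le
  · refine Measurable.smul (measurable_fst.ennreal_ofReal) ?_
    exact (measurable_one.indicator hP').comp continuous_polarCoord_symm.measurable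

/-- The integrand has period `2π/n`, and the full turn contains `n` periods. -/
lemma integral_sectorAngle (hn : 0 < n) {F : ℝ → ℝ}
    (hF : ContinuousOn F (Set.Icc (-(π / n)) (π / n))) :
    ∫ φ in -π..π, F (sectorAngle n φ - π / n) = n * ∫ x in -(π / n)..(π / n), F x := by
  have hn' : (0 : ℝ) < n := Nat.cast_pos.2 hn
  have hper : Function.Periodic (fun φ => F (sectorAngle n φ - π / n)) (2 * π / n) := fun φ => by
    simp only [periodic_sectorAngle hn φ]
  have hpos : 0 < 2 * π / n := by positivity
  have hcongr : Set.EqOn (fun φ => F (φ - π / n)) (fun φ => F (sectorAngle n φ - π / n))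
      (Set.Ioo 0 (2 * π / n)) := fun φ hφ => by
    simp only [sectorAngle_of_mem hn ⟨hφ.1.le, hφ.2⟩]
  have hint0 : IntervalIntegrable (fun φ => F (φ - π / n)) volume 0 (2 * π / n) := by
    refine ContinuousOn.intervalIntegrable ?_
    rw [Set.uIcc_of_le hpos.le]
    refine hF.comp (by fun_prop) fun φ hφ => ⟨by linarith [hφ.1], ?_⟩
    have := hφ.2
    rw [show 2 * π / n = π / n + π / n by ring] at this
    linarith
  have hint1 : IntervalIntegrable (fun φ => F (sectorAngle n φ - π / n)) volume 0 (2 * π / n) := by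
    refine hint0.congr_uIoo ?_
    rw [Set.uIoo_of_le hpos.le]
    exact hcongr
  have hint := fun a b => hper.intervalIntegrable₀ hpos.ne' hint1 a b
  have h1 := hper.intervalIntegral_add_zsmul_eq (n : ℤ) (-π) hint
  have h2 : -π + (n : ℤ) • (2 * π / n) = π := by
    simp only [zsmul_eq_mul, Int.cast_natCast]
    field_simp
    ring
  rw [h2, hper.intervalIntegral_add_eq (-π) 0, zero_add,
    ← intervalIntegral.integral_congr_Ioo_of_le hpos.le hcongr,
    intervalIntegral.integral_comp_sub_right F] at h1
  rw [h1, zsmul_eq_mul, Int.cast_natCast, zero_sub]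
  congr 3
  ring

end Planar

/-! ### Areas of polygonal slices -/

section PolygonSlice

variable {n : ℕ}

/-- In direction `φ` only the constraint of the side in that sector matters; its left side is
positive, so it may be squared. -/
lemma mem_polygonSlice_iff (hn : 3 ≤ n) {K σ : ℝ} (hK : 0 < K)
    (hKσ : 0 < K ^ 2 * Real.cos (π / n) ^ 2 + σ) {r : ℝ} (hr : 0 < r) (φ : ℝ) :
    (0 < 1 - σ * r ^ 2 ∧ ∀ k : Fin n, K * (r * Real.cos φ * Real.cos ((2 * k + 1) * π / n) +
      r * Real.sin φ * Real.sin ((2 * k + 1) * π / n)) ≤ √(1 - σ * r ^ 2)) ↔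
    r ^ 2 ≤ 1 / (K ^ 2 * Real.cos (sectorAngle n φ - π / n) ^ 2 + σ) := by
  have hc := cos_pi_div_pos hn
  have hg := cos_pi_div_le_cos_sectorAngle hn φ
  have hle := cos_le_cos_sectorAngle (by omega : 0 < n) φ
  obtain ⟨k, hk⟩ := exists_cos_eq_cos_sectorAngle (by omega : 0 < n) φ
  set g := Real.cos (sectorAngle n φ - π / n)
  have hgσ : 0 < K ^ 2 * g ^ 2 + σ := hKσ.trans_le (by gcongr)
  have hg0 : 0 < g := hc.trans_le hg
  have hform : ∀ k : ℕ, K * (r * Real.cos φ * Real.cos ((2 * k + 1) * π / n) +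
      r * Real.sin φ * Real.sin ((2 * k + 1) * π / n)) =
      K * r * Real.cos (φ - (2 * k + 1) * π / n) := fun k => by
    rw [Real.cos_sub]; ring
  simp only [hform]
  rw [le_div_iff₀ hgσ]
  constructor
  · rintro ⟨h0, h1⟩
    have h2 := h1 k
    rw [hk] at h2
    have h3 := pow_le_pow_left₀ (by positivity) h2 2
    rw [Real.sq_sqrt h0.le] at h3
    nlinarith
  · intro h1
    have h2 : (K * r * g) ^ 2 ≤ 1 - σ * r ^ 2 := by nlinarith
    have h3 : 0 < (K * r * g) ^ 2 := by positivity
    refine ⟨h3.trans_le h2, fun j => ?_⟩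
    calc K * r * Real.cos (φ - (2 * j + 1) * π / n) ≤ K * r * g := by
          have := hle j
          gcongr
      _ ≤ √(1 - σ * r ^ 2) := Real.le_sqrt_of_sq_le h2

lemma volume_polygonSlice (hn : 3 ≤ n) {K σ : ℝ} (hK : 0 < K)
    (hKσ : 0 < K ^ 2 * Real.cos (π / n) ^ 2 + σ) :
    volume {v : Fin 2 → ℝ | 0 < 1 - σ * ∑ i, v i ^ 2 ∧
      ∀ k : Fin n, K * (v 0 * Real.cos ((2 * k + 1) * π / n) +
        v 1 * Real.sin ((2 * k + 1) * π / n)) ≤ √(1 - σ * ∑ i, v i ^ 2)} =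
    ENNReal.ofReal (n * ∫ x in -(π / n)..(π / n), 1 / (K ^ 2 * Real.cos x ^ 2 + σ) / 2) := by
  have hc := cos_pi_div_pos hn
  have hpos : ∀ y, Real.cos (π / n) ≤ y → 0 < K ^ 2 * y ^ 2 + σ := fun y hy =>
    hKσ.trans_le (by gcongr)
  have hcos : ∀ x ∈ Set.Icc (-(π / n)) (π / n), 0 < K ^ 2 * Real.cos x ^ 2 + σ := fun x hx => by
    refine hpos _ ?_
    rw [← Real.cos_abs x]
    exact Real.cos_le_cos_of_nonneg_of_le_pi (abs_nonneg _)
      (by linarith [pi_div_le hn, Real.pi_pos]) (abs_le.2 hx)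
  have hm := measurable_sectorAngle (n := n)
  rw [volume_eq_lintegral_polar
    (f := fun φ => 1 / (K ^ 2 * Real.cos (sectorAngle n φ - π / n) ^ 2 + σ))]
  · rw [← integral_sectorAngle (F := fun x => 1 / (K ^ 2 * Real.cos x ^ 2 + σ) / 2) (by omega),
      intervalIntegral.integral_of_le (by linarith [Real.pi_pos]), ← restrict_Ioo_eq_restrict_Ioc,
      ofReal_integral_eq_lintegral_ofReal]
    · refine Measure.integrableOn_of_bounded
        (M := 1 / (K ^ 2 * Real.cos (π / n) ^ 2 + σ) / 2) (by simp) ?_ (ae_of_all _ fun φ => ?_)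
      · exact Measurable.aestronglyMeasurable (by fun_prop)
      · have h1 := cos_pi_div_le_cos_sectorAngle hn φ
        have h2 := hpos _ h1
        rw [Real.norm_of_nonneg (by positivity)]
        gcongr
    · refine ae_of_all _ fun φ => ?_
      have := hpos _ (cos_pi_div_le_cos_sectorAngle hn φ)
      simp only [Pi.zero_apply]
      positivity
    · refine fun x hx => ContinuousAt.continuousWithinAt ?_
      have := (hcos x hx).ne'
      fun_prop (disch := assumption)
  · have h1 : Measurable fun v : Fin 2 → ℝ => 1 - σ * ∑ i, v i ^ 2 := by fun_prop
    simp only [Set.ofPred_and, Set.ofPred_forall]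
    exact (measurableSet_lt measurable_const h1).inter <| MeasurableSet.iInter fun k =>
      measurableSet_le (by fun_prop) h1.sqrt
  · intro φ
    have := hpos _ (cos_pi_div_le_cos_sectorAngle hn φ)
    positivity
  · intro r φ hr
    rw [← mem_polygonSlice_iff hn hK hKσ hr φ]
    have h1 : σ * ∑ i, (![r * Real.cos φ, r * Real.sin φ] : Fin 2 → ℝ) i ^ 2 = σ * r ^ 2 := by
      rw [Fin.sum_univ_two]
      simp only [Matrix.cons_val_zero, Matrix.cons_val_one]
      linear_combination σ * r ^ 2 * Real.sin_sq_add_cos_sq φ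
    rw [Set.mem_ofPred_eq, h1]
    rfl

lemma integral_polygonSlice_spherical (hn : 3 ≤ n) {s : ℝ} (hs : 0 < s) :
    ∫ x in -(π / n)..(π / n), 1 / (s ^ 2 * Real.cos x ^ 2 + Real.sin x ^ 2) / 2 =
      1 / s * Real.arctan (Real.tan (π / n) / s) := by
  have hcos : ∀ x ∈ Set.uIcc (-(π / n)) (π / n), 0 < Real.cos x := fun x hx => by
    rw [Set.uIcc_of_le (by linarith [pi_div_pos hn])] at hx
    exact Real.cos_pos_of_mem_Ioo ⟨by linarith [pi_div_le hn, Real.pi_pos, hx.1],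
      by linarith [pi_div_le hn, Real.pi_pos, hx.2]⟩
  rw [intervalIntegral.integral_eq_sub_of_hasDerivAt
    (f := fun x => 1 / (2 * s) * Real.arctan (Real.tan x / s))]
  · rw [Real.tan_neg, neg_div, Real.arctan_neg]
    field_simp
    ring
  · intro x hx
    have hc := hcos x hx
    convert! (((Real.hasDerivAt_tan hc.ne').div_const s).arctan).const_mul (1 / (2 * s)) using 1
    rw [Real.tan_eq_sin_div_cos]
    have : 0 < s ^ 2 * Real.cos x ^ 2 + Real.sin x ^ 2 := by positivity
    field_simp
  · refine ContinuousOn.intervalIntegrable fun x hx => ContinuousAt.continuousWithinAt ?_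
    have hc := hcos x hx
    have : s ^ 2 * Real.cos x ^ 2 + Real.sin x ^ 2 ≠ 0 := by positivity
    fun_prop (disch := assumption)

lemma artanh_neg_eq {x : ℝ} (hx : x ∈ Set.Ioo (-1 : ℝ) 1) :
    Real.artanh (-x) = -Real.artanh x := by
  rw [Real.artanh_eq_half_log ⟨by linarith [hx.2], by linarith [hx.1]⟩,
    Real.artanh_eq_half_log ⟨hx.1.le, hx.2.le⟩, sub_neg_eq_add, ← sub_eq_add_neg,
    ← inv_div (1 + x), Real.log_inv]
  ring

lemma integral_polygonSlice_hyperbolic (hn : 3 ≤ n) {s : ℝ} (hs : Real.tan (π / n) < s) :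
    ∫ x in -(π / n)..(π / n), 1 / (s ^ 2 * Real.cos x ^ 2 - Real.sin x ^ 2) / 2 =
      1 / s * Real.artanh (Real.tan (π / n) / s) := by
  have hx0 := pi_div_pos hn
  have ht : 0 < Real.tan (π / n) :=
    Real.tan_pos_of_pos_of_lt_pi_div_two hx0 (by linarith [pi_div_le hn, Real.pi_pos])
  have hs0 := ht.trans hs
  have hcos : ∀ x ∈ Set.uIcc (-(π / n)) (π / n), 0 < Real.cos x ∧
      Real.tan x / s ∈ Set.Ioo (-1 : ℝ) 1 := fun x hx => by
    rw [Set.uIcc_of_le (by linarith)] at hx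
    have h1 : π / n < π / 2 := by linarith [pi_div_le hn, Real.pi_pos]
    have h2 := Real.strictMonoOn_tan.monotoneOn (a := x) (b := π / n)
      ⟨by linarith [hx.1], by linarith [hx.2]⟩ ⟨by linarith, h1⟩ hx.2
    have h3 := Real.strictMonoOn_tan.monotoneOn (a := -(π / n)) (b := x)
      ⟨by linarith, by linarith⟩ ⟨by linarith [hx.1], by linarith [hx.2]⟩ hx.1
    rw [Real.tan_neg] at h3
    refine ⟨Real.cos_pos_of_mem_Ioo ⟨by linarith [hx.1], by linarith [hx.2]⟩, ?_, ?_⟩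
    · rw [lt_div_iff₀ hs0]; linarith
    · rw [div_lt_iff₀ hs0]; linarith
  have hpos : ∀ x ∈ Set.uIcc (-(π / n)) (π / n),
      0 < s ^ 2 * Real.cos x ^ 2 - Real.sin x ^ 2 := fun x hx => by
    obtain ⟨hc, ht1, ht2⟩ := hcos x hx
    have h1 : (Real.tan x / s) ^ 2 < 1 := (sq_lt_one_iff_abs_lt_one _).2 (abs_lt.2 ⟨ht1, ht2⟩)
    rw [Real.tan_eq_sin_div_cos, div_div, div_pow, div_lt_one (by positivity)] at h1
    nlinarith
  rw [intervalIntegral.integral_eq_sub_of_hasDerivAt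
    (f := fun x => 1 / (2 * s) * Real.artanh (Real.tan x / s))]
  · rw [Real.tan_neg, neg_div, artanh_neg_eq (hcos _ Set.right_mem_uIcc).2]
    field_simp
    ring
  · intro x hx
    obtain ⟨hc, ht⟩ := hcos x hx
    convert! ((hasDerivAt_artanh ht).comp x
      ((Real.hasDerivAt_tan hc.ne').div_const s)).const_mul (1 / (2 * s)) using 1
    have h1 := (hpos x hx).ne'
    rw [Real.tan_eq_sin_div_cos]
    have h2 : 1 - (Real.sin x / Real.cos x / s) ^ 2 =
        (s ^ 2 * Real.cos x ^ 2 - Real.sin x ^ 2) / (s ^ 2 * Real.cos x ^ 2) := by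
      field_simp
    rw [h2]
    field_simp
  · refine ContinuousOn.intervalIntegrable fun x hx => ContinuousAt.continuousWithinAt ?_
    have := (hpos x hx).ne'
    fun_prop (disch := assumption)

end PolygonSlice

/-! ### Cones over regular polygons -/

section PolygonCone

lemma circlePoint_mem_space {X : Geometry} {n : ℕ} {p e₁ e₂ : Fin (n + 1) → ℝ}
    (h : IsTangentFrame X p e₁ e₂) {c : ℝ} (hc : 0 < X.cosX c) (θ : ℝ) :
    circlePoint X p e₁ e₂ c θ ∈ space X n := by
  have hself := form_circlePoint_self h (cosX_sq_add X c) θ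
  cases X
  · exact hself
  · obtain ⟨hp, -, -, -, h1p, h2p⟩ := h
    refine mem_space_of_form_neg hp hself ?_
    rw [form_circlePoint, form_self_of_mem_space hp, form_comm p, form_comm p, h1p, h2p]
    simp only [Geometry.sign]
    linarith

lemma circlePoint_mem_geodesicHull {X : Geometry} {n N : ℕ} {p e₁ e₂ : Fin (n + 1) → ℝ}
    (h : IsTangentFrame X p e₁ e₂) {c : ℝ} (hc : 0 < X.cosX c) (k : Fin N) :
    circlePoint X p e₁ e₂ c (2 * π * k / N) ∈
      geodesicHull X (fun k : Fin N => circlePoint X p e₁ e₂ c (2 * π * k / N)) := by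
  refine ⟨circlePoint_mem_space h hc _, fun j => if j = k then 1 else 0, fun j => ?_, ?_⟩
  · dsimp only
    split_ifs <;> norm_num
  · simp

/-- The vertex at angle `0` gives `⟨o, e₁⟩ = 0`; the next one then gives `⟨o, e₂⟩ = 0`, as `sin
(2π/N) ≠ 0` for `N ≥ 3`. -/
lemma form_eq_zero_of_geodesicHull_subset {X : Geometry} {n N : ℕ} (hN : 3 ≤ N)
    {o p e₁ e₂ : Fin (n + 1) → ℝ} (h : IsTangentFrame X p e₁ e₂) {c : ℝ} (hc : 0 < X.cosX c)
    (hs : 0 < X.sinX c)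
    (hP : geodesicHull X (fun k : Fin N => circlePoint X p e₁ e₂ c (2 * π * k / N)) ⊆
      perpHyperplane X p o) : form X o e₁ = 0 ∧ form X o e₂ = 0 := by
  have hN' : (3 : ℝ) ≤ N := by exact_mod_cast hN
  have key : ∀ k : Fin N, form X o e₁ * Real.cos (2 * π * k / N) +
      form X o e₂ * Real.sin (2 * π * k / N) = 0 := fun k => by
    have h1 := (hP (circlePoint_mem_geodesicHull h hc k)).2
    obtain ⟨hp, -, -, -, h1p, h2p⟩ := h
    have hpp := form_self_of_mem_space hp
    have hpp0 : form X p p ≠ 0 := hpp ▸ sign_ne_zero X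
    rw [form_circlePoint] at h1
    simp only [form_sub_left, form_smul_left, form_comm p e₁, form_comm p e₂, h1p, h2p,
      div_mul_cancel₀ _ hpp0, sub_self, mul_zero, sub_zero, zero_add] at h1
    exact (mul_eq_zero.1 h1).resolve_left hs.ne'
  have h0 : form X o e₁ = 0 := by simpa using key ⟨0, by omega⟩
  refine ⟨h0, ?_⟩
  have h1 := key ⟨1, by omega⟩
  have hsin : 0 < Real.sin (2 * π * ((1 : ℕ) : ℝ) / N) := by
    have := Real.pi_pos
    refine Real.sin_pos_of_pos_of_lt_pi (by positivity) ?_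
    rw [div_lt_iff₀ (by linarith)]
    push_cast
    nlinarith
  rw [h0, zero_mul, zero_add] at h1
  exact (mul_eq_zero.1 h1).resolve_right hsin.ne'

lemma exists_isConeFrame_of_isTangentFrame {X : Geometry} {o p e₁ e₂ : Fin (2 + 1 + 1) → ℝ}
    {h : ℝ} (ho : o ∈ space X (2 + 1)) (hd : gdist X o p = h) (h0 : 0 < h)
    (hπ : X = .spherical → h < π) (he : IsTangentFrame X p e₁ e₂) (ho1 : form X o e₁ = 0)
    (ho2 : form X o e₂ = 0) : ∃ b, IsConeFrame X o p b ![e₁, e₂] h := by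
  obtain ⟨hp, h11, h22, h12, h1p, h2p⟩ := he
  obtain ⟨b, hpb, hbb, hob⟩ := exists_direction ho hp hd h0 hπ
  have hoo := form_self_of_mem_space ho
  have hσ := sign_mul_sign X
  have hS := sinX_pos h0 hπ
  have hb : ∀ e, form X o e = 0 → form X e p = 0 → form X b e = 0 := fun e h1 h2 => by
    rw [hpb, form_add_right, form_smul_right, form_smul_right, form_comm e o, h1, mul_zero,
      zero_add, form_comm e b] at h2
    exact (mul_eq_zero.1 h2).resolve_left hS.ne'
  have hb1 := hb e₁ ho1 h1p
  have hb2 := hb e₂ ho2 h2p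
  -- The four vectors already form a frame; with `m = 0` only the expansion formula is extracted.
  obtain ⟨d, -, -, hrec⟩ := exists_frame (X := X) (n := 2 + 1) (k := 4) (m := 0) rfl
    ![o, b, e₁, e₂] ![X.sign, 1, 1, 1] (by intro i; fin_cases i <;> simp [hσ])
    (by
      intro i j
      fin_cases i <;> fin_cases j <;>
        simp [hoo, hbb, hob, h11, h22, h12, ho1, ho2, hb1, hb2, form_comm b o, form_comm e₁ o,
          form_comm e₂ o, form_comm e₁ b, form_comm e₂ b, form_comm e₂ e₁])
    (fun y hy hy0 => pos_of_form_eq_zero ho (hy 0) hy0)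
  refine ⟨b, ho, hp, h0, hπ, hpb, hbb, hob, ?_, ?_, ?_, fun x => ?_⟩
  · intro i; fin_cases i <;> simp [ho1, ho2]
  · intro i; fin_cases i <;> simp [hb1, hb2]
  · intro i j
    fin_cases i <;> fin_cases j <;> simp [h11, h22, h12, form_comm e₂ e₁]
  · have := hrec x
    simp only [Fin.sum_univ_four, Finset.univ_eq_empty, Finset.sum_empty, add_zero] at this
    simpa [Fin.sum_univ_two, add_assoc] using this

/-- The cone spanned by a regular `N`-gon, in the coordinates of an adapted frame. -/
def polygonBase (X : Geometry) (N : ℕ) (τ h : ℝ) : Set (ℝ × (Fin 2 → ℝ)) :=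
  {q | 0 ≤ q.1 ∧ ∀ k : Fin N, X.sinX h * (q.2 0 * Real.cos ((2 * k + 1) * π / N) +
    q.2 1 * Real.sin ((2 * k + 1) * π / N)) ≤ q.1 * τ}

lemma measurableSet_polygonBase (X : Geometry) (N : ℕ) (τ h : ℝ) :
    MeasurableSet (polygonBase X N τ h) := by
  simp only [polygonBase, Set.ofPred_and, Set.ofPred_forall]
  exact (measurableSet_le measurable_const measurable_fst).inter <| MeasurableSet.iInter fun k =>
    measurableSet_le (by fun_prop) (by fun_prop)

variable {X : Geometry} {o p b : Fin (2 + 1 + 1) → ℝ} {d : Fin 2 → Fin (2 + 1 + 1) → ℝ} {h : ℝ}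

namespace IsConeFrame

lemma ext_form (hf : IsConeFrame X o p b d h) {x y : Fin (2 + 1 + 1) → ℝ}
    (ho : form X x o = form X y o) (hb : form X x b = form X y b)
    (hd : ∀ i, form X x (d i) = form X y (d i)) : x = y := by
  rw [hf.eq_sum x, hf.eq_sum y, ho, hb]
  simp only [hd]

lemma form_sum_circlePoint (hf : IsConeFrame X o p b d h) {N : ℕ} (c : ℝ) (w θ : Fin N → ℝ) :
    form X (∑ k, w k • circlePoint X p (d 0) (d 1) c (θ k)) o =
      X.sign * X.cosX h * X.cosX c * ∑ k, w k ∧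
    form X (∑ k, w k • circlePoint X p (d 0) (d 1) c (θ k)) b =
      X.sinX h * X.cosX c * ∑ k, w k ∧
    form X (∑ k, w k • circlePoint X p (d 0) (d 1) c (θ k)) (d 0) =
      X.sinX c * ∑ k, w k * Real.cos (θ k) ∧
    form X (∑ k, w k • circlePoint X p (d 0) (d 1) c (θ k)) (d 1) =
      X.sinX c * ∑ k, w k * Real.sin (θ k) := by
  have hop : form X o p = X.sign * X.cosX h := by
    rw [hf.form_p, form_self_of_mem_space hf.o_mem, hf.form_o_b]; ring
  simp only [form_sum_left, form_smul_left, form_circlePoint, hop, form_comm b p, hf.form_p_b,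
    form_comm (d _) p, hf.form_p_d, hf.form_o_d, hf.form_b_d, hf.form_d_d, Finset.mul_sum]
  refine ⟨?_, ?_, ?_, ?_⟩ <;> refine Finset.sum_congr rfl fun k _ => ?_ <;> simp <;> ring

/-- Central projection from the origin makes the geodesic polygon a Euclidean one with circumradius
`tan c` (or `tanh c`) and inradius `τ = tan c cos (π/N)`. Each vertex satisfies each side
inequality; conversely, `exists_weights` supplies the nonnegative coefficients. -/
lemma mem_polygonBase_iff (hf : IsConeFrame X o p b d h) {N : ℕ} (hN : 3 ≤ N) {c : ℝ}
    (hc : 0 < X.cosX c) (hs : 0 < X.sinX c) (x : Fin (2 + 1 + 1) → ℝ) :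
    x ∈ geodesicHull X (fun k : Fin N => circlePoint X p (d 0) (d 1) c (2 * π * k / N)) ↔
      x ∈ perpHyperplane X p o ∧ (form X x b, fun i => form X x (d i)) ∈
        polygonBase X N (X.sinX c / X.cosX c * Real.cos (π / N)) h := by
  have hS := hf.sinX_pos
  have hσ := sign_mul_sign X
  rw [hf.mem_perpHyperplane_iff]
  constructor
  · rintro ⟨hx, w, hw, rfl⟩
    obtain ⟨h1, h2, h3, h4⟩ := hf.form_sum_circlePoint c w fun k : Fin N => 2 * π * k / N
    refine ⟨⟨hx, ?_⟩, ?_, fun k => ?_⟩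
    · rw [h1, h2]
      linear_combination (X.sinX h * X.cosX h * X.cosX c * ∑ k, w k) * hσ
    · dsimp only
      rw [h2]
      exact mul_nonneg (by positivity) (Finset.sum_nonneg fun k _ => hw k)
    · dsimp only
      rw [h2, h3, h4]
      have h5 : X.sinX h * X.cosX c * (∑ k, w k) * (X.sinX c / X.cosX c * Real.cos (π / N)) =
          X.sinX h * X.sinX c * ∑ k, w k * Real.cos (π / N) := by
        rw [← Finset.sum_mul]
        field_simp
      have h6 : X.sinX h * (X.sinX c * (∑ j : Fin N, w j * Real.cos (2 * π * j / N)) *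
          Real.cos ((2 * k + 1) * π / N) + X.sinX c * (∑ j : Fin N, w j *
          Real.sin (2 * π * j / N)) * Real.sin ((2 * k + 1) * π / N)) =
          X.sinX h * X.sinX c * ∑ j : Fin N, w j *
            Real.cos (2 * π * j / N - (2 * k + 1) * π / N) := by
        simp only [Real.cos_sub, mul_add, Finset.sum_add_distrib, Finset.mul_sum, Finset.sum_mul]
        congr 1 <;> refine Finset.sum_congr rfl fun j _ => ?_ <;> ring
      rw [h5, h6]
      have h7 : ∀ j : Fin N, Real.cos (2 * π * j / N - (2 * k + 1) * π / N) ≤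
          Real.cos (π / N) := fun j => by
        have h8 := cos_add_two_pi_mul_div_le (n := N) (by omega) (x := -(π / N))
          (by rw [abs_neg, abs_of_pos (pi_div_pos hN)]) ((j : ℤ) - (k : ℤ))
        rw [Real.cos_neg] at h8
        convert! h8 using 2
        push_cast
        ring
      gcongr with j
      · exact hw j
      · exact h7 j
  · rintro ⟨⟨hx, hperp⟩, h1, h2⟩
    dsimp only at h1 h2
    obtain ⟨w, hw, hw1, hwc, hws⟩ := exists_weights hN (v₀ := form X x (d 0))
      (v₁ := form X x (d 1)) (μ := form X x b / X.sinX h * (X.sinX c / X.cosX c)) fun k => by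
        have h3 := h2 k
        rw [← le_div_iff₀' hS] at h3
        refine h3.trans_eq ?_
        ring
    refine ⟨hx, fun k => w k / X.sinX c, fun k => div_nonneg (hw k) hs.le, ?_⟩
    obtain ⟨h4, h5, h6, h7⟩ := hf.form_sum_circlePoint c (fun k => w k / X.sinX c)
      fun k : Fin N => 2 * π * k / N
    simp only [div_mul_eq_mul_div, ← Finset.sum_div, hw1, hwc, hws] at h4 h5 h6 h7
    refine hf.ext_form ?_ ?_ fun i => ?_
    · rw [h4]
      have h8 : form X x o = X.sign * (X.cosX h * form X x b) / X.sinX h := by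
        rw [eq_div_iff hS.ne']
        linear_combination X.sign * hperp - X.sinX h * form X x o * hσ
      rw [h8]
      field_simp
    · rw [h5]
      field_simp
    · fin_cases i
      · simp only [Fin.zero_eta]
        rw [h6]
        field_simp
      · simp only [Fin.mk_one]
        rw [h7]
        field_simp

theorem vol_polygonCone (hf : IsConeFrame X o p b d h) {N : ℕ} (hN : 3 ≤ N) {c τ : ℝ}
    (hc : 0 < X.cosX c) (hs : 0 < X.sinX c) (hτ : τ = X.sinX c / X.cosX c * Real.cos (π / N))
    (hK : ∀ t ∈ Set.Ioc 0 h,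
      0 < (X.sinX h / (X.sinX t * τ)) ^ 2 * Real.cos (π / N) ^ 2 + X.sign) :
    vol X (coneOver X o
      (geodesicHull X fun k : Fin N => circlePoint X p (d 0) (d 1) c (2 * π * k / N))) =
    ∫⁻ t in Set.Ioc 0 h, ENNReal.ofReal (N * ∫ x in -(π / N)..(π / N),
      1 / ((X.sinX h / (X.sinX t * τ)) ^ 2 * Real.cos x ^ 2 + X.sign) / 2) := by
  have hS := hf.sinX_pos
  have hcs := cosX_sq_add X c
  have hcN := cos_pi_div_pos hN
  have hτ0 : 0 < τ := by rw [hτ]; positivity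
  rw [hf.vol_coneOver (measurableSet_polygonBase X N τ h)
    (fun x => hτ ▸ hf.mem_polygonBase_iff hN hc hs x)]
  · refine setLIntegral_congr_fun measurableSet_Ioc fun t ht => ?_
    have hst := hf.sinX_pos_of_mem ht
    rw [← volume_polygonSlice hN (by positivity) (hK t ht)]
    congr 1
    ext v
    refine and_congr_right fun _ => ?_
    have h0 : 0 ≤ √(1 - X.sign * ∑ i, v i ^ 2) * X.sinX t := by positivity
    refine (and_iff_right h0).trans (forall_congr' fun k => ?_)
    rw [div_mul_eq_mul_div, div_le_iff₀ (by positivity), mul_assoc (√_)]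
  · rintro s hs' q ⟨h1, h2⟩
    refine ⟨mul_nonneg hs' h1, fun k => ?_⟩
    have h3 := mul_le_mul_of_nonneg_left (h2 k) hs'
    simp only [Prod.smul_fst, Prod.smul_snd, Pi.smul_apply, smul_eq_mul]
    linarith
  · exact fun q hq => hq.1
  · rintro q ⟨h1, h2⟩ hq
    set T := X.sinX c / X.cosX c with hT
    -- Circumscribed disc; together with `1 + σ T² = 1 / cos² c > 0` it makes the vector
    -- normalizable to a point of the space.
    have h3 : q.2 0 ^ 2 + q.2 1 ^ 2 ≤ (q.1 / X.sinX h * T) ^ 2 := by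
      refine sum_sq_le_of_halfPlanes hN fun k => ?_
      have h3 := h2 k
      rw [← le_div_iff₀' hS, hτ] at h3
      refine h3.trans_eq ?_
      ring
    have hT1 : 0 < 1 + X.sign * T ^ 2 := by
      have : 1 + X.sign * T ^ 2 = 1 / X.cosX c ^ 2 := by
        rw [hT]
        field_simp
        linarith
      rw [this]
      positivity
    have hq1 : 0 < q.1 := by
      refine h1.lt_of_ne fun h0 => hq ?_
      have h4 : q.1 / X.sinX h * T = 0 := by rw [← h0, zero_div, zero_mul]
      rw [h4] at h3
      refine Prod.ext h0.symm (funext fun i => pow_eq_zero_iff two_ne_zero |>.1 ?_)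
      have h5 := sq_nonneg (q.2 0)
      have h6 := sq_nonneg (q.2 1)
      fin_cases i <;> simp only [Fin.zero_eta, Fin.mk_one] <;> linarith
    rw [Fin.sum_univ_two]
    have hη : 0 < (q.1 / X.sinX h) ^ 2 := by positivity
    rw [mul_pow] at h3
    have h4 := mul_pos hη hT1
    cases X
    · simp only [Geometry.sign, one_mul]
      positivity
    · simp only [Geometry.sign] at h4 ⊢
      linarith
  · have h1 := (hf.mem_polygonBase_iff hN hc hs p).2 ⟨hf.p_mem_perpHyperplane, ?_⟩
    · exact h1
    · refine ⟨?_, fun k => ?_⟩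
      · dsimp only
        rw [hf.form_p_b]
        exact hS.le
      · dsimp only
        rw [hf.form_p_b, hf.form_p_d, hf.form_p_d]
        simp only [zero_mul, add_zero, mul_zero]
        positivity

end IsConeFrame

end PolygonCone

/-! ### Explicit formulas for cones over regular polygons -/

section PolygonConeFormulas

/-- The source of the relation `sin (a/2) = sin c sin (π/n)` between side and circumradius. -/
lemma form_circlePoint_consecutive {X : Geometry} {n : ℕ} {p e₁ e₂ : Fin (n + 1) → ℝ}
    (h : IsTangentFrame X p e₁ e₂) (c : ℝ) (N : ℕ) :
    form X (circlePoint X p e₁ e₂ c 0) (circlePoint X p e₁ e₂ c (2 * π / N)) =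
      X.sign - 2 * X.sinX c ^ 2 * Real.sin (π / N) ^ 2 := by
  obtain ⟨hp, h11, h22, h12, h1p, h2p⟩ := h
  rw [form_circlePoint]
  simp only [circlePoint, form_add_left, form_smul_left, form_comm p e₁, form_comm p e₂,
    form_comm e₂ e₁, h11, h22, h12, h1p, h2p, form_self_of_mem_space hp, Real.cos_zero,
    Real.sin_zero]
  have h1 : Real.cos (2 * π / N) = 1 - 2 * Real.sin (π / N) ^ 2 := by
    rw [mul_div_assoc, Real.cos_two_mul]
    linear_combination 2 * Real.sin_sq_add_cos_sq (π / N)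
  rw [h1]
  linear_combination X.sign * cosX_sq_add X c - X.sinX c ^ 2 * sign_mul_sign X

theorem vol_polygonCone_spherical (n : ℕ) (o p : Fin (3 + 1) → ℝ) (P : Set (Fin (3 + 1) → ℝ))
    (a h : ℝ) (hn : 3 ≤ n) (ho : o ∈ space .spherical 3)
    (hd : gdist .spherical o p = h) (h0 : 0 < h) (hπ : h < π)
    (hP : IsRegularPolygon .spherical n a p P) (hPo : P ⊆ perpHyperplane .spherical p o) :
    ∃ b : ℝ, 0 < b ∧ b < π / 2 ∧
      Real.cot b ^ 2 = Real.tan (π / n) ^ 2 * Real.cot (a / 2) ^ 2 - 1 ∧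
      vol .spherical (coneOver .spherical o P) =
        ENNReal.ofReal (∫ t in (0 : ℝ)..h,
          n / √(1 + Real.cot b ^ 2 * Real.sin h ^ 2 * (1 / Real.sin t) ^ 2) *
            Real.arctan (Real.tan (π / n) /
              √(1 + Real.cot b ^ 2 * Real.sin h ^ 2 * (1 / Real.sin t) ^ 2))) := by
  obtain ⟨e₁, e₂, c, he, hc0, hcπ, ha, rfl⟩ := hP
  have hc : 0 < Geometry.spherical.cosX c :=
    Real.cos_pos_of_mem_Ioo ⟨by linarith [Real.pi_pos], hcπ rfl⟩
  have hs : 0 < Geometry.spherical.sinX c :=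
    Real.sin_pos_of_pos_of_lt_pi hc0 (by linarith [hcπ rfl, Real.pi_pos])
  obtain ⟨ho1, ho2⟩ := form_eq_zero_of_geodesicHull_subset hn he hc hs hPo
  obtain ⟨b, hf⟩ := exists_isConeFrame_of_isTangentFrame ho hd h0 (fun _ => hπ) he ho1 ho2
  have hcN := cos_pi_div_pos hn
  have hsN := sin_pi_div_pos hn
  set τ := Geometry.spherical.sinX c / Geometry.spherical.cosX c * Real.cos (π / n) with hτ
  have hτ0 : 0 < τ := by positivity
  have hcot : Real.cot (Real.arctan τ) = 1 / τ := by
    rw [← Real.tan_inv_eq_cot, Real.tan_arctan, one_div]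
  have hS : 0 < Real.sin h := Real.sin_pos_of_pos_of_lt_pi h0 hπ
  -- The witness is the inradius of the polygon: `tan b = tan c cos (π/n)`.
  refine ⟨Real.arctan τ, Real.arctan_pos.2 hτ0, Real.arctan_lt_pi_div_two τ, ?_, ?_⟩
  · have hcs := Real.sin_sq_add_cos_sq c
    have hcsN := Real.sin_sq_add_cos_sq (π / n)
    simp only [Geometry.sinX, Geometry.cosX] at hc hs hτ
    have hform := form_circlePoint_consecutive he c n
    simp only [Geometry.sign, Geometry.sinX] at hform
    have hsc : Real.sin c ^ 2 * Real.sin (π / n) ^ 2 ≤ 1 := by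
      nlinarith [Real.sin_sq_le_one c, Real.sin_sq_le_one (π / n), sq_nonneg (Real.sin c),
        sq_nonneg (Real.sin (π / n))]
    have hcosa : Real.cos a = 1 - 2 * Real.sin c ^ 2 * Real.sin (π / n) ^ 2 := by
      rw [← ha, gdist, hform, Real.cos_arccos (by linarith)]
      nlinarith [sq_nonneg (Real.sin c * Real.sin (π / n))]
    have hsa : Real.sin (a / 2) ^ 2 = Real.sin c ^ 2 * Real.sin (π / n) ^ 2 := by
      rw [Real.sin_sq_eq_half_sub, mul_div_cancel₀ _ two_ne_zero, hcosa]
      ring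
    have hca : Real.cos (a / 2) ^ 2 = 1 - Real.sin c ^ 2 * Real.sin (π / n) ^ 2 := by
      rw [Real.cos_sq', hsa]
    rw [hcot, Real.cot_eq_cos_div_sin, div_pow, div_pow, hsa, hca, Real.tan_eq_sin_div_cos, hτ]
    field_simp
    linear_combination hcs + Real.sin c ^ 2 * hcsN
  · have hvol := hf.vol_polygonCone hn hc hs hτ fun t _ => by
      simp only [Geometry.sign]
      positivity
    simp only [Matrix.cons_val_zero, Matrix.cons_val_one] at hvol
    rw [hvol, hcot]
    simp only [Geometry.sinX, Geometry.sign]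
    have hslice : Set.EqOn (fun t => ENNReal.ofReal (n * ∫ x in -(π / n)..(π / n),
        1 / ((Real.sin h / (Real.sin t * τ)) ^ 2 * Real.cos x ^ 2 + 1) / 2))
        (fun t => ENNReal.ofReal (n / √(1 + (1 / τ) ^ 2 * Real.sin h ^ 2 * (1 / Real.sin t) ^ 2) *
          Real.arctan (Real.tan (π / n) /
            √(1 + (1 / τ) ^ 2 * Real.sin h ^ 2 * (1 / Real.sin t) ^ 2)))) (Set.Ioc 0 h) := by
      intro t _
      dsimp only
      set s := √(1 + (1 / τ) ^ 2 * Real.sin h ^ 2 * (1 / Real.sin t) ^ 2) with hs_def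
      have hs0 : 0 < s := Real.sqrt_pos.2 (by positivity)
      -- With `K² = s² - 1`, the denominator `K² cos² x + 1` becomes `s² cos² x + sin² x`.
      have hs2 : s ^ 2 = 1 + (Real.sin h / (Real.sin t * τ)) ^ 2 := by
        rw [hs_def, Real.sq_sqrt (by positivity)]
        ring
      rw [div_mul_eq_mul_div, ← one_div_mul_eq_div s, mul_left_comm (1 / s) (n : ℝ),
        ← integral_polygonSlice_spherical hn hs0]
      congr 2
      refine intervalIntegral.integral_congr fun x _ => ?_
      congr 2
      linear_combination -Real.sin_sq_add_cos_sq x - Real.cos x ^ 2 * hs2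
    rw [setLIntegral_congr_fun measurableSet_Ioc hslice,
      lintegral_Ioc_ofReal (M := n * (π / 2)) (by fun_prop) h0.le]
    intro t _
    have h1 : 1 ≤ √(1 + (1 / τ) ^ 2 * Real.sin h ^ 2 * (1 / Real.sin t) ^ 2) :=
      Real.one_le_sqrt.2 (by linarith [show 0 ≤ (1 / τ) ^ 2 * Real.sin h ^ 2 *
        (1 / Real.sin t) ^ 2 by positivity])
    have htan : 0 ≤ Real.tan (π / n) := by rw [Real.tan_eq_sin_div_cos]; positivity
    have h2 : 0 ≤ Real.arctan (Real.tan (π / n) /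
        √(1 + (1 / τ) ^ 2 * Real.sin h ^ 2 * (1 / Real.sin t) ^ 2)) :=
      Real.arctan_nonneg.2 (by positivity)
    refine ⟨by positivity, ?_⟩
    gcongr
    · exact div_le_self (by positivity) h1
    · exact (Real.arctan_lt_pi_div_two _).le

lemma measurable_artanh : Measurable Real.artanh := by
  unfold Real.artanh
  fun_prop

theorem vol_polygonCone_hyperbolic (n : ℕ) (o p : Fin (3 + 1) → ℝ) (P : Set (Fin (3 + 1) → ℝ))
    (a h : ℝ) (hn : 3 ≤ n) (ho : o ∈ space .hyperbolic 3)
    (hd : gdist .hyperbolic o p = h) (h0 : 0 < h)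
    (hP : IsRegularPolygon .hyperbolic n a p P) (hPo : P ⊆ perpHyperplane .hyperbolic p o) :
    ∃ b : ℝ, 0 < b ∧
      (Real.cosh b / Real.sinh b) ^ 2 =
        Real.tan (π / n) ^ 2 * (Real.cosh (a / 2) / Real.sinh (a / 2)) ^ 2 + 1 ∧
      vol .hyperbolic (coneOver .hyperbolic o P) =
        ENNReal.ofReal (∫ t in (0 : ℝ)..h,
          n / √(-1 + (Real.cosh b / Real.sinh b) ^ 2 * Real.sinh h ^ 2 *
              (1 / Real.sinh t) ^ 2) *
            Real.artanh (Real.tan (π / n) /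
              √(-1 + (Real.cosh b / Real.sinh b) ^ 2 * Real.sinh h ^ 2 *
                (1 / Real.sinh t) ^ 2))) := by
  obtain ⟨e₁, e₂, c, he, hc0, -, ha, rfl⟩ := hP
  have hc : 0 < Geometry.hyperbolic.cosX c := Real.cosh_pos c
  have hs : 0 < Geometry.hyperbolic.sinX c := Real.sinh_pos_iff.2 hc0
  obtain ⟨ho1, ho2⟩ := form_eq_zero_of_geodesicHull_subset hn he hc hs hPo
  obtain ⟨b, hf⟩ := exists_isConeFrame_of_isTangentFrame ho hd h0 nofun he ho1 ho2
  have hcN := cos_pi_div_pos hn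
  have hsN := sin_pi_div_pos hn
  have hcsN := Real.sin_sq_add_cos_sq (π / n)
  set T := Geometry.hyperbolic.sinX c / Geometry.hyperbolic.cosX c with hT
  have hT0 : 0 < T := by positivity
  have hT1 : T < 1 := (div_lt_one hc).2 (Real.sinh_lt_cosh c)
  set τ := T * Real.cos (π / n) with hτ
  have hτ0 : 0 < τ := by positivity
  have hτ1 : τ < 1 := by nlinarith [Real.cos_le_one (π / n)]
  have hcoth : Real.cosh (Real.artanh τ) / Real.sinh (Real.artanh τ) = 1 / τ := by
    have h1 := Real.tanh_artanh (x := τ) ⟨by linarith, hτ1⟩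
    rw [Real.tanh_eq_sinh_div_cosh] at h1
    rw [← h1, one_div_div, h1]
  have hS : 0 < Real.sinh h := Real.sinh_pos_iff.2 h0
  -- Again the inradius: `tanh b = tanh c cos (π/n)`.
  refine ⟨Real.artanh τ, Real.artanh_pos ⟨hτ0, hτ1⟩, ?_, ?_⟩
  · have hcs := Real.cosh_sq c
    simp only [Geometry.sinX, Geometry.cosX] at hc hs hT
    have hform := form_circlePoint_consecutive he c n
    simp only [Geometry.sign, Geometry.sinX] at hform
    have hcosa : Real.cosh a = 1 + 2 * Real.sinh c ^ 2 * Real.sin (π / n) ^ 2 := by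
      rw [← ha, gdist, hform, Real.cosh_arcosh]
      · ring
      · linarith [show 0 ≤ 2 * Real.sinh c ^ 2 * Real.sin (π / n) ^ 2 by positivity]
    have h2a : Real.cosh a = Real.cosh (a / 2) ^ 2 + Real.sinh (a / 2) ^ 2 := by
      rw [← Real.cosh_two_mul, mul_div_cancel₀ _ two_ne_zero]
    have hsa : Real.sinh (a / 2) ^ 2 = Real.sinh c ^ 2 * Real.sin (π / n) ^ 2 := by
      linarith [Real.cosh_sq (a / 2)]
    have hca : Real.cosh (a / 2) ^ 2 = 1 + Real.sinh c ^ 2 * Real.sin (π / n) ^ 2 := by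
      rw [Real.cosh_sq, hsa, add_comm]
    rw [hcoth, div_pow, div_pow, hsa, hca, Real.tan_eq_sin_div_cos, hτ, hT]
    field_simp
    linear_combination hcs - Real.sinh c ^ 2 * hcsN
  · have hle : ∀ t ∈ Set.Ioc 0 h, 0 < Real.sinh t ∧ 1 ≤ Real.sinh h / Real.sinh t := fun t ht => by
      have h1 := Real.sinh_pos_iff.2 ht.1
      exact ⟨h1, (one_le_div h1).2 (Real.sinh_le_sinh.2 ht.2)⟩
    -- The left side of `hK` decreases in `t`, so the critical case is `t = h`, where the claim
    -- reads `coth² c > 1`.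
    have hK0 : 1 < (1 / τ) ^ 2 * Real.cos (π / n) ^ 2 := by
      have h1 : 1 / τ * Real.cos (π / n) = 1 / T := by rw [hτ]; field_simp
      rw [← mul_pow, h1]
      exact one_lt_pow₀ ((one_lt_div hT0).2 hT1) two_ne_zero
    have hKt : ∀ t ∈ Set.Ioc 0 h, (1 / τ) ^ 2 ≤ (Real.sinh h / (Real.sinh t * τ)) ^ 2 :=
      fun t ht => by
        obtain ⟨h1, h2⟩ := hle t ht
        refine pow_le_pow_left₀ (by positivity) ?_ 2
        rw [← div_div (Real.sinh h), div_eq_mul_one_div (_ / _) τ]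
        exact le_mul_of_one_le_left (by positivity) h2
    have hvol := hf.vol_polygonCone hn hc hs hτ fun t ht => by
      simp only [Geometry.sign, Geometry.sinX]
      nlinarith [hKt t ht, sq_nonneg (Real.cos (π / n))]
    simp only [Matrix.cons_val_zero, Matrix.cons_val_one] at hvol
    rw [hvol, hcoth]
    simp only [Geometry.sinX, Geometry.sign]
    have htan : 0 < Real.tan (π / n) := by rw [Real.tan_eq_sin_div_cos]; positivity
    have htan2 : Real.tan (π / n) ^ 2 < -1 + (1 / τ) ^ 2 := by
      rw [Real.tan_eq_sin_div_cos, div_pow, div_lt_iff₀ (by positivity)]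
      linarith
    have hs_eq : ∀ t, -1 + (1 / τ) ^ 2 * Real.sinh h ^ 2 * (1 / Real.sinh t) ^ 2 =
        -1 + (Real.sinh h / (Real.sinh t * τ)) ^ 2 := fun t => by ring
    have hslice : Set.EqOn (fun t => ENNReal.ofReal (n * ∫ x in -(π / n)..(π / n),
        1 / ((Real.sinh h / (Real.sinh t * τ)) ^ 2 * Real.cos x ^ 2 + -1) / 2))
        (fun t => ENNReal.ofReal (n /
          √(-1 + (1 / τ) ^ 2 * Real.sinh h ^ 2 * (1 / Real.sinh t) ^ 2) *
          Real.artanh (Real.tan (π / n) /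
            √(-1 + (1 / τ) ^ 2 * Real.sinh h ^ 2 * (1 / Real.sinh t) ^ 2)))) (Set.Ioc 0 h) := by
      intro t ht
      dsimp only
      rw [hs_eq t]
      have h1 := hKt t ht
      set s := √(-1 + (Real.sinh h / (Real.sinh t * τ)) ^ 2) with hs_def
      have hs2 : s ^ 2 = -1 + (Real.sinh h / (Real.sinh t * τ)) ^ 2 :=
        Real.sq_sqrt (by linarith [sq_nonneg (Real.tan (π / n))])
      have hs0 : Real.tan (π / n) < s := Real.lt_sqrt_of_sq_lt (by linarith)
      rw [div_mul_eq_mul_div, ← one_div_mul_eq_div s, mul_left_comm (1 / s) (n : ℝ),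
        ← integral_polygonSlice_hyperbolic hn hs0]
      congr 2
      refine intervalIntegral.integral_congr fun x _ => ?_
      congr 2
      linear_combination Real.sin_sq_add_cos_sq x - Real.cos x ^ 2 * hs2
    have hm := measurable_artanh
    have hs0 : Real.tan (π / n) < √(-1 + (1 / τ) ^ 2) := Real.lt_sqrt_of_sq_lt htan2
    have hs1 := htan.trans hs0
    -- The bound `M` is the value of the integrand at `t = h`, where the square root is smallest.
    rw [setLIntegral_congr_fun measurableSet_Ioc hslice,
      lintegral_Ioc_ofReal (M := n / √(-1 + (1 / τ) ^ 2) *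
        Real.artanh (Real.tan (π / n) / √(-1 + (1 / τ) ^ 2))) (by fun_prop) h0.le]
    intro t ht
    rw [hs_eq t]
    have h1 : √(-1 + (1 / τ) ^ 2) ≤ √(-1 + (Real.sinh h / (Real.sinh t * τ)) ^ 2) :=
      Real.sqrt_le_sqrt (by linarith [hKt t ht])
    have h2 : 0 ≤ Real.artanh (Real.tan (π / n) /
        √(-1 + (Real.sinh h / (Real.sinh t * τ)) ^ 2)) := Real.artanh_nonneg (by positivity)
    refine ⟨by positivity, ?_⟩
    gcongr
    refine Real.artanh_le_artanh ?_ ((div_lt_one hs1).2 hs0) (by gcongr)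
    have : 0 ≤ Real.tan (π / n) / √(-1 + (Real.sinh h / (Real.sinh t * τ)) ^ 2) := by positivity
    linarith

end PolygonConeFormulas

end NonEuclid

theorem mainTheorem6 :
    -- solid tori in dimension 3
    (∀ (p e₁ e₂ : Fin (3 + 1) → ℝ) (R r : ℝ), IsTangentFrame .spherical p e₁ e₂ →
      0 < r → r ≤ R → r + R ≤ π →
      vol .spherical (solidTorus .spherical p e₁ e₂ R r) =
        ENNReal.ofReal (2 * π ^ 2 * Real.sin R * Real.sin r ^ 2)) ∧
    (∀ (p e₁ e₂ : Fin (3 + 1) → ℝ) (R r : ℝ), IsTangentFrame .hyperbolic p e₁ e₂ →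
      0 < r → r ≤ R →
      vol .hyperbolic (solidTorus .hyperbolic p e₁ e₂ R r) =
        ENNReal.ofReal (2 * π ^ 2 * Real.sinh R * Real.sinh r ^ 2)) ∧
    -- right circular cones in dimension 3
    (∀ (o p : Fin (3 + 1) → ℝ) (r h : ℝ), o ∈ space .spherical 3 → p ∈ space .spherical 3 →
      gdist .spherical o p = h → 0 < h → h < π / 2 → 0 < r → r < π / 2 →
      vol .spherical (rightBallCone .spherical o p r) =
        ENNReal.ofReal (π * (h - Real.sin h / √(Real.tan r ^ 2 + Real.sin h ^ 2) *
          Real.arctan (√(Real.tan r ^ 2 + Real.sin h ^ 2) / Real.cos h)))) ∧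
    (∀ (o p : Fin (3 + 1) → ℝ) (r h : ℝ), o ∈ space .hyperbolic 3 → p ∈ space .hyperbolic 3 →
      gdist .hyperbolic o p = h → 0 < h → 0 < r →
      vol .hyperbolic (rightBallCone .hyperbolic o p r) =
        ENNReal.ofReal (π * (-h + Real.sinh h / √(Real.tanh r ^ 2 + Real.sinh h ^ 2) *
          Real.artanh (√(Real.tanh r ^ 2 + Real.sinh h ^ 2) / Real.cosh h)))) ∧
    -- right cones over (n - 1)-dimensional balls in dimension n
    (∀ (n : ℕ) (o p : Fin (n + 1) → ℝ) (r h a : ℝ), 1 ≤ n →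
      o ∈ space .spherical n → p ∈ space .spherical n →
      gdist .spherical o p = h → 0 < h → h < π → 0 < r → r ≤ π / 2 →
      a = Real.cot r * Real.sin h →
      vol .spherical (rightBallCone .spherical o p r) =
        ENNReal.ofReal (π ^ (((n : ℝ) - 1) / 2) / Real.Gamma (((n : ℝ) + 1) / 2) *
          ∫ t in (0 : ℝ)..h,
            1 / (a ^ 2 * (1 / Real.sin t) ^ 2 + 1) ^ (((n : ℝ) - 1) / 2))) ∧
    (∀ (n : ℕ) (o p : Fin (n + 1) → ℝ) (r h a : ℝ), 1 ≤ n →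
      o ∈ space .hyperbolic n → p ∈ space .hyperbolic n →
      gdist .hyperbolic o p = h → 0 < h → 0 < r →
      a = Real.cosh r / Real.sinh r * Real.sinh h →
      vol .hyperbolic (rightBallCone .hyperbolic o p r) =
        ENNReal.ofReal (π ^ (((n : ℝ) - 1) / 2) / Real.Gamma (((n : ℝ) + 1) / 2) *
          ∫ t in (0 : ℝ)..h,
            1 / (a ^ 2 * (1 / Real.sinh t) ^ 2 - 1) ^ (((n : ℝ) - 1) / 2))) ∧
    -- right cones over regular n-gons in dimension 3
    (∀ (n : ℕ) (o p : Fin (3 + 1) → ℝ) (P : Set (Fin (3 + 1) → ℝ)) (a h : ℝ), 3 ≤ n →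
      o ∈ space .spherical 3 → p ∈ space .spherical 3 →
      gdist .spherical o p = h → 0 < h → h < π →
      IsRegularPolygon .spherical n a p P → P ⊆ perpHyperplane .spherical p o →
      ∃ b : ℝ, 0 < b ∧ b < π / 2 ∧
        Real.cot b ^ 2 = Real.tan (π / n) ^ 2 * Real.cot (a / 2) ^ 2 - 1 ∧
        vol .spherical (coneOver .spherical o P) =
          ENNReal.ofReal (∫ t in (0 : ℝ)..h,
            n / √(1 + Real.cot b ^ 2 * Real.sin h ^ 2 * (1 / Real.sin t) ^ 2) *
              Real.arctan (Real.tan (π / n) /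
                √(1 + Real.cot b ^ 2 * Real.sin h ^ 2 * (1 / Real.sin t) ^ 2)))) ∧
    (∀ (n : ℕ) (o p : Fin (3 + 1) → ℝ) (P : Set (Fin (3 + 1) → ℝ)) (a h : ℝ), 3 ≤ n →
      o ∈ space .hyperbolic 3 → p ∈ space .hyperbolic 3 →
      gdist .hyperbolic o p = h → 0 < h →
      IsRegularPolygon .hyperbolic n a p P → P ⊆ perpHyperplane .hyperbolic p o →
      ∃ b : ℝ, 0 < b ∧
        (Real.cosh b / Real.sinh b) ^ 2 =
          Real.tan (π / n) ^ 2 * (Real.cosh (a / 2) / Real.sinh (a / 2)) ^ 2 + 1 ∧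
        vol .hyperbolic (coneOver .hyperbolic o P) =
          ENNReal.ofReal (∫ t in (0 : ℝ)..h,
            n / √(-1 + (Real.cosh b / Real.sinh b) ^ 2 * Real.sinh h ^ 2 *
                (1 / Real.sinh t) ^ 2) *
              Real.artanh (Real.tan (π / n) /
                √(-1 + (Real.cosh b / Real.sinh b) ^ 2 * Real.sinh h ^ 2 *
                  (1 / Real.sinh t) ^ 2)))) :=
  ⟨fun _ _ _ _ _ => vol_solidTorus_spherical,
    fun _ _ _ _ _ => vol_solidTorus_hyperbolic,
    vol_rightCone_spherical,
    vol_rightCone_hyperbolic,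
    vol_rightBallCone_spherical,
    vol_rightBallCone_hyperbolic,
    fun n o p P a h hn ho _ => vol_polygonCone_spherical n o p P a h hn ho,
    fun n o p P a h hn ho _ => vol_polygonCone_hyperbolic n o p P a h hn ho⟩
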